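/- Let $k$ be a field of characteristic $0$ and let $\mathcal G$ be the family of all finite simple graphs (including the empty graph). For $G=(V,E)\in\mathcal G$ let $B(G)$ be the lattice of subsets of $V$, and for $U\subseteq V$ let $G|U$ be the induced subgraph on $U$. Let $\mathcal P(\mathcal G)$ be the family of all finite products $[U_1,W_1]\times\dots\times[U_n,W_n]$ of intervals of lattices $B(G_i)$, $G_i\in\mathcal G$, with the relation $$\prod_{i=1}^n[U_i,W_i]\sim\prod_{j=1}^m[U'_j,W'_j]\iff \sum_i G_i|(W_i\setminus U_i)\;\cong\;\sum_j G'_j|(W'_j\setminus U'_j)$$ as graphs, where the sum is the disjoint union. The equivalence classes are called types, and the type of $\prod_i[U_i,W_i]$ is identified with the isomorphism class of the graph $\sum_i G_i|(W_i\setminus U_i)$. The (commutative, reduced) graph incidence algebra $A={\bf I}(\mathcal P(\mathcal G),\sim)$ is the set of all functions from types to $k$, with $$(fg)(\overline{[x,y]})=\sum_{x\le z\le y}f(\overline{[x,z]})\,g(\overline{[z,y]}),$$ topologized by pointwise convergence with $k$ discrete. Let $k$ be the trivial $A$-bimodule, i.e. $A$ acts on both sides through $\varepsilon(f)=f(\overline{[x,x]})$.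 Let $HH^*(A,k)=\bigoplus_{n\ge0}HH^n(A,k)$ be the continuous Hochschild cohomology: the cohomology of the complex of continuous $k$-multilinear maps $A^n\to k$ with the Hochschild differential, with the cup product $(f\cup g)(a_1,\dots,a_{p+q})=f(a_1,\dots,a_p)\,g(a_{p+1},\dots,a_{p+q})$. Let ${\bf C}$ be the free $k$-module on the set of types, and for a nonempty $G=(V,E)\in\mathcal G$ put $$\lambda([G])=\sum_{\pi}(-1)^{|\pi|-1}(|\pi|-1)!\prod_{B\in\pi}[G|B]\in{\bf C},$$ where $\pi$ runs over all partitions of $V$ and the product of isomorphism classes is disjoint union. Let $\widetilde{\mathcal G}_0$ be the set of isomorphism classes of nonempty connected finite simple graphs. Then $HH^*(A,k)$ is a graded commutative algebra with $|\lambda(\widetilde{\mathcal G}_0)|$-many generators: $xy=(-1)^{pq}yx$ for $x\in HH^p(A,k)$ and $y\in HH^q(A,k)$, and there are pairwise distinct elements $\xi_c\in HH^1(A,k)$, $c\in\lambda(\widetilde{\mathcal G}_0)$, which generate $HH^*(A,k)$ as a $k$-algebra, and generate it freely as a graded commutative algebra; that is, $c\mapsto\xi_c$ extends to an isomorphism of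 $k$-algebras from the exterior algebra of the $k$-vector space with basis $\lambda(\widetilde{\mathcal G}_0)$ onto $HH^*(A,k)$. -/

import Mathlib

open scoped Nat DirectSum

noncomputable section

/-! ## Continuous Hochschild cohomology with trivial coefficients -/

namespace Hochschild

/-- An augmentation `ε : A → k` of a topological `k`-algebra that is continuous for the discrete
topology on `k` (for maps into a discrete space, continuous means locally constant). It makes `k`
an `A`-bimodule, `a · c · b = ε a * c * ε b`. -/
structure Augmentation (k : Type*) (A : Type*) [Field k] [Ring A] [Algebra k A]
    [TopologicalSpace A] extends A →ₐ[k] k where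
  isLocallyConstant : IsLocallyConstant toFun

variable {k A : Type*} [Field k] [Ring A] [Algebra k A] [TopologicalSpace A]

instance : CoeFun (Augmentation k A) (fun _ => A → k) := ⟨fun ε => ε.toAlgHom⟩

theorem Augmentation.isLocallyConstant' (ε : Augmentation k A) :
    IsLocallyConstant (fun a => ε a) := ε.isLocallyConstant

variable (k A) in
/-- The continuous Hochschild `n`-cochains of `A` with values in the discrete module `k`: the
`k`-multilinear maps `Aⁿ → k` that are continuous for the product topology on `Aⁿ` and the
discrete topology on `k`. -/
structure Cochain (n : ℕ) where
  toMultilinearMap : MultilinearMap k (fun _ : Fin n => A) k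
  isLocallyConstant : IsLocallyConstant (toMultilinearMap : (Fin n → A) → k)

namespace Cochain

variable {n : ℕ}

instance : CoeFun (Cochain k A n) (fun _ => (Fin n → A) → k) := ⟨fun f => f.toMultilinearMap⟩

theorem toMultilinearMap_injective :
    Function.Injective (toMultilinearMap : Cochain k A n → _) := by
  rintro ⟨f, _⟩ ⟨g, _⟩ (rfl : f = g); rfl

@[ext] theorem ext {f g : Cochain k A n} (h : ∀ a, f a = g a) : f = g :=
  toMultilinearMap_injective (MultilinearMap.ext h)

instance : Zero (Cochain k A n) := ⟨⟨0, IsLocallyConstant.const 0⟩⟩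
instance : Add (Cochain k A n) :=
  ⟨fun f g => ⟨f.1 + g.1, f.2.comp₂ g.2 (fun x y => x + y)⟩⟩
instance : Neg (Cochain k A n) := ⟨fun f => ⟨-f.1, f.2.comp (fun x => -x)⟩⟩
instance : Sub (Cochain k A n) :=
  ⟨fun f g => ⟨f.1 - g.1, f.2.comp₂ g.2 (fun x y => x - y)⟩⟩
instance : SMul k (Cochain k A n) := ⟨fun c f => ⟨c • f.1, f.2.comp (fun x => c * x)⟩⟩
instance : SMul ℕ (Cochain k A n) := ⟨fun c f => ⟨c • f.1, f.2.comp (fun x => c • x)⟩⟩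
instance : SMul ℤ (Cochain k A n) := ⟨fun c f => ⟨c • f.1, f.2.comp (fun x => c • x)⟩⟩

instance : AddCommGroup (Cochain k A n) :=
  toMultilinearMap_injective.addCommGroup _ rfl (fun _ _ => rfl) (fun _ => rfl)
    (fun _ _ => rfl) (fun _ _ => rfl) (fun _ _ => rfl)

instance : Module k (Cochain k A n) :=
  toMultilinearMap_injective.module k ⟨⟨toMultilinearMap, rfl⟩, fun _ _ => rfl⟩ (fun _ _ => rfl)

theorem zero_apply (a : Fin n → A) : (0 : Cochain k A n) a = 0 := rfl

theorem add_apply (f g : Cochain k A n) (a : Fin n → A) : (f + g) a = f a + g a := rfl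

theorem smul_apply (c : k) (f : Cochain k A n) (a : Fin n → A) : (c • f) a = c * f a := rfl

end Cochain

/-- Sends `(a₀, …, aₙ)` to `(a₀, …, aⱼ aⱼ₊₁, …, aₙ)`. -/
def contract {n : ℕ} (j : Fin n) (a : Fin (n + 1) → A) : Fin n → A :=
  Fin.contractNth j.castSucc (· * ·) a

theorem contract_update {n : ℕ} (j : Fin n) [DecidableEq (Fin (n + 1))] [DecidableEq (Fin n)]
    (a : Fin (n + 1) → A) (m : Fin (n + 1)) :
    ∃ (p : Fin n) (L : A →ₗ[k] A), ∀ x,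
      contract j (Function.update a m x) = Function.update (contract j a) p (L x) := by
  rcases lt_trichotomy (m : ℕ) j with h | h | h
  · refine ⟨⟨m, by omega⟩, LinearMap.id, fun x => ?_⟩
    funext i
    simp only [contract, Fin.contractNth, Function.update_apply, Fin.ext_iff,
      Fin.val_castSucc, Fin.val_succ, LinearMap.id_apply]
    split_ifs <;> first | rfl | omega
  · refine ⟨j, LinearMap.mulRight k (a j.succ), fun x => ?_⟩
    funext i
    simp only [contract, Fin.contractNth, Function.update_apply, Fin.ext_iff,
      Fin.val_castSucc, Fin.val_succ, LinearMap.mulRight_apply]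
    split_ifs with h1 h2 h3 h4 h5 <;>
      first | rfl | omega | (have : i = j := Fin.ext (by omega); subst this; rfl)
  · by_cases h' : (m : ℕ) = j + 1
    · refine ⟨j, LinearMap.mulLeft k (a j.castSucc), fun x => ?_⟩
      funext i
      simp only [contract, Fin.contractNth, Function.update_apply, Fin.ext_iff,
        Fin.val_castSucc, Fin.val_succ, LinearMap.mulLeft_apply]
      split_ifs with h1 h2 h3 h4 h5 <;>
        first | rfl | omega | (have : i = j := Fin.ext (by omega); subst this; rfl)
    · refine ⟨⟨m - 1, by omega⟩, LinearMap.id, fun x => ?_⟩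
      funext i
      simp only [contract, Fin.contractNth, Function.update_apply, Fin.ext_iff,
        Fin.val_castSucc, Fin.val_succ, LinearMap.id_apply]
      split_ifs <;> first | rfl | omega

theorem continuous_contract [ContinuousMul A] {n : ℕ} (j : Fin n) :
    Continuous (contract j : (Fin (n + 1) → A) → Fin n → A) := by
  refine continuous_pi fun i => ?_
  simp only [contract, Fin.contractNth]
  split_ifs <;> fun_prop

/-- The Hochschild differential with coefficients in the bimodule `k`, on functions. -/
def dFun (ε : Augmentation k A) {n : ℕ} (f : (Fin n → A) → k) (a : Fin (n + 1) → A) : k :=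
  ε (a 0) * f (Fin.tail a)
    + ∑ j : Fin n, (-1) ^ ((j : ℕ) + 1) * f (contract j a)
    + (-1) ^ (n + 1) * (f (Fin.init a) * ε (a (Fin.last n)))

theorem map_add_contract {n : ℕ} [DecidableEq (Fin (n + 1))] (f : Cochain k A n) (j : Fin n)
    (a : Fin (n + 1) → A) (m : Fin (n + 1)) (x y : A) :
    f (contract j (Function.update a m (x + y))) =
      f (contract j (Function.update a m x)) + f (contract j (Function.update a m y)) := by
  obtain ⟨p, L, h⟩ := contract_update (k := k) j a m
  rw [h, h, h, map_add, f.1.map_update_add]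

theorem map_smul_contract {n : ℕ} [DecidableEq (Fin (n + 1))] (f : Cochain k A n) (j : Fin n)
    (a : Fin (n + 1) → A) (m : Fin (n + 1)) (c : k) (x : A) :
    f (contract j (Function.update a m (c • x))) =
      c • f (contract j (Function.update a m x)) := by
  obtain ⟨p, L, h⟩ := contract_update (k := k) j a m
  rw [h, h, map_smul, f.1.map_update_smul]

variable [ContinuousMul A] (ε : Augmentation k A)

/-- The Hochschild differential `d : Cⁿ → Cⁿ⁺¹` on continuous cochains:
`(d f)(a₀, …, aₙ) = ε(a₀) f(a₁, …, aₙ) + ∑ⱼ (-1)ʲ⁺¹ f(…, aⱼ aⱼ₊₁, …)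
  + (-1)ⁿ⁺¹ f(a₀, …, aₙ₋₁) ε(aₙ)`. -/
def d (n : ℕ) : Cochain k A n →ₗ[k] Cochain k A (n + 1) where
  toFun f :=
    ⟨{  toFun := dFun ε f
        map_update_add' := by
          intro inst a m x y
          obtain rfl : inst = instDecidableEqFin (n + 1) := Subsingleton.elim _ _
          have h1 : ε (Function.update a m (x + y) 0) * f (Fin.tail (Function.update a m (x + y)))
              = ε (Function.update a m x 0) * f (Fin.tail (Function.update a m x))
              + ε (Function.update a m y 0) * f (Fin.tail (Function.update a m y)) := by
            induction m using Fin.cases with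
            | zero =>
              simp only [Function.update_self, Fin.tail_update_zero, map_add, add_mul]
            | succ i =>
              simp only [Fin.tail_update_succ, f.1.map_update_add, mul_add,
                Function.update_of_ne (Fin.succ_ne_zero i).symm]
          have h2 : f (Fin.init (Function.update a m (x + y)))
                * ε (Function.update a m (x + y) (Fin.last n))
              = f (Fin.init (Function.update a m x)) * ε (Function.update a m x (Fin.last n))
              + f (Fin.init (Function.update a m y)) * ε (Function.update a m y (Fin.last n)) := by
            induction m using Fin.lastCases with
            | last =>
              simp only [Function.update_self, Fin.init_update_last, map_add, mul_add]
            | cast i =>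
              simp only [Fin.init_update_castSucc, f.1.map_update_add, add_mul,
                Function.update_of_ne (Fin.castSucc_lt_last i).ne']
          simp only [dFun, h1, h2, map_add_contract, mul_add, Finset.sum_add_distrib]
          ring
        map_update_smul' := by
          intro inst a m c x
          obtain rfl : inst = instDecidableEqFin (n + 1) := Subsingleton.elim _ _
          have h1 : ε (Function.update a m (c • x) 0) * f (Fin.tail (Function.update a m (c • x)))
              = c * (ε (Function.update a m x 0) * f (Fin.tail (Function.update a m x))) := by
            induction m using Fin.cases with
            | zero =>
              simp only [Function.update_self, Fin.tail_update_zero, map_smul, smul_eq_mul]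
              ring
            | succ i =>
              simp only [Fin.tail_update_succ, f.1.map_update_smul, smul_eq_mul,
                Function.update_of_ne (Fin.succ_ne_zero i).symm]
              ring
          have h2 : f (Fin.init (Function.update a m (c • x)))
                * ε (Function.update a m (c • x) (Fin.last n))
              = c * (f (Fin.init (Function.update a m x))
                * ε (Function.update a m x (Fin.last n))) := by
            induction m using Fin.lastCases with
            | last =>
              simp only [Function.update_self, Fin.init_update_last, map_smul, smul_eq_mul]
              ring
            | cast i =>
              simp only [Fin.init_update_castSucc, f.1.map_update_smul, smul_eq_mul,
                Function.update_of_ne (Fin.castSucc_lt_last i).ne']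
              ring
          simp only [dFun, h1, h2, map_smul_contract, smul_eq_mul, mul_add, Finset.mul_sum]
          congr 1
          · congr 1
            exact Finset.sum_congr rfl fun _ _ => by ring
          · ring }, by
      have hf : IsLocallyConstant (f.1 : (Fin n → A) → k) := f.2
      have hε := ε.isLocallyConstant'
      have e1 : IsLocallyConstant fun a : Fin (n + 1) → A => ε (a 0) * f (Fin.tail a) :=
        (hε.comp_continuous (continuous_apply 0)).comp₂
          (hf.comp_continuous (continuous_pi fun i => continuous_apply i.succ)) (· * ·)
      have e2 (j : Fin n) : IsLocallyConstant fun a : Fin (n + 1) → A =>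
          (-1) ^ ((j : ℕ) + 1) * f (contract j a) :=
        (hf.comp_continuous (continuous_contract j)).comp (fun x => (-1) ^ ((j : ℕ) + 1) * x)
      have e3 : IsLocallyConstant fun a : Fin (n + 1) → A =>
          (-1) ^ (n + 1) * (f (Fin.init a) * ε (a (Fin.last n))) :=
        (hf.comp_continuous (continuous_pi fun i => continuous_apply i.castSucc)).comp₂
          (hε.comp_continuous (continuous_apply (Fin.last n)))
          (fun x y => (-1) ^ (n + 1) * (x * y))
      have e4 : ∀ s : Finset (Fin n), IsLocallyConstant fun a : Fin (n + 1) → A =>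
          ∑ j ∈ s, (-1) ^ ((j : ℕ) + 1) * f (contract j a) := by
        intro s
        induction s using Finset.induction_on with
        | empty => exact IsLocallyConstant.const (0 : k)
        | insert j s hj ih =>
          simp only [Finset.sum_insert hj]
          exact (e2 j).comp₂ ih (· + ·)
      exact (e1.comp₂ (e4 Finset.univ) (· + ·)).comp₂ e3 (· + ·)⟩
  map_add' f g := by
    ext a
    change dFun ε (fun b => f b + g b) a = dFun ε f a + dFun ε g a
    simp only [dFun, mul_add, add_mul, Finset.sum_add_distrib]
    ring
  map_smul' c f := by
    ext a
    change dFun ε (fun b => c * f b) a = c * dFun ε f a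
    simp only [dFun, mul_add, Finset.mul_sum]
    congr 1
    · congr 1
      · ring
      · exact Finset.sum_congr rfl fun _ _ => by ring
    · ring

theorem d_apply {n : ℕ} (f : Cochain k A n) (a : Fin (n + 1) → A) : d ε n f a = dFun ε f a := rfl

/-- Cocycles. -/
def cocycles (n : ℕ) : Submodule k (Cochain k A n) := LinearMap.ker (d ε n)

/-- Coboundaries. -/
def coboundaries : (n : ℕ) → Submodule k (Cochain k A n)
  | 0 => ⊥
  | n + 1 => LinearMap.range (d ε n)

/-- The continuous Hochschild cohomology group `HHⁿ(A, k)`: cocycles modulo coboundaries. -/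
def HH (n : ℕ) : Type _ := cocycles ε n ⧸ (coboundaries ε n).comap (cocycles ε n).subtype

instance (n : ℕ) : AddCommGroup (HH ε n) :=
  inferInstanceAs (AddCommGroup (_ ⧸ (coboundaries ε n).comap (cocycles ε n).subtype))

instance (n : ℕ) : Module k (HH ε n) :=
  inferInstanceAs (Module k (_ ⧸ (coboundaries ε n).comap (cocycles ε n).subtype))

/-- The cohomology class of a cocycle. -/
def HH.mk (n : ℕ) : cocycles ε n →ₗ[k] HH ε n :=
  ((coboundaries ε n).comap (cocycles ε n).subtype).mkQ

theorem HH.mk_surjective (n : ℕ) : Function.Surjective (HH.mk ε n) :=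
  Submodule.mkQ_surjective _

theorem HH.mk_eq_zero {n : ℕ} (f : cocycles ε n) : HH.mk ε n f = 0 ↔ f.1 ∈ coboundaries ε n :=
  Submodule.Quotient.mk_eq_zero _

/-- The cup product of cochains,
`(f ∪ g)(a₁, …, a_{p+q}) = f(a₁, …, a_p) g(a_{p+1}, …, a_{p+q})`. -/
def cup {p q : ℕ} (f : Cochain k A p) (g : Cochain k A q) : Cochain k A (p + q) :=
  ⟨{  toFun := fun a => f (fun i => a (Fin.castAdd q i)) * g (fun j => a (Fin.natAdd p j))
      map_update_add' := by
        intro _ a m x y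
        induction m using Fin.addCases with
        | left i =>
          have h1 (z : A) : (fun i' => Function.update a (Fin.castAdd q i) z (Fin.castAdd q i'))
              = Function.update (fun i' => a (Fin.castAdd q i')) i z := by
            funext i'; simp only [Function.update_apply, Fin.ext_iff, Fin.val_castAdd]
          have h2 (z : A) : (fun j => Function.update a (Fin.castAdd q i) z (Fin.natAdd p j))
              = fun j => a (Fin.natAdd p j) := by
            funext j
            exact Function.update_of_ne (by simp only [ne_eq, Fin.ext_iff, Fin.val_castAdd, Fin.val_natAdd]; omega) _ _
          simp only [h1, h2, f.1.map_update_add, add_mul]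
        | right i =>
          have h1 (z : A) : (fun i' => Function.update a (Fin.natAdd p i) z (Fin.natAdd p i'))
              = Function.update (fun i' => a (Fin.natAdd p i')) i z := by
            funext i'; simp [Function.update_apply, Fin.ext_iff]
          have h2 (z : A) : (fun j => Function.update a (Fin.natAdd p i) z (Fin.castAdd q j))
              = fun j => a (Fin.castAdd q j) := by
            funext j
            exact Function.update_of_ne (by simp only [ne_eq, Fin.ext_iff, Fin.val_castAdd, Fin.val_natAdd]; omega) _ _
          simp only [h1, h2, g.1.map_update_add, mul_add]
      map_update_smul' := by
        intro _ a m c x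
        induction m using Fin.addCases with
        | left i =>
          have h1 (z : A) : (fun i' => Function.update a (Fin.castAdd q i) z (Fin.castAdd q i'))
              = Function.update (fun i' => a (Fin.castAdd q i')) i z := by
            funext i'; simp only [Function.update_apply, Fin.ext_iff, Fin.val_castAdd]
          have h2 (z : A) : (fun j => Function.update a (Fin.castAdd q i) z (Fin.natAdd p j))
              = fun j => a (Fin.natAdd p j) := by
            funext j
            exact Function.update_of_ne (by simp only [ne_eq, Fin.ext_iff, Fin.val_castAdd, Fin.val_natAdd]; omega) _ _
          simp only [h1, h2, f.1.map_update_smul, smul_eq_mul]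
          ring
        | right i =>
          have h1 (z : A) : (fun i' => Function.update a (Fin.natAdd p i) z (Fin.natAdd p i'))
              = Function.update (fun i' => a (Fin.natAdd p i')) i z := by
            funext i'; simp [Function.update_apply, Fin.ext_iff]
          have h2 (z : A) : (fun j => Function.update a (Fin.natAdd p i) z (Fin.castAdd q j))
              = fun j => a (Fin.castAdd q j) := by
            funext j
            exact Function.update_of_ne (by simp only [ne_eq, Fin.ext_iff, Fin.val_castAdd, Fin.val_natAdd]; omega) _ _
          simp only [h1, h2, g.1.map_update_smul, smul_eq_mul]
          ring }, by
    have hf : IsLocallyConstant (f.1 : (Fin p → A) → k) := f.2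
    have hg : IsLocallyConstant (g.1 : (Fin q → A) → k) := g.2
    exact (hf.comp_continuous (continuous_pi fun i => continuous_apply (Fin.castAdd q i))).comp₂
      (hg.comp_continuous (continuous_pi fun j => continuous_apply (Fin.natAdd p j))) (· * ·)⟩

theorem cup_apply {p q : ℕ} (f : Cochain k A p) (g : Cochain k A q) (a : Fin (p + q) → A) :
    cup f g a = f (fun i => a (Fin.castAdd q i)) * g (fun j => a (Fin.natAdd p j)) := rfl

/-- The graded Leibniz rule, evaluated at a tuple. -/
theorem d_cup_apply {p q : ℕ} (f : Cochain k A p) (g : Cochain k A q)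
    (a : Fin (p + q + 1) → A) :
    d ε (p + q) (cup f g) a =
      d ε p f (fun i => a ⟨i, by omega⟩) * g (fun j => a ⟨p + 1 + j, by omega⟩)
      + (-1) ^ p * (f (fun i => a ⟨i, by omega⟩) * d ε q g (fun j => a ⟨p + j, by omega⟩)) := by
  set a₁ : Fin (p + 1) → A := fun i => a ⟨i, by omega⟩ with ha₁
  set a₂ : Fin q → A := fun j => a ⟨p + 1 + j, by omega⟩ with ha₂
  set b₁ : Fin p → A := fun i => a ⟨i, by omega⟩ with hb₁
  set b₂ : Fin (q + 1) → A := fun j => a ⟨p + j, by omega⟩ with hb₂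
  have eq_a {x y : Fin (p + q + 1)} (h : (x : ℕ) = y) : a x = a y := congrArg a (Fin.ext h)
  have e1 : (fun i => Fin.tail a (Fin.castAdd q i)) = Fin.tail a₁ := rfl
  have e2 : (fun j => Fin.tail a (Fin.natAdd p j)) = a₂ := by
    funext j; exact eq_a (by simp; omega)
  have e3 (i : Fin p) : (fun i' => contract (Fin.castAdd q i) a (Fin.castAdd q i')) =
      contract i a₁ := rfl
  have e4 (i : Fin p) : (fun j => contract (Fin.castAdd q i) a (Fin.natAdd p j)) = a₂ := by
    funext j
    simp only [contract, Fin.contractNth, Fin.val_castSucc, Fin.val_castAdd, Fin.val_natAdd]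
    rw [if_neg (by omega), if_neg (by omega)]
    exact eq_a (by simp; omega)
  have e5 (j : Fin q) : (fun i => contract (Fin.natAdd p j) a (Fin.castAdd q i)) = b₁ := by
    funext i
    simp only [contract, Fin.contractNth, Fin.val_castSucc, Fin.val_castAdd, Fin.val_natAdd]
    rw [if_pos (by omega)]
    rfl
  have e6 (j : Fin q) : (fun j' => contract (Fin.natAdd p j) a (Fin.natAdd p j')) =
      contract j b₂ := by
    funext j'
    simp only [contract, Fin.contractNth, Fin.val_castSucc, Fin.val_natAdd,
      add_lt_add_iff_left, add_right_inj]
    rfl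
  have e7 : (fun i => Fin.init a (Fin.castAdd q i)) = b₁ := rfl
  have e8 : (fun j => Fin.init a (Fin.natAdd p j)) = Fin.init b₂ := rfl
  have e9 : Fin.init a₁ = b₁ := rfl
  have e10 : Fin.tail b₂ = a₂ := by
    funext j; exact eq_a (by simp; omega)
  have e11 : a₁ 0 = a 0 := rfl
  have e12 : a₁ (Fin.last p) = b₂ 0 := rfl
  have e13 : b₂ (Fin.last q) = a (Fin.last (p + q)) := rfl
  simp only [d_apply, dFun, cup_apply, Fin.sum_univ_add, e1, e2, e3, e4, e5, e6, e7, e8, e9, e10,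
    e11, e12, e13, Fin.val_castAdd, Fin.val_natAdd, add_mul, mul_add, Finset.sum_mul,
    Finset.mul_sum]
  have s1 : ∀ i : Fin p, (-1 : k) ^ ((i : ℕ) + 1) * (f (contract i a₁) * g a₂) =
      (-1) ^ ((i : ℕ) + 1) * f (contract i a₁) * g a₂ := fun i => by ring
  have s2 : ∀ j : Fin q, (-1 : k) ^ (p + (j : ℕ) + 1) * (f b₁ * g (contract j b₂)) =
      (-1) ^ p * (f b₁ * ((-1) ^ ((j : ℕ) + 1) * g (contract j b₂))) := fun j => by ring
  rw [Finset.sum_congr rfl fun i _ => s1 i, Finset.sum_congr rfl fun j _ => s2 j]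
  ring

theorem cup_add_left {p q : ℕ} (f f' : Cochain k A p) (g : Cochain k A q) :
    cup (f + f') g = cup f g + cup f' g := by
  ext a; exact add_mul _ _ _

theorem cup_add_right {p q : ℕ} (f : Cochain k A p) (g g' : Cochain k A q) :
    cup f (g + g') = cup f g + cup f g' := by
  ext a; exact mul_add _ _ _

theorem cup_smul_left {p q : ℕ} (c : k) (f : Cochain k A p) (g : Cochain k A q) :
    cup (c • f) g = c • cup f g := by
  ext a; exact mul_assoc _ _ _

theorem cup_smul_right {p q : ℕ} (c : k) (f : Cochain k A p) (g : Cochain k A q) :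
    cup f (c • g) = c • cup f g := by
  ext a; exact mul_left_comm _ _ _

theorem cup_mem_cocycles {p q : ℕ} {f : Cochain k A p} {g : Cochain k A q}
    (hf : f ∈ cocycles ε p) (hg : g ∈ cocycles ε q) : cup f g ∈ cocycles ε (p + q) := by
  rw [cocycles, LinearMap.mem_ker] at *
  ext a
  rw [d_cup_apply, hf, hg]
  simp only [Cochain.zero_apply, zero_mul, mul_zero, add_zero]

theorem cup_mem_coboundaries_right {p q : ℕ} {f : Cochain k A p} {g : Cochain k A q}
    (hf : f ∈ cocycles ε p) (hg : g ∈ coboundaries ε q) : cup f g ∈ coboundaries ε (p + q) := by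
  cases q with
  | zero =>
    rw [(Submodule.mem_bot k).1 hg]
    convert Submodule.zero_mem _
    ext a; exact mul_zero _
  | succ q =>
    obtain ⟨h, rfl⟩ := hg
    refine ⟨(-1 : k) ^ p • cup f h, ?_⟩
    rw [cocycles, LinearMap.mem_ker] at hf
    rw [map_smul]
    ext a
    refine (congrArg ((-1 : k) ^ p * ·) (d_cup_apply ε f h a)).trans ?_
    simp only [hf, Cochain.zero_apply]
    rw [zero_mul, zero_add, ← mul_assoc, ← mul_pow, neg_one_mul, neg_neg, one_pow, one_mul]
    rfl

/-- Reindexing along an equality of degrees. -/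
theorem mem_coboundaries_of_eq {m n : ℕ} (e : m = n) {f : Cochain k A m} {g : Cochain k A n}
    (h : ∀ a : Fin m → A, f a = g (fun i => a (Fin.cast e.symm i)))
    (hf : f ∈ coboundaries ε m) : g ∈ coboundaries ε n := by
  subst e
  have : f = g := Cochain.ext h
  rwa [← this]

theorem cup_mem_coboundaries_left {p q : ℕ} {f : Cochain k A p} {g : Cochain k A q}
    (hf : f ∈ coboundaries ε p) (hg : g ∈ cocycles ε q) : cup f g ∈ coboundaries ε (p + q) := by
  cases p with
  | zero =>
    rw [(Submodule.mem_bot k).1 hf]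
    convert Submodule.zero_mem _
    ext a; exact zero_mul _
  | succ p =>
    obtain ⟨h, rfl⟩ := hf
    rw [cocycles, LinearMap.mem_ker] at hg
    refine mem_coboundaries_of_eq ε (m := p + q + 1) (by omega) (f := d ε (p + q) (cup h g))
      (fun a => ?_) ⟨_, rfl⟩
    rw [d_cup_apply, hg]
    change d ε p h _ * g _ + _ * (_ * 0) = d ε p h _ * g _
    rw [mul_zero, mul_zero, add_zero]
    rfl

/-- The cup product of cohomology classes. -/
def cupHH (p q : ℕ) : HH ε p →ₗ[k] HH ε q →ₗ[k] HH ε (p + q) :=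
  LinearMap.flip <| Submodule.liftQ _
    (LinearMap.flip <| Submodule.liftQ _
      (LinearMap.mk₂ k (fun (f : cocycles ε p) (g : cocycles ε q) =>
          HH.mk ε (p + q) ⟨cup f.1 g.1, cup_mem_cocycles ε f.2 g.2⟩)
        (fun f f' g => by
          rw [← map_add]; exact congrArg _ (Subtype.ext (cup_add_left _ _ _)))
        (fun c f g => by
          rw [← map_smul]; exact congrArg _ (Subtype.ext (cup_smul_left _ _ _)))
        (fun f g g' => by
          rw [← map_add]; exact congrArg _ (Subtype.ext (cup_add_right _ _ _)))
        (fun c f g => by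
          rw [← map_smul]; exact congrArg _ (Subtype.ext (cup_smul_right _ _ _))))
      (fun f hf => LinearMap.ext fun g =>
        (HH.mk_eq_zero ε _).2 (cup_mem_coboundaries_left ε hf g.2)))
    (fun g hg => by
      refine LinearMap.ext fun x => ?_
      obtain ⟨f, rfl⟩ := HH.mk_surjective ε p x
      exact (HH.mk_eq_zero ε _).2 (cup_mem_coboundaries_right ε f.2 hg))

theorem cupHH_mk {p q : ℕ} (f : cocycles ε p) (g : cocycles ε q) :
    cupHH ε p q (HH.mk ε p f) (HH.mk ε q g) =
      HH.mk ε (p + q) ⟨cup f.1 g.1, cup_mem_cocycles ε f.2 g.2⟩ := rfl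

/-- The unit: the class of the `0`-cochain `1`. -/
def oneCocycle : cocycles ε 0 :=
  ⟨⟨MultilinearMap.constOfIsEmpty k (fun _ : Fin 0 => A) 1, IsLocallyConstant.const 1⟩, by
    refine LinearMap.mem_ker.2 (Cochain.ext fun a => ?_)
    change ε (a 0) * 1 + ∑ j : Fin 0, _ + (-1) ^ (0 + 1) * (1 * ε (a 0)) = 0
    rw [Finset.univ_eq_empty, Finset.sum_empty]
    ring⟩

theorem gradedMk_eq {m n : ℕ} (e : m = n) (f : cocycles ε m) (g : cocycles ε n)
    (h : ∀ a : Fin m → A, f.1 a = g.1 (fun i => a (Fin.cast e.symm i))) :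
    GradedMonoid.mk (A := HH ε) m (HH.mk ε m f) = GradedMonoid.mk n (HH.mk ε n g) := by
  subst e
  have : f = g := Subtype.ext (Cochain.ext h)
  rw [this]

instance instGMul : GradedMonoid.GMul (HH ε) := ⟨fun x y => cupHH ε _ _ x y⟩

instance instGOne : GradedMonoid.GOne (HH ε) := ⟨HH.mk ε 0 (oneCocycle ε)⟩

instance : DirectSum.GRing (HH ε) where
  mul := (instGMul ε).mul
  mul_zero x := map_zero _
  zero_mul x := LinearMap.map_zero₂ _ _
  mul_add x y z := map_add _ _ _
  add_mul x y z := LinearMap.map_add₂ _ _ _ _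
  one := (instGOne ε).one
  one_mul := by
    rintro ⟨n, x⟩
    obtain ⟨f, rfl⟩ := HH.mk_surjective ε n x
    exact gradedMk_eq ε (zero_add n) _ f fun a =>
      (one_mul _).trans (congrArg f.1 (funext fun i => congrArg a (Fin.ext (by simp))))
  mul_one := by
    rintro ⟨n, x⟩
    obtain ⟨f, rfl⟩ := HH.mk_surjective ε n x
    exact gradedMk_eq ε (add_zero n) _ f fun a => mul_one _
  mul_assoc := by
    rintro ⟨l, x⟩ ⟨m, y⟩ ⟨n, z⟩
    obtain ⟨f, rfl⟩ := HH.mk_surjective ε l x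
    obtain ⟨g, rfl⟩ := HH.mk_surjective ε m y
    obtain ⟨h, rfl⟩ := HH.mk_surjective ε n z
    refine gradedMk_eq ε (add_assoc l m n)
      ⟨cup (cup f.1 g.1) h.1, cup_mem_cocycles ε (cup_mem_cocycles ε f.2 g.2) h.2⟩
      ⟨cup f.1 (cup g.1 h.1), cup_mem_cocycles ε f.2 (cup_mem_cocycles ε g.2 h.2)⟩ fun a => ?_
    refine (mul_assoc _ _ _).trans ?_
    refine congrArg₂ (· * ·) rfl (congrArg₂ (· * ·) rfl ?_)
    exact congrArg h.1 (funext fun i => congrArg a (Fin.ext (by simp; omega)))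
  natCast n := n • HH.mk ε 0 (oneCocycle ε)
  natCast_zero := zero_smul _ _
  natCast_succ n := succ_nsmul _ _
  intCast n := n • HH.mk ε 0 (oneCocycle ε)
  intCast_ofNat n := natCast_zsmul _ _
  intCast_negSucc_ofNat n := negSucc_zsmul _ _

theorem gMul_mk {p q : ℕ} (f : cocycles ε p) (g : cocycles ε q) :
    GradedMonoid.GMul.mul (A := HH ε) (HH.mk ε p f) (HH.mk ε q g) =
      HH.mk ε (p + q) ⟨cup f.1 g.1, cup_mem_cocycles ε f.2 g.2⟩ := rfl

instance : DirectSum.GAlgebra k (HH ε) where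
  toFun := (LinearMap.toSpanSingleton k (HH ε 0) (HH.mk ε 0 (oneCocycle ε))).toAddMonoidHom
  map_one := one_smul k (HH.mk ε 0 (oneCocycle ε))
  map_mul r s := by
    refine gradedMk_eq ε rfl ((r * s) • oneCocycle ε)
      ⟨cup (r • oneCocycle ε).1 (s • oneCocycle ε).1, cup_mem_cocycles ε (r • oneCocycle ε).2 (s • oneCocycle ε).2⟩ fun a => ?_
    change r * s * 1 = (r * 1) * (s * 1)
    ring
  commutes r x := by
    obtain ⟨n, x⟩ := x
    obtain ⟨f, rfl⟩ := HH.mk_surjective ε n x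
    refine gradedMk_eq ε (add_comm 0 n)
      ⟨cup (r • oneCocycle ε).1 f.1, cup_mem_cocycles ε (r • oneCocycle ε).2 f.2⟩
      ⟨cup f.1 (r • oneCocycle ε).1, cup_mem_cocycles ε f.2 (r • oneCocycle ε).2⟩ fun a => ?_
    refine (mul_comm _ _).trans (congrArg₂ (· * ·) ?_ rfl)
    exact congrArg f.1 (funext fun i => congrArg a (Fin.ext (by simp)))
  smul_def r x := by
    obtain ⟨n, x⟩ := x
    obtain ⟨f, rfl⟩ := HH.mk_surjective ε n x
    refine gradedMk_eq ε (zero_add n).symm (r • f)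
      ⟨cup (r • oneCocycle ε).1 f.1, cup_mem_cocycles ε (r • oneCocycle ε).2 f.2⟩ fun a => ?_
    change r * f.1 a = (r * 1) * _
    rw [mul_one]
    exact congrArg (r * f.1 ·) (funext fun i => congrArg a (Fin.ext (by simp)))

/-- The continuous Hochschild cohomology algebra `HH*(A, k) = ⨁ₙ HHⁿ(A, k)`, a graded
`k`-algebra under the cup product. -/
abbrev Cohomology : Type _ := ⨁ n, HH ε n

end Hochschild

/-! ## The commutative reduced graph incidence algebra -/

namespace GraphIncidence

/-- A finite simple graph. -/
structure FinGraph where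
  V : Type
  [finite : Finite V]
  graph : SimpleGraph V

instance (G : FinGraph) : Finite G.V := G.finite

/-- The sum (disjoint union) of a family of graphs. -/
def sumGraph {ι : Type} {V : ι → Type} (G : ∀ i, SimpleGraph (V i)) :
    SimpleGraph (Σ i, V i) where
  Adj x y := ∃ h : x.1 = y.1, (G y.1).Adj (h ▸ x.2) y.2
  symm := ⟨by
    rintro ⟨i, a⟩ ⟨j, b⟩ ⟨h, hab⟩
    obtain rfl : i = j := h
    exact ⟨rfl, hab.symm⟩⟩
  loopless := ⟨by
    rintro ⟨i, a⟩ ⟨_, h⟩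
    exact (G i).loopless.irrefl a h⟩

theorem sumGraph_adj {ι : Type} {V : ι → Type} (G : ∀ i, SimpleGraph (V i)) {i : ι} (a b : V i) :
    (sumGraph G).Adj ⟨i, a⟩ ⟨i, b⟩ ↔ (G i).Adj a b :=
  ⟨fun ⟨_, h⟩ => h, fun h => ⟨rfl, h⟩⟩

/-- A finite product of intervals `[U₁, W₁] × ⋯ × [Uₙ, Wₙ]`, where `[Uᵢ, Wᵢ]` is an interval of
the lattice `B(Gᵢ)` of subsets of the vertex set of a finite simple graph `Gᵢ`. -/
structure IntervalProduct where
  ι : Type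
  [finite : Finite ι]
  G : ι → FinGraph
  bot : ∀ i, Set (G i).V
  top : ∀ i, Set (G i).V
  le : bot ≤ top

namespace IntervalProduct

instance (X : IntervalProduct) : Finite X.ι := X.finite

/-- The poset `[U₁, W₁] × ⋯ × [Uₙ, Wₙ]`. -/
abbrev Elem (X : IntervalProduct) : Type := {z : ∀ i, Set (X.G i).V // X.bot ≤ z ∧ z ≤ X.top}

instance (X : IntervalProduct) : Fintype X.Elem := Fintype.ofFinite _

/-- The interval `[0, z]` of the poset `X`. -/
def lower (X : IntervalProduct) (z : X.Elem) : IntervalProduct :=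
  { X with top := z.1, le := z.2.1 }

/-- The interval `[z, 1]` of the poset `X`. -/
def upper (X : IntervalProduct) (z : X.Elem) : IntervalProduct :=
  { X with bot := z.1, le := z.2.2 }

/-- The graph `G₁ | (W₁ - U₁) + ⋯ + Gₙ | (Wₙ - Uₙ)`. -/
def graph (X : IntervalProduct) : SimpleGraph (Σ i, ↥(X.top i \ X.bot i)) :=
  sumGraph fun i => (X.G i).graph.induce (X.top i \ X.bot i)

/-- The relation `∼` on products of intervals: the associated graphs are isomorphic. -/
instance setoid : Setoid IntervalProduct where
  r X Y := Nonempty (X.graph ≃g Y.graph)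
  iseqv := ⟨fun _ => ⟨SimpleGraph.Iso.refl⟩, fun ⟨e⟩ => ⟨e.symm⟩, fun ⟨e⟩ ⟨f⟩ => ⟨e.trans f⟩⟩

theorem equiv_iff {X Y : IntervalProduct} : X ≈ Y ↔ Nonempty (X.graph ≃g Y.graph) := Iff.rfl

/-- The elements of `X` correspond to the subsets of the vertex set of its graph. -/
def elemEquiv (X : IntervalProduct) : X.Elem ≃ Set (Σ i, ↥(X.top i \ X.bot i)) where
  toFun z := {v | v.2.1 ∈ z.1 v.1}
  invFun S := ⟨fun i => X.bot i ∪ {v | ∃ h, (⟨i, v, h⟩ : Σ i, ↥(X.top i \ X.bot i)) ∈ S},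
    fun _ => Set.subset_union_left,
    fun i => Set.union_subset (X.le i) fun _ ⟨h, _⟩ => h.1⟩
  left_inv z := by
    refine Subtype.ext (funext fun i => Set.ext fun v => ?_)
    constructor
    · rintro (h | ⟨_, h⟩)
      · exact z.2.1 i h
      · exact h
    · intro h
      by_cases hb : v ∈ X.bot i
      · exact Or.inl hb
      · exact Or.inr ⟨⟨z.2.2 i h, hb⟩, h⟩
  right_inv S := by
    ext ⟨i, v, hv⟩
    exact ⟨fun h => h.elim (fun h => absurd h hv.2) fun ⟨_, h⟩ => h, fun h => Or.inr ⟨hv, h⟩⟩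

theorem mem_elemEquiv (X : IntervalProduct) (z : X.Elem) (v : Σ i, ↥(X.top i \ X.bot i)) :
    v ∈ X.elemEquiv z ↔ v.2.1 ∈ z.1 v.1 := Iff.rfl

/-- The graph of `[0, z]` is an induced subgraph of the graph of `X`. -/
def lowerIso (X : IntervalProduct) (z : X.Elem) :
    (X.lower z).graph ≃g X.graph.induce (X.elemEquiv z) where
  toFun v := ⟨⟨v.1, v.2.1, z.2.2 _ v.2.2.1, v.2.2.2⟩, v.2.2.1⟩
  invFun v := ⟨v.1.1, v.1.2.1, v.2, v.1.2.2.2⟩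
  left_inv _ := rfl
  right_inv _ := rfl
  map_rel_iff' := by
    rintro ⟨i, a⟩ ⟨j, b⟩
    constructor
    · rintro ⟨h, hab⟩
      obtain rfl : i = j := h
      exact ⟨rfl, hab⟩
    · rintro ⟨h, hab⟩
      obtain rfl : i = j := h
      exact ⟨rfl, hab⟩

/-- The graph of `[z, 1]` is the complementary induced subgraph of the graph of `X`. -/
def upperIso (X : IntervalProduct) (z : X.Elem) :
    (X.upper z).graph ≃g X.graph.induce (X.elemEquiv z)ᶜ where
  toFun v := ⟨⟨v.1, v.2.1, v.2.2.1, fun h => v.2.2.2 (z.2.1 _ h)⟩, v.2.2.2⟩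
  invFun v := ⟨v.1.1, v.1.2.1, v.1.2.2.1, v.2⟩
  left_inv _ := rfl
  right_inv _ := rfl
  map_rel_iff' := by
    rintro ⟨i, a⟩ ⟨j, b⟩
    constructor
    · rintro ⟨h, hab⟩
      obtain rfl : i = j := h
      exact ⟨rfl, hab⟩
    · rintro ⟨h, hab⟩
      obtain rfl : i = j := h
      exact ⟨rfl, hab⟩

end IntervalProduct

/-- An isomorphism restricts to induced subgraphs. -/
def induceIso {V W : Type} {G : SimpleGraph V} {H : SimpleGraph W} (e : G ≃g H)
    (s : Set V) (t : Set W) (h : ∀ v, e v ∈ t ↔ v ∈ s) : G.induce s ≃g H.induce t where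
  toEquiv := e.toEquiv.subtypeEquiv fun v => (h v).symm
  map_rel_iff' := e.map_rel_iff

/-- The types of products of intervals, i.e. the equivalence classes under `∼`. -/
def Types : Type 1 := Quotient IntervalProduct.setoid

/-- The type of a product of intervals. -/
def ty (X : IntervalProduct) : Types := Quotient.mk _ X

theorem ty_eq {X Y : IntervalProduct} (e : X.graph ≃g Y.graph) : ty X = ty Y :=
  Quotient.sound ⟨e⟩

open IntervalProduct

theorem bot_eq_top_iff (X : IntervalProduct) :
    X.bot = X.top ↔ IsEmpty (Σ i, ↥(X.top i \ X.bot i)) := by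
  constructor
  · intro h
    exact ⟨fun ⟨i, v, hv⟩ => hv.2 (h ▸ hv.1)⟩
  · intro h
    refine le_antisymm X.le fun i v hv => ?_
    by_contra hn
    exact h.false ⟨i, v, hv, hn⟩

/-- The reduced incidence algebra `I(P(G), ∼)`: all functions from the set of types to `k`. -/
def IncAlg (k : Type*) : Type _ := Types → k

namespace IncAlg

variable {k : Type*} [Field k]

@[ext] theorem ext {f g : IncAlg k} (h : ∀ X, f (ty X) = g (ty X)) : f = g :=
  funext fun t => Quotient.inductionOn t h

instance : AddCommGroup (IncAlg k) := inferInstanceAs (AddCommGroup (Types → k))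

instance : Module k (IncAlg k) := inferInstanceAs (Module k (Types → k))

/-- The sum defining the convolution depends only on the type. -/
theorem sum_congr_ty (F : Types → Types → k) {X Y : IntervalProduct} (e : X.graph ≃g Y.graph) :
    ∑ z : X.Elem, F (ty (X.lower z)) (ty (X.upper z)) =
      ∑ z : Y.Elem, F (ty (Y.lower z)) (ty (Y.upper z)) := by
  refine Fintype.sum_equiv
    ((X.elemEquiv.trans (Equiv.Set.congr e.toEquiv)).trans Y.elemEquiv.symm) _ _ fun z => ?_
  set w := ((X.elemEquiv.trans (Equiv.Set.congr e.toEquiv)).trans Y.elemEquiv.symm) z with hw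
  have hw' : Y.elemEquiv w = e.toEquiv '' X.elemEquiv z := by simp [hw]
  have hmem (v) : e v ∈ Y.elemEquiv w ↔ v ∈ X.elemEquiv z := by
    rw [hw']; exact e.toEquiv.injective.mem_set_image
  congr 1
  · exact ty_eq (((X.lowerIso z).trans (induceIso e _ _ hmem)).trans (Y.lowerIso w).symm)
  · exact ty_eq (((X.upperIso z).trans (induceIso e _ _ fun v => not_congr (hmem v))).trans
      (Y.upperIso w).symm)

/-- The convolution product, `(f * g)(X) = ∑_{z ∈ X} f([0, z]) g([z, 1])`. -/
instance : Mul (IncAlg k) :=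
  ⟨fun f g => Quotient.lift
    (fun X => ∑ z : X.Elem, f (ty (X.lower z)) * g (ty (X.upper z)))
    (fun _ _ ⟨e⟩ => sum_congr_ty (fun s t => f s * g t) e)⟩

open Classical in
/-- The unit: `δ(X) = 1` if `X` has one element, and `0` otherwise. -/
instance : One (IncAlg k) :=
  ⟨Quotient.lift (fun X => if X.bot = X.top then 1 else 0) (fun X Y ⟨e⟩ => by
    have : X.bot = X.top ↔ Y.bot = Y.top := by
      rw [bot_eq_top_iff, bot_eq_top_iff]
      exact e.toEquiv.isEmpty_congr
    simp only [this])⟩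

theorem mul_apply (f g : IncAlg k) (X : IntervalProduct) :
    (f * g) (ty X) = ∑ z : X.Elem, f (ty (X.lower z)) * g (ty (X.upper z)) := rfl

open Classical in
theorem one_apply (X : IntervalProduct) :
    (1 : IncAlg k) (ty X) = if X.bot = X.top then 1 else 0 := rfl

theorem add_apply (f g : IncAlg k) (t : Types) : (f + g) t = f t + g t := rfl

theorem zero_apply (t : Types) : (0 : IncAlg k) t = 0 := rfl

theorem smul_apply (c : k) (f : IncAlg k) (t : Types) : (c • f) t = c * f t := rfl

protected theorem mul_comm (f g : IncAlg k) : f * g = g * f := by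
  ext X
  rw [mul_apply, mul_apply]
  refine Fintype.sum_equiv
    ((X.elemEquiv.trans compl_involutive.toPerm).trans X.elemEquiv.symm) _ _ fun z => ?_
  set w := ((X.elemEquiv.trans compl_involutive.toPerm).trans X.elemEquiv.symm) z with hw
  have hw' : X.elemEquiv w = (X.elemEquiv z)ᶜ := by simp [hw]
  have hw'' : (X.elemEquiv w)ᶜ = X.elemEquiv z := by rw [hw', compl_compl]
  rw [mul_comm (f _)]
  congr 2
  · exact ty_eq ((hw' ▸ X.upperIso z).trans (X.lowerIso w).symm)
  · exact ty_eq ((hw'' ▸ X.lowerIso z).trans (X.upperIso w).symm)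

protected theorem mul_one (f : IncAlg k) : f * 1 = f := by
  ext X
  rw [mul_apply, Fintype.sum_eq_single ⟨X.top, X.le, le_rfl⟩]
  · exact (congrArg _ (if_pos rfl)).trans (mul_one _)
  · intro z hz
    rw [one_apply, if_neg, mul_zero]
    exact fun h => hz (Subtype.ext h)

/-- Chains `0 ≤ w ≤ z ≤ 1`, parametrized in two ways. -/
def chainEquiv (X : IntervalProduct) :
    (Σ z : X.Elem, (X.lower z).Elem) ≃ (Σ w : X.Elem, (X.upper w).Elem) where
  toFun c := ⟨⟨c.2.1, c.2.2.1, c.2.2.2.trans c.1.2.2⟩, ⟨c.1.1, c.2.2.2, c.1.2.2⟩⟩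
  invFun c := ⟨⟨c.2.1, c.1.2.1.trans c.2.2.1, c.2.2.2⟩, ⟨c.1.1, c.1.2.1, c.2.2.1⟩⟩
  left_inv _ := rfl
  right_inv _ := rfl

protected theorem mul_assoc (f g h : IncAlg k) : f * g * h = f * (g * h) := by
  ext X
  simp only [mul_apply, Finset.sum_mul, Finset.mul_sum, ← Fintype.sum_sigma']
  exact Fintype.sum_equiv (chainEquiv X) _ _ fun c => mul_assoc _ _ _

instance : CommRing (IncAlg k) :=
  { (inferInstance : AddCommGroup (IncAlg k)) with
    left_distrib f g h := by
      ext X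
      simp only [mul_apply, add_apply, mul_add, Finset.sum_add_distrib]
    right_distrib f g h := by
      ext X
      simp only [mul_apply, add_apply, add_mul, Finset.sum_add_distrib]
    zero_mul f := by
      ext X
      simp only [mul_apply, zero_apply, zero_mul, Finset.sum_const_zero]
    mul_zero f := by
      ext X
      simp only [mul_apply, zero_apply, mul_zero, Finset.sum_const_zero]
    mul_assoc := IncAlg.mul_assoc
    one_mul f := by rw [IncAlg.mul_comm, IncAlg.mul_one]
    mul_one := IncAlg.mul_one
    mul_comm := IncAlg.mul_comm }

instance : Algebra k (IncAlg k) :=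
  Algebra.ofModule
    (fun c f g => by
      ext X
      simp only [mul_apply, smul_apply, Finset.mul_sum, mul_assoc])
    (fun c f g => by
      ext X
      simp only [mul_apply, smul_apply, Finset.mul_sum, mul_left_comm])

/-- The topology of pointwise convergence, `k` being discrete. -/
instance : TopologicalSpace (IncAlg k) :=
  @Pi.topologicalSpace Types (fun _ => k) (fun _ => ⊥)

theorem isLocallyConstant_apply (t : Types) : IsLocallyConstant (fun f : IncAlg k => f t) := by
  let _ : TopologicalSpace k := ⊥
  have : DiscreteTopology k := ⟨rfl⟩
  exact (IsLocallyConstant.iff_continuous _).2 (continuous_apply (A := fun _ : Types => k) t)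

instance : ContinuousMul (IncAlg k) where
  continuous_mul := by
    let _ : TopologicalSpace k := ⊥
    have : DiscreteTopology k := ⟨rfl⟩
    have hc (t : Types) : Continuous fun f : IncAlg k => f t :=
      continuous_apply (A := fun _ : Types => k) t
    refine continuous_pi fun t => Quotient.inductionOn t fun X => ?_
    change Continuous fun p : IncAlg k × IncAlg k =>
      ∑ z : X.Elem, p.1 (ty (X.lower z)) * p.2 (ty (X.upper z))
    exact continuous_finsetSum _ fun z _ =>
      ((hc _).comp continuous_fst).mul ((hc _).comp continuous_snd)

end IncAlg

/-- The empty product of intervals, a one-point poset. -/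
def point : IntervalProduct where
  ι := Empty
  G := Empty.elim
  bot := fun i => i.elim
  top := fun i => i.elim
  le := fun i => i.elim

/-- The augmentation `f ↦ f(one-point interval)` of the incidence algebra; it defines the trivial
bimodule `k`. -/
def augmentation (k : Type*) [Field k] : Hochschild.Augmentation k (IncAlg k) where
  toAlgHom := AlgHom.ofLinearMap
    { toFun := fun f => f (ty point), map_add' := fun _ _ => rfl, map_smul' := fun _ _ => rfl }
    (if_pos rfl)
    (fun f g => by
      have h (X : point.Elem) : X = ⟨point.bot, le_rfl, point.le⟩ :=
        Subtype.ext (funext fun i => i.elim)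
      change (f * g) (ty point) = _
      rw [IncAlg.mul_apply, Fintype.sum_eq_single _ (fun z hz => absurd (h z) hz)]
      have h' : point.bot = point.top := funext fun i => i.elim
      rfl)
  isLocallyConstant := IncAlg.isLocallyConstant_apply _

/-- The product `∏_{B ∈ π} [∅, B]` of intervals of `B(G)`, for a set `π` of subsets of the vertex
set of `G`; its type is the product `∏_{B ∈ π} [G | B]`. -/
def blocks (G : FinGraph) (π : Set (Set G.V)) : IntervalProduct where
  ι := π
  G := fun _ => G
  bot := fun _ => ∅
  top := fun B => B
  le := fun _ => Set.empty_subset _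

instance (G : FinGraph) : Fintype {π : Set (Set G.V) // Setoid.IsPartition π} :=
  Fintype.ofFinite _

/-- `λ([G]) = ∑_π (-1)^(|π| - 1) (|π| - 1)! ∏_{B ∈ π} [G | B]`, the sum over all partitions `π` of
the vertex set of a nonempty graph `G`, in the incidence coalgebra `C(P(G), ∼)`, which is the free
`k`-module on the set of types. -/
def lam (k : Type*) [Field k] (G : FinGraph) : Types →₀ k :=
  ∑ π : {π : Set (Set G.V) // Setoid.IsPartition π},
    Finsupp.single (ty (blocks G π.1)) ((-1) ^ (π.1.ncard - 1) * ((π.1.ncard - 1)! : k))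

/-- The set of all `λ([G])`, `G` a (nonempty) connected finite simple graph. -/
def lamConnected (k : Type*) [Field k] : Set (Types →₀ k) :=
  {x | ∃ G : FinGraph, G.graph.Connected ∧ lam k G = x}

end GraphIncidence

end

/-! The incidence algebra is a power series algebra in disguise. Isomorphism classes of finite
graphs form the free commutative monoid on the connected classes (`union_bijective`). To a multiset
`m` of connected graphs belongs the monomial `IncAlg.monomial k m`, the convolution product of their
indicator functions. Its value at a graph counts the ways to split the vertex set into pieces
inducing the members of `m`. A nonzero value forces the graph to have at least as many edges as the
disjoint union of `m`, and exactly as many only if it is that union, where the count is positive. So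
evaluating types on monomials is a triangular matrix, invertible in characteristic 0, and
`monomialPairing_bijective` identifies the coalgebra of types with the finitely supported functions
on monomials. A continuous cochain sees only finitely many types in each argument
(`exists_finset_of_cochain`). Therefore continuous `n`-cochains are the same as finitely supported
functions on `n`-tuples of monomials (`coordinates`).

What remains is the cohomology of a free commutative monoid with trivial coefficients. The bar
complex is compared with a Koszul complex inside the double complex of alternating forms with values
in bar cochains. One differential, `del`, is contracted by inserting the unit in front. The other,
`koszul`, is contracted in positive form degree by the Euler vector field divided by the total
degree, which again needs characteristic 0 (`koszul_euler`, `exists_koszul_eq`). Walking along the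
staircase of the double complex sends an `n`-cochain to its antisymmetrization on generators. This
kills coboundaries (`antisymm_bar`), and a cocycle that it kills is a coboundary (`exists_bar_eq`).
The differential respects the total exponent, so the primitive can be taken finitely supported, that
is, continuous (`exists_bar_eq_of_finite`).

Cohomology thus embeds into alternating forms. The 1-cocycles dual to the generators anticommute,
and the antisymmetrization of an `n`-fold product of them is a determinant (`alt_dualCochain`).
Division by `n!` then shows that the induced map from the exterior algebra is bijective. The
elements `λ([G])` serve as labels: their coefficients at connected types recover `G` (`lamEquiv`).
-/

/-! ## The bar complex of a free commutative monoid

Cochains on tuples of elements of `I →₀ ℕ` (of all lengths at once) are functions on lists. -/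

noncomputable section

namespace BarComplex

variable {k : Type*} [Field k] {I : Type*}

open Classical in
/-- The augmentation of the monoid algebra of `I →₀ ℕ` on the monoid: `1` at `0`, else `0`. -/
def eps (k : Type*) [Field k] {I : Type*} (m : I →₀ ℕ) : k := if m = 0 then 1 else 0

theorem eps_zero : eps k (0 : I →₀ ℕ) = 1 := if_pos rfl

theorem eps_of_ne {m : I →₀ ℕ} (h : m ≠ 0) : eps k m = 0 := if_neg h

theorem eps_add (a b : I →₀ ℕ) : eps k (a + b) = eps k a * eps k b := by
  by_cases ha : a = 0
  · rw [ha, zero_add, eps_zero, one_mul]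
  · rw [eps_of_ne ha, zero_mul, eps_of_ne]
    exact fun h => ha (add_eq_zero.1 h).1

theorem eps_single (i : I) : eps k (Finsupp.single i 1) = 0 :=
  eps_of_ne (by simp)

/-- Translate the first entry of the argument by `b`; on the empty list, multiply by `eps b`. -/
def merge (b : I →₀ ℕ) : (List (I →₀ ℕ) → k) →ₗ[k] (List (I →₀ ℕ) → k) where
  toFun f
    | [] => eps k b * f []
    | x :: l => f ((b + x) :: l)
  map_add' f g := by
    funext l
    cases l
    · exact mul_add _ _ _
    · rfl
  map_smul' c f := by
    funext l
    cases l
    · exact mul_left_comm _ _ _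
    · rfl

/-- Fix the first entry. -/
def fixHead (b : I →₀ ℕ) : (List (I →₀ ℕ) → k) →ₗ[k] (List (I →₀ ℕ) → k) where
  toFun f l := f (b :: l)
  map_add' _ _ := rfl
  map_smul' _ _ := rfl

theorem fixHead_apply (b : I →₀ ℕ) (f : List (I →₀ ℕ) → k) (l) : fixHead b f l = f (b :: l) := rfl

theorem merge_nil (b : I →₀ ℕ) (f : List (I →₀ ℕ) → k) : merge b f [] = eps k b * f [] := rfl

theorem merge_cons (b : I →₀ ℕ) (f : List (I →₀ ℕ) → k) (x l) :
    merge b f (x :: l) = f ((b + x) :: l) := rfl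

theorem merge_merge (a b : I →₀ ℕ) (f : List (I →₀ ℕ) → k) :
    merge a (merge b f) = merge (b + a) f := by
  funext l
  cases l
  · simp only [merge_nil, eps_add]; ring
  · simp only [merge_cons, add_assoc]

theorem merge_zero (f : List (I →₀ ℕ) → k) : merge 0 f = f := by
  funext l
  cases l
  · simp only [merge_nil, eps_zero, one_mul]
  · simp only [merge_cons, zero_add]

theorem fixHead_merge (a b : I →₀ ℕ) (f : List (I →₀ ℕ) → k) :
    fixHead a (merge b f) = fixHead (b + a) f := rfl

/-- The bar differential without the face map that drops the first entry (up to sign). -/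
def delAux : List (I →₀ ℕ) → ((List (I →₀ ℕ) → k) →ₗ[k] k)
  | [] => 0
  | b :: l => LinearMap.proj l ∘ₗ merge b - delAux l ∘ₗ fixHead b

/-- The bar differential without the face map that drops the first entry (up to sign). -/
def del : (List (I →₀ ℕ) → k) →ₗ[k] (List (I →₀ ℕ) → k) := LinearMap.pi delAux

theorem del_nil (f : List (I →₀ ℕ) → k) : del f [] = 0 := rfl

theorem del_cons (f : List (I →₀ ℕ) → k) (b l) :
    del f (b :: l) = merge b f l - del (fixHead b f) l := rfl

/-- The bar differential: `(d f)(b₀, b₁, …) = eps b₀ f(b₁, …) - f(b₀ + b₁, …) + …`. -/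
def bar (f : List (I →₀ ℕ) → k) : List (I →₀ ℕ) → k
  | [] => 0
  | b :: l => eps k b * f l - del f (b :: l)

theorem bar_cons (f : List (I →₀ ℕ) → k) (b l) :
    bar f (b :: l) = eps k b * f l - del f (b :: l) := rfl

/-- Lists of length `n + 1` form a basis of the free module on `n` bar entries, with the monoid
acting on the first entry; `del` is dual to a differential linear for this action. -/
theorem merge_del (b : I →₀ ℕ) (f : List (I →₀ ℕ) → k) :
    merge b (del f) = del (merge b f) := by
  funext l
  cases l
  · rw [merge_nil, del_nil, del_nil, mul_zero]
  · rw [merge_cons, del_cons, del_cons, merge_merge, fixHead_merge]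

theorem fixHead_del (b : I →₀ ℕ) (f : List (I →₀ ℕ) → k) :
    fixHead b (del f) = merge b f - del (fixHead b f) := rfl

/-- The standard contraction of the bar resolution: inserting the unit in front is a homotopy
between the identity and zero. -/
theorem fixHead_zero_del (f : List (I →₀ ℕ) → k) :
    fixHead 0 (del f) = f - del (fixHead 0 f) := by
  rw [fixHead_del, merge_zero]

theorem del_del (f : List (I →₀ ℕ) → k) : del (del f) = 0 := by
  funext l
  induction l generalizing f with
  | nil => rfl
  | cons b l ih =>
    rw [del_cons, fixHead_del, map_sub, Pi.sub_apply, ih, merge_del]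
    simp

/-- Cochains of all lengths share one function space, so equations hold only on lists of a given
length; such an equation passes through `del` with the length raised by one. -/
theorem del_congr {f g : List (I →₀ ℕ) → k} {n : ℕ} (h : ∀ l, l.length = n → f l = g l)
    (l : List (I →₀ ℕ)) (hl : l.length = n + 1) : del f l = del g l := by
  induction n generalizing f g l with
  | zero =>
    obtain ⟨b, rfl⟩ := List.length_eq_one_iff.1 hl
    rw [del_cons, del_cons, del_nil, del_nil, merge_nil, merge_nil, h [] rfl]
  | succ n ih =>
    match l, hl with
    | b :: x :: l, hl =>
      rw [del_cons f b, del_cons g b, merge_cons, merge_cons, h _ (by simpa using hl),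
        ih (f := fixHead b f) (g := fixHead b g)
          (fun l' hl' => h (b :: l') (by simp [hl'])) (x :: l) (by simpa using hl)]

/-! ### The Koszul differential on cochain-valued alternating forms -/

/-- The Koszul operator: `merge` extended linearly to linear combinations of generators. -/
def mergeLin : (I →₀ k) →ₗ[k] (List (I →₀ ℕ) → k) →ₗ[k] (List (I →₀ ℕ) → k) :=
  Finsupp.linearCombination k fun i => merge (Finsupp.single i 1)

theorem mergeLin_single (i : I) :
    mergeLin (k := k) (Finsupp.single i 1) = merge (Finsupp.single i 1) := by
  simp [mergeLin]

theorem mergeLin_del (v : I →₀ k) (f : List (I →₀ ℕ) → k) :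
    mergeLin v (del f) = del (mergeLin v f) := by
  induction v using Finsupp.induction_linear with
  | zero => simp
  | add v w hv hw => simp [hv, hw]
  | single i c =>
    rw [← Finsupp.smul_single_one i c, map_smul, LinearMap.smul_apply,
      LinearMap.smul_apply, map_smul, mergeLin_single, merge_del]

theorem mergeLin_comm (v w : I →₀ k) (f : List (I →₀ ℕ) → k) :
    mergeLin v (mergeLin w f) = mergeLin w (mergeLin v f) := by
  induction v using Finsupp.induction_linear with
  | zero => simp
  | add v v' hv hv' => simp [hv, hv']
  | single i c =>
    induction w using Finsupp.induction_linear with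
    | zero => simp
    | add w w' hw hw' => simp [hw, hw']
    | single j c' =>
      rw [← Finsupp.smul_single_one i c, ← Finsupp.smul_single_one j c']
      simp only [map_smul, LinearMap.smul_apply, mergeLin_single, merge_merge]
      rw [smul_comm, add_comm]

/-- On the empty list a generator acts through the augmentation, which kills it. -/
theorem mergeLin_nil (v : I →₀ k) (f : List (I →₀ ℕ) → k) : mergeLin v f [] = 0 := by
  induction v using Finsupp.induction_linear with
  | zero => simp
  | add v v' hv hv' => simp [hv, hv']
  | single i c =>
    rw [← Finsupp.smul_single_one i c, map_smul, mergeLin_single]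
    simp [merge_nil, eps_single]

variable (k I) in
/-- Alternating forms with values in cochains. -/
abbrev Form (p : ℕ) : Type _ := (I →₀ k) [⋀^Fin p]→ₗ[k] (List (I →₀ ℕ) → k)

variable {p : ℕ}

/-- `v ↦ mergeLin v ∘ u`. -/
def mergeForm (u : Form k I p) : (I →₀ k) →ₗ[k] Form k I p where
  toFun v := (mergeLin v).compAlternatingMap u
  map_add' v w := by ext; simp
  map_smul' c v := by ext; simp

/-- The Koszul differential, dual to multiplication by the generators. -/
def koszul (u : Form k I p) : Form k I (p + 1) := AlternatingMap.alternatizeUncurryFin (mergeForm u)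

theorem koszul_apply (u : Form k I p) (v : Fin (p + 1) → I →₀ k) :
    koszul u v = ∑ i : Fin (p + 1), (-1 : ℤ) ^ (i : ℕ) • mergeLin (v i) (u (i.removeNth v)) :=
  AlternatingMap.alternatizeUncurryFin_apply _ _

theorem koszul_sub (u w : Form k I p) : koszul (u - w) = koszul u - koszul w := by
  ext1 v
  simp only [koszul_apply, AlternatingMap.sub_apply, map_sub, smul_sub, Finset.sum_sub_distrib]

/-- Alternatizing twice an expression that is symmetric in the two new arguments gives zero; the
symmetry is `mergeLin_comm`. -/
theorem koszul_koszul (u : Form k I p) : koszul (koszul u) = 0 := by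
  let F : (I →₀ k) →ₗ[k] (I →₀ k) →ₗ[k] Form k I p :=
    { toFun := fun v =>
        { toFun := fun w => (mergeLin v).compAlternatingMap (mergeForm u w)
          map_add' := fun _ _ => by ext; simp
          map_smul' := fun _ _ => by ext; simp }
      map_add' := fun _ _ => by ext; simp
      map_smul' := fun _ _ => by ext; simp }
  have hF : mergeForm (koszul u) = AlternatingMap.alternatizeUncurryFinLM ∘ₗ F := by
    refine LinearMap.ext fun v => ?_
    ext1 w
    change mergeLin v (koszul u w) = AlternatingMap.alternatizeUncurryFin (F v) w
    rw [koszul_apply, AlternatingMap.alternatizeUncurryFin_apply, map_sum]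
    simp only [map_zsmul]
    rfl
  rw [koszul, hF]
  refine AlternatingMap.alternatizeUncurryFin_alternatizeUncurryFinLM_comp_of_symmetric
    fun v w => ?_
  ext1 x
  exact mergeLin_comm v w (u x)

/-- `del` on forms. -/
def delForm (u : Form k I p) : Form k I p := del.compAlternatingMap u

theorem delForm_apply (u : Form k I p) (v) : delForm u v = del (u v) := rfl

theorem koszul_delForm (u : Form k I p) : koszul (delForm u) = delForm (koszul u) := by
  ext1 v
  simp only [koszul_apply, delForm_apply, mergeLin_del, map_sum, map_zsmul]

/-- Setting the first entry equal to `0`. -/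
def headZero (u : Form k I p) : Form k I p := (fixHead 0).compAlternatingMap u

theorem headZero_apply (u : Form k I p) (v l) : headZero u v l = u v (0 :: l) := rfl

theorem headZero_delForm (u : Form k I p) : headZero (delForm u) = u - delForm (headZero u) := by
  ext1 v
  exact fixHead_zero_del (u v)

end BarComplex

end

/-! ### The Euler homotopy and the Poincaré lemma -/

noncomputable section

namespace BarComplex

variable {k : Type*} [Field k] {I : Type*} {p : ℕ}

/-- Evaluation at a list. -/
def evalAt (l : List (I →₀ ℕ)) : (List (I →₀ ℕ) → k) →ₗ[k] k := LinearMap.proj l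

/-- The contraction of the Koszul complex: contraction with the Euler vector field of the first
entry. -/
def euler (u : Form k I (p + 1)) : Form k I p :=
  AlternatingMap.pi fun
    | [] => 0
    | b :: l => ∑ i ∈ b.support, (b i : k) •
        (evalAt ((b - Finsupp.single i 1) :: l)).compAlternatingMap (u.curryLeft (Finsupp.single i 1))

theorem euler_cons (u : Form k I (p + 1)) (v : Fin p → I →₀ k) (b l) :
    euler u v (b :: l) = b.sum fun i n =>
      (n : k) * u (Matrix.vecCons (Finsupp.single i 1) v) ((b - Finsupp.single i 1) :: l) := by
  exact map_sum ({ toFun := fun w => w v, map_zero' := rfl, map_add' := fun _ _ => rfl } :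
    ((I →₀ k) [⋀^Fin p]→ₗ[k] k) →+ k) _ _

/-- The Leibniz rule for the Euler sum: the added unit produces one extra term, and in the others
subtraction of a generator commutes with the translation. -/
theorem sum_single_add (c : I) (b : I →₀ ℕ) (X : I → (I →₀ ℕ) → k) :
    ((Finsupp.single c 1 + b).sum fun i n => (n : k) * X i (Finsupp.single c 1 + b -
      Finsupp.single i 1)) =
      X c b + b.sum fun i n => (n : k) * X i (Finsupp.single c 1 + (b - Finsupp.single i 1)) := by
  classical
  rw [Finsupp.sum_add_index' (fun _ => by simp) (fun _ _ _ => by push_cast; ring),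
    Finsupp.sum_single_index (by simp)]
  congr 1
  · simp
  · refine Finset.sum_congr rfl fun i hi => ?_
    have h : Finsupp.single i 1 ≤ b := by
      rw [Finsupp.single_le_iff]
      exact Nat.one_le_iff_ne_zero.2 (Finsupp.mem_support_iff.1 hi)
    beta_reduce
    rw [add_tsub_assoc_of_le h]

theorem removeNth_succ_vecCons {α : Type*} (j : Fin (p + 1)) (x : α) (v : Fin (p + 1) → α) :
    j.succ.removeNth (Matrix.vecCons x v : Fin (p + 2) → α) =
      (Matrix.vecCons x (j.removeNth v) : Fin (p + 1) → α) := by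
  funext a
  induction a using Fin.cases with
  | zero => simp [Fin.removeNth]
  | succ a => simp [Fin.removeNth]

/-- Moving the `j`-th argument to the front costs exactly the sign `(-1) ^ j`, so all `p + 1`
summands agree. -/
theorem sum_vecCons_removeNth (u : Form k I (p + 1)) (v : Fin (p + 1) → I →₀ k) :
    ∑ j : Fin (p + 1), (-1 : ℤ) ^ (j : ℕ) • u (Matrix.vecCons (v j) (j.removeNth v)) =
      ((p : k) + 1) • u v := by
  have h := congrArg (fun w => w v) (AlternatingMap.alternatizeUncurryFin_curryLeft u)
  simp only [AlternatingMap.alternatizeUncurryFin_apply] at h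
  refine h.trans ?_
  rw [AlternatingMap.smul_apply, ← Nat.cast_smul_eq_nsmul k]
  push_cast
  rfl

/-- Cartan's formula for the Euler field. The extra Leibniz terms in the first summand give `p + 1`,
the leading Koszul term in the second gives `b.degree`, and the remaining double sums cancel. -/
theorem koszul_euler (u : Form k I (p + 1)) (v : Fin (p + 1) → I →₀ k) (b l) :
    koszul (euler u) v (b :: l) + euler (koszul u) v (b :: l) =
      ((b.degree : k) + p + 1) * u v (b :: l) := by
  let π : (List (I →₀ ℕ) → k) →ₗ[k] k := evalAt (b :: l)
  suffices h : π.compAlternatingMap (koszul (euler u) + euler (koszul u)) =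
      ((b.degree : k) + p + 1) • π.compAlternatingMap u from
    congrArg (fun w => w v) h
  -- On basis vectors the Koszul operator is translation by a single generator, so both sides become
  -- explicit sums.
  refine Module.Basis.ext_alternating (Finsupp.basisSingleOne (R := k)) fun i _ => ?_
  simp only [Finsupp.coe_basisSingleOne]
  set v : Fin (p + 1) → I →₀ k := fun j => Finsupp.single (i j) 1 with hv
  change koszul (euler u) v (b :: l) + euler (koszul u) v (b :: l) =
      ((b.degree : k) + p + 1) * u v (b :: l)
  have h1 : koszul (euler u) v (b :: l) = ∑ j : Fin (p + 1), (-1 : ℤ) ^ (j : ℕ) •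
      (u (Matrix.vecCons (v j) (j.removeNth v)) (b :: l) + b.sum fun i' n => (n : k) *
        u (Matrix.vecCons (Finsupp.single i' 1) (j.removeNth v))
          ((Finsupp.single (i j) 1 + (b - Finsupp.single i' 1)) :: l)) := by
    rw [koszul_apply, Finset.sum_apply]
    refine Finset.sum_congr rfl fun j _ => ?_
    rw [Pi.smul_apply, hv, mergeLin_single, merge_cons, euler_cons]
    exact congrArg _ (sum_single_add (i j) b fun i' m =>
      u (Matrix.vecCons (Finsupp.single i' 1) (j.removeNth v)) (m :: l))
  have h2 : euler (koszul u) v (b :: l) = b.sum fun i' n => (n : k) * (u v (b :: l) -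
      ∑ j : Fin (p + 1), (-1 : ℤ) ^ (j : ℕ) •
        u (Matrix.vecCons (Finsupp.single i' 1) (j.removeNth v))
          ((Finsupp.single (i j) 1 + (b - Finsupp.single i' 1)) :: l)) := by
    rw [euler_cons]
    refine Finset.sum_congr rfl fun i' hi' => ?_
    have h : Finsupp.single i' 1 ≤ b := by
      rw [Finsupp.single_le_iff]
      exact Nat.one_le_iff_ne_zero.2 (Finsupp.mem_support_iff.1 hi')
    beta_reduce
    rw [koszul_apply, Finset.sum_apply, Fin.sum_univ_succ, sub_eq_add_neg, ← Finset.sum_neg_distrib]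
    congr 2
    · simp only [Fin.val_zero, pow_zero, one_smul, Matrix.cons_val_zero, mergeLin_single,
        merge_cons, add_tsub_cancel_of_le h]
      rfl
    · refine Finset.sum_congr rfl fun j _ => ?_
      rw [Pi.smul_apply, removeNth_succ_vecCons, Matrix.cons_val_succ, hv, mergeLin_single,
        merge_cons, Fin.val_succ, pow_succ, mul_neg_one, neg_smul]
  have h3 := congrFun (sum_vecCons_removeNth u v) (b :: l)
  rw [Finset.sum_apply] at h3
  simp only [Pi.smul_apply] at h3
  have h4 : (b.degree : k) = b.sum fun _ n => (n : k) := by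
    rw [Finsupp.degree_apply, Finsupp.sum, Nat.cast_sum]
  rw [h1, h2]
  have h5 : (∑ j : Fin (p + 1), (-1 : ℤ) ^ (j : ℕ) • b.sum fun i' n => (n : k) *
        u (Matrix.vecCons (Finsupp.single i' 1) (j.removeNth v))
          ((Finsupp.single (i j) 1 + (b - Finsupp.single i' 1)) :: l)) =
      b.sum fun i' n => (n : k) * ∑ j : Fin (p + 1), (-1 : ℤ) ^ (j : ℕ) •
        u (Matrix.vecCons (Finsupp.single i' 1) (j.removeNth v))
          ((Finsupp.single (i j) 1 + (b - Finsupp.single i' 1)) :: l) := by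
    simp only [Finsupp.sum, Finset.smul_sum, Finset.mul_sum, mul_smul_comm]
    exact Finset.sum_comm
  have h6 : (b.sum fun _ n => (n : k) * u v (b :: l)) = (b.sum fun _ n => (n : k)) * u v (b :: l) :=
    (Finset.sum_mul _ _ _).symm
  simp only [smul_add, Finset.sum_add_distrib, h3, mul_sub]
  rw [Finsupp.sum_sub, h4, h5, h6, smul_eq_mul]
  ring

/-- Division of a form by the Euler weight. -/
def weightInv (u : Form k I (p + 1)) : Form k I (p + 1) :=
  AlternatingMap.pi fun l => ((l.headD 0).degree + p + 1 : k)⁻¹ •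
    (evalAt l).compAlternatingMap u

theorem weightInv_apply (u : Form k I (p + 1)) (v l) :
    weightInv u v l = ((l.headD 0).degree + p + 1 : k)⁻¹ * u v l := rfl

theorem koszul_single (u : Form k I p) (i : Fin (p + 1) → I) (b l) :
    koszul u (fun j => Finsupp.single (i j) 1) (b :: l) =
      ∑ j : Fin (p + 1), (-1 : ℤ) ^ (j : ℕ) •
        u (j.removeNth fun j => Finsupp.single (i j) 1) ((Finsupp.single (i j) 1 + b) :: l) := by
  rw [koszul_apply, Finset.sum_apply]
  simp only [Pi.smul_apply, mergeLin_single, merge_cons]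

/-- Forms are determined by their values on basis vectors. -/
theorem ext_single {u w : Form k I p} (l l' : List (I →₀ ℕ)) (c c' : k)
    (h : ∀ i : Fin p → I, c * u (fun j => Finsupp.single (i j) 1) l =
      c' * w (fun j => Finsupp.single (i j) 1) l') (v) : c * u v l = c' * w v l' := by
  suffices h : c • (evalAt l).compAlternatingMap u = c' • (evalAt l').compAlternatingMap w from
    congrArg (fun w => w v) h
  refine Module.Basis.ext_alternating (Finsupp.basisSingleOne (R := k)) fun i _ => ?_
  simpa [evalAt] using h i

/-- Every summand of `koszul` reads `u` at a first entry of degree `b.degree + 1`, so all of them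
carry the same weight and it factors out. -/
theorem koszul_weightInv (u : Form k I (p + 1)) (v b l) :
    koszul (weightInv u) v (b :: l) = ((b.degree : k) + 1 + p + 1)⁻¹ * koszul u v (b :: l) := by
  rw [← one_mul (koszul _ _ _)]
  refine ext_single _ _ _ _ (fun i => ?_) v
  rw [koszul_single, koszul_single, one_mul, Finset.mul_sum]
  refine Finset.sum_congr rfl fun j _ => ?_
  rw [weightInv_apply, mul_smul_comm]
  simp [add_comm, add_left_comm]

/-- The Poincaré lemma: on nonempty lists of a given length, closed forms are exact. -/
theorem exists_koszul_eq [CharZero k] {n : ℕ} (u : Form k I (p + 1))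
    (hu : ∀ v l, l.length = n + 1 → koszul u v l = 0) :
    ∃ w : Form k I p, ∀ v l, l.length = n + 1 → koszul w v l = u v l := by
  -- Dividing by the weight preserves closedness, so only the first term of the homotopy formula
  -- survives.
  refine ⟨euler (weightInv u), fun v l hl => ?_⟩
  match l, hl with
  | b :: l, hl =>
    have h := koszul_euler (weightInv u) v b l
    have h0 : euler (koszul (weightInv u)) v (b :: l) = 0 := by
      rw [euler_cons]
      refine Finset.sum_eq_zero fun i _ => ?_
      beta_reduce
      rw [koszul_weightInv, hu _ _ (by simpa using hl), mul_zero, mul_zero]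
    rw [h0, add_zero, weightInv_apply, List.headD_cons, ← mul_assoc, mul_inv_cancel₀, one_mul] at h
    · exact h
    -- The weight is a positive integer; here characteristic 0 is used.
    · exact_mod_cast (Nat.succ_ne_zero (b.degree + p))

end BarComplex

end

/-! ### From bar cochains to alternating forms -/

noncomputable section

namespace BarComplex

variable {k : Type*} [Field k] {I : Type*} {p : ℕ}

theorem mergeLin_congr {f g : List (I →₀ ℕ) → k} {n : ℕ} (h : ∀ l, l.length = n → f l = g l)
    (v : I →₀ k) (l : List (I →₀ ℕ)) (hl : l.length = n) : mergeLin v f l = mergeLin v g l := by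
  induction v using Finsupp.induction_linear with
  | zero => simp
  | add v w hv hw => simp [hv, hw]
  | single i c =>
    rw [← Finsupp.smul_single_one i c, map_smul, mergeLin_single]
    simp only [LinearMap.smul_apply, Pi.smul_apply]
    congr 1
    match l with
    | [] => rw [merge_nil, merge_nil, h _ hl]
    | b :: l => rw [merge_cons, merge_cons, h _ (by simpa using hl)]

theorem koszul_congr {u w : Form k I p} {n : ℕ} (h : ∀ v l, l.length = n → u v l = w v l)
    (v) (l : List (I →₀ ℕ)) (hl : l.length = n) : koszul u v l = koszul w v l := by
  simp only [koszul_apply, Finset.sum_apply, Pi.smul_apply]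
  exact Finset.sum_congr rfl fun i _ => congrArg _ (mergeLin_congr (h _) _ _ hl)

theorem koszul_add (u w : Form k I p) : koszul (u + w) = koszul u + koszul w := by
  ext1 v
  simp only [koszul_apply, AlternatingMap.add_apply, map_add, smul_add, Finset.sum_add_distrib]

theorem koszul_smul (c : k) (u : Form k I p) : koszul (c • u) = c • koszul u := by
  ext1 v
  simp only [koszul_apply, AlternatingMap.smul_apply, map_smul, Finset.smul_sum]
  exact Finset.sum_congr rfl fun i _ => smul_comm _ _ _

theorem koszul_zero : koszul (0 : Form k I p) = 0 := by
  rw [← sub_self 0, koszul_sub, sub_self]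

theorem koszul_nil (u : Form k I p) (v) : koszul u v [] = 0 := by
  simp [koszul_apply, mergeLin_nil]

/-- A cochain as a form of degree `0`. -/
def ofCochain (f : List (I →₀ ℕ) → k) : Form k I 0 := AlternatingMap.constOfIsEmpty k _ _ f

theorem ofCochain_apply (f : List (I →₀ ℕ) → k) (v) : ofCochain f v = f := rfl

theorem koszul_ofCochain (f : List (I →₀ ℕ) → k) (v) :
    koszul (ofCochain f) v = mergeLin (v 0) f := by
  simp [koszul_apply, ofCochain_apply]

/-- Replace the first arguments of a cochain, one after the other, by generators, and
antisymmetrize. -/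
def tower (f : List (I →₀ ℕ) → k) : (p : ℕ) → Form k I p
  | 0 => ofCochain f
  | p + 1 => headZero (koszul (tower f p))

theorem tower_succ (f : List (I →₀ ℕ) → k) (p : ℕ) :
    tower f (p + 1) = headZero (koszul (tower f p)) := rfl

theorem tower_add (f g : List (I →₀ ℕ) → k) (p : ℕ) : tower (f + g) p = tower f p + tower g p := by
  induction p with
  | zero => rfl
  | succ p ih => rw [tower_succ, ih, koszul_add]; rfl

theorem tower_smul (c : k) (f : List (I →₀ ℕ) → k) (p : ℕ) : tower (c • f) p = c • tower f p := by
  induction p with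
  | zero => rfl
  | succ p ih => rw [tower_succ, ih, koszul_smul]; rfl

theorem tower_congr {f g : List (I →₀ ℕ) → k} {n : ℕ} (h : ∀ l, l.length = n → f l = g l)
    (p q : ℕ) (hn : p + q = n) (v) (l : List (I →₀ ℕ)) (hl : l.length = q) :
    tower f p v l = tower g p v l := by
  induction p generalizing q l with
  | zero => exact h l (by omega)
  | succ p ih =>
    exact koszul_congr (n := q + 1) (fun v l hl => ih _ (by omega) v l hl) v (0 :: l) (by simp [hl])

/-- The antisymmetrization of an `n`-cochain on generators. -/
def antisymm (n : ℕ) : (List (I →₀ ℕ) → k) →ₗ[k] (I →₀ k) [⋀^Fin n]→ₗ[k] k where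
  toFun f := ((evalAt []).compAlternatingMap (tower f n)).domDomCongr Fin.revPerm
  map_add' f g := by rw [tower_add]; rfl
  map_smul' c f := by rw [tower_smul]; rfl

theorem antisymm_apply (n : ℕ) (f : List (I →₀ ℕ) → k) (v) :
    antisymm n f v = tower f n (fun i => v i.rev) [] := rfl

theorem antisymm_congr {f g : List (I →₀ ℕ) → k} {n : ℕ} (h : ∀ l, l.length = n → f l = g l) :
    antisymm n f = antisymm n g := by
  ext1 v
  exact tower_congr h n 0 rfl _ _ rfl

/-- `b :: l ↦ eps b * f l`. -/
def extHead (f : List (I →₀ ℕ) → k) : List (I →₀ ℕ) → k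
  | [] => 0
  | b :: l => eps k b * f l

theorem fixHead_extHead (f : List (I →₀ ℕ) → k) : fixHead 0 (extHead f) = f := by
  funext l
  rw [fixHead_apply, extHead, eps_zero, one_mul]

theorem bar_eq (f : List (I →₀ ℕ) → k) : bar f = extHead f - del f := by
  funext l
  cases l
  · exact (sub_self _).symm
  · rfl

/-- After a generator is added the first entry is nonzero, and `eps` vanishes there. -/
theorem mergeLin_extHead (v : I →₀ k) (f : List (I →₀ ℕ) → k) : mergeLin v (extHead f) = 0 := by
  induction v using Finsupp.induction_linear with
  | zero => simp
  | add v w hv hw => simp [hv, hw]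
  | single i c =>
    rw [← Finsupp.smul_single_one i c, map_smul, mergeLin_single]
    refine (congrArg (c • ·) (funext fun l => ?_)).trans (smul_zero c)
    cases l
    · exact mul_zero _
    · simp [merge_cons, extHead, eps_add, eps_single]

/-- In passing to the next stage the first term dies because `koszul` squares to zero, and moving
`headZero` past `del` in the second term regenerates it with the opposite sign. -/
theorem tower_del (f : List (I →₀ ℕ) → k) (p : ℕ) :
    tower (del f) (p + 1) =
      (-1 : k) ^ p • (koszul (tower f p) - delForm (tower f (p + 1))) := by
  induction p with
  | zero =>
    have : tower (del f) 0 = delForm (tower f 0) := rfl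
    rw [tower_succ, this, koszul_delForm, headZero_delForm, pow_zero, one_smul]
    rfl
  | succ p ih =>
    rw [tower_succ, ih, koszul_smul, koszul_sub, koszul_koszul, koszul_delForm, zero_sub]
    have h := headZero_delForm (koszul (tower f (p + 1)))
    rw [← tower_succ] at h
    ext1 v
    funext l
    have h' := congrFun (congrArg (fun w => w v) h) l
    change (-1 : k) ^ p * (-(headZero (delForm (koszul (tower f (p + 1)))) v l)) = (-1 : k) ^ (p + 1) *
      (koszul (tower f (p + 1)) - delForm (tower f (p + 1 + 1))) v l
    rw [h', pow_succ]
    ring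

theorem tower_extHead (f : List (I →₀ ℕ) → k) (p : ℕ) : tower (extHead f) (p + 1) = 0 := by
  induction p with
  | zero =>
    ext1 v
    funext l
    change koszul (ofCochain (extHead f)) v (0 :: l) = 0
    rw [koszul_ofCochain, mergeLin_extHead]
    rfl
  | succ p ih => rw [tower_succ, ih, koszul_zero]; rfl

/-- At the empty list both terms of `tower_del` vanish, and the face that carries the leading
augmentation is already killed by the first stage of the tower. -/
theorem antisymm_bar (n : ℕ) (f : List (I →₀ ℕ) → k) : antisymm (n + 1) (bar f) = 0 := by
  rw [bar_eq, map_sub]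
  ext1 v
  rw [AlternatingMap.sub_apply, antisymm_apply, antisymm_apply, tower_extHead, tower_del,
    AlternatingMap.smul_apply, AlternatingMap.sub_apply, Pi.smul_apply, Pi.sub_apply, koszul_nil,
    delForm_apply, del_nil, sub_zero, smul_zero]
  exact sub_zero _

theorem mergeLin_head_zero (v : I →₀ k) (f : List (I →₀ ℕ) → k) (l) :
    mergeLin v f (0 :: l) = v.sum fun i c => c * f (Finsupp.single i 1 :: l) := by
  simp [mergeLin, Finsupp.linearCombination_apply, Finsupp.sum, merge_cons, LinearMap.sum_apply]

open Classical in
/-- The cochain `(b₁, …, bₙ) ↦ ∏ [bⱼ = single iⱼ 1]`. -/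
def indicator : List I → List (I →₀ ℕ) → k
  | [], [] => 1
  | i :: is, b :: l => (if b = Finsupp.single i 1 then 1 else 0) * indicator is l
  | _, _ => 0

theorem sum_indicator (v : I →₀ k) (i : I) (is l) :
    (v.sum fun j c => c * indicator (k := k) (i :: is) (Finsupp.single j 1 :: l)) =
      v i * indicator is l := by
  classical
  simp only [indicator, ← mul_assoc, mul_ite, mul_one, mul_zero]
  rw [← Finsupp.sum_mul]
  congr 1
  rw [Finsupp.sum_eq_single i]
  · simp
  · intro j _ hj
    rw [if_neg]
    exact fun h => hj ((Finsupp.single_left_inj one_ne_zero).1 h)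
  · intro _
    simp

/-- Each stage is a Laplace expansion along row zero. The tower consumes arguments from the front
and treats `r 0` last, hence the reversed list. -/
theorem tower_indicator (p : ℕ) (r : Fin p → I) (is : List I) (v) (l) :
    tower (indicator (k := k) ((List.ofFn r).reverse ++ is)) p v l =
      Matrix.det (Matrix.of fun a b => v b (r a)) * indicator is l := by
  induction p generalizing is l with
  | zero =>
    simp only [Matrix.det_isEmpty, one_mul]
    rfl
  | succ p ih =>
    have h : (List.ofFn r).reverse ++ is = (List.ofFn (Fin.tail r)).reverse ++ (r 0 :: is) := by
      simp [List.ofFn_succ]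
      rfl
    rw [tower_succ, headZero_apply, koszul_apply, Finset.sum_apply, Matrix.det_succ_row_zero,
      Finset.sum_mul]
    refine Finset.sum_congr rfl fun i _ => ?_
    rw [Pi.smul_apply, mergeLin_head_zero, h]
    simp only [ih]
    have := sum_indicator (v i) (r 0) is l
    rw [Finsupp.sum_congr (g2 := fun j c => Matrix.det (Matrix.of fun a b =>
      i.removeNth v b (Fin.tail r a)) * (c * indicator (k := k) (r 0 :: is)
        (Finsupp.single j 1 :: l))) (fun _ _ => by ring), ← Finsupp.mul_sum, this]
    simp only [zsmul_eq_mul]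
    push_cast
    simp only [Matrix.submatrix, Matrix.of_apply]
    have hd : (Matrix.of fun a b => v (i.succAbove b) (r a.succ)) =
      Matrix.of fun a b => i.removeNth v b (Fin.tail r a) := rfl
    rw [hd]
    ring

theorem antisymm_indicator (n : ℕ) (r : Fin n → I) (v) :
    antisymm n (indicator (k := k) (List.ofFn r)) v =
      Matrix.det (Matrix.of fun a b => v b (r a)) := by
  have h : List.ofFn r = (List.ofFn fun i => r i.rev).reverse ++ [] := by
    rw [List.append_nil]
    apply List.ext_getElem <;> simp [Fin.rev]
    intro i h
    congr
    omega
  rw [antisymm_apply, h, tower_indicator]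
  refine (mul_one _).trans ?_
  -- Rows and columns are reversed simultaneously, which leaves the determinant unchanged.
  exact Matrix.det_submatrix_equiv_self Fin.revPerm (Matrix.of fun a b => v b (r a))

end BarComplex

end

/-! ### Exactness: cocycles with vanishing antisymmetrization -/

noncomputable section

namespace BarComplex

variable {k : Type*} [Field k] {I : Type*} {p : ℕ}

theorem del_extHead_of_bar_eq_zero {f : List (I →₀ ℕ) → k} {n : ℕ}
    (hf : ∀ l, l.length = n + 1 → bar f l = 0) (l : List (I →₀ ℕ)) (hl : l.length = n + 1) :
    del f l = extHead f l := by
  have h := hf l hl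
  rw [bar_eq, Pi.sub_apply, sub_eq_zero] at h
  exact h.symm

/-- The Koszul differential of every stage of the tower of a cocycle is closed under `del`. -/
theorem delForm_koszul_tower {f : List (I →₀ ℕ) → k} {n : ℕ}
    (hf : ∀ l, l.length = n + 1 → bar f l = 0) (p q : ℕ) (hn : p + q = n) (v)
    (l : List (I →₀ ℕ)) (hl : l.length = q + 1) : delForm (koszul (tower f p)) v l = 0 := by
  induction p generalizing q l with
  | zero =>
    obtain rfl : q = n := by omega
    have h0 : delForm (koszul (tower f 0)) = koszul (ofCochain (del f)) :=
      (koszul_delForm _).symm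
    rw [h0, koszul_ofCochain, mergeLin_congr (del_extHead_of_bar_eq_zero hf) _ l hl,
      mergeLin_extHead]
    rfl
  | succ p ih =>
    rw [← koszul_delForm]
    have h := headZero_delForm (koszul (tower f p))
    have h' : delForm (tower f (p + 1)) =
        koszul (tower f p) - headZero (delForm (koszul (tower f p))) := by
      rw [h, sub_sub_cancel, tower_succ]
    rw [h', koszul_sub, koszul_koszul, AlternatingMap.sub_apply, Pi.sub_apply,
      koszul_congr (w := 0) (fun v l hl => ih (q + 1) (by omega) v (0 :: l) (by simp [hl])) v l hl,
      koszul_zero]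
    exact sub_zero _

/-- By the contraction, a form killed by `del` is `del` of its head insertion; for the Koszul
differential of stage `p` the head insertion is stage `p + 1`. -/
theorem koszul_tower_eq {f : List (I →₀ ℕ) → k} {n : ℕ}
    (hf : ∀ l, l.length = n + 1 → bar f l = 0) (p q : ℕ) (hn : p + q = n) (v)
    (l : List (I →₀ ℕ)) (hl : l.length = q) :
    koszul (tower f p) v l = delForm (tower f (p + 1)) v l := by
  have h := congrFun (congrArg (fun w => w v) (headZero_delForm (koszul (tower f p)))) l
  have h0 : headZero (delForm (koszul (tower f p))) v l = 0 :=
    delForm_koszul_tower hf p q hn v (0 :: l) (by simp [hl])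
  exact sub_eq_zero.1 (h.symm.trans h0)

variable [CharZero k]

/-- The staircase argument, descending from `p = n - 1` to `p = 0`: a correction making stage `p +
1` Koszul-closed yields, through the Poincaré lemma, a correction of stage `p`. -/
theorem exists_koszul_tower_sub {f : List (I →₀ ℕ) → k} {n : ℕ}
    (hf : ∀ l, l.length = n + 1 → bar f l = 0) (h0 : antisymm n f = 0) (r p : ℕ)
    (hn : p + (r + 1) = n) :
    ∃ w : Form k I p, ∀ v l, l.length = r + 1 → koszul (tower f p - delForm w) v l = 0 := by
  induction r generalizing p with
  | zero =>
    subst hn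
    -- At the top no correction is needed: on one-entry lists `del` of the last stage reads only its
    -- value at `[]`, which is the vanishing antisymmetrization.
    refine ⟨0, fun v l hl => ?_⟩
    have hw : delForm (0 : Form k I p) = 0 := by ext1; exact map_zero del
    rw [hw, sub_zero, koszul_tower_eq hf p 1 rfl v l hl, delForm_apply,
      del_congr (g := 0) (n := 0) ?_ l hl]
    · exact congrFun (map_zero del) l
    · intro l hl
      rw [List.length_eq_zero_iff.1 hl]
      have := congrArg (fun w => w fun i => v i.rev) h0
      simpa [antisymm_apply] using this
  | succ r ih =>
    obtain ⟨w', hw'⟩ := ih (p + 1) (by omega)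
    -- Since `koszul w` is stage `p + 1` minus a `del`-boundary, its `del` equals `del` of that
    -- stage, which is `koszul (tower f p)`.
    obtain ⟨w, hw⟩ := exists_koszul_eq _ hw'
    refine ⟨w, fun v l hl => ?_⟩
    rw [koszul_sub, koszul_delForm, AlternatingMap.sub_apply, Pi.sub_apply,
      koszul_tower_eq hf p (r + 1 + 1) (by omega) v l hl, delForm_apply, delForm_apply,
      del_congr (hw v) l hl, AlternatingMap.sub_apply, delForm_apply, map_sub, del_del, sub_zero,
      sub_self]

/-- A cocycle whose antisymmetrization on generators vanishes is a coboundary. -/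
theorem exists_bar_eq {f : List (I →₀ ℕ) → k} {n : ℕ}
    (hf : ∀ l, l.length = n + 2 → bar f l = 0) (h0 : antisymm (n + 1) f = 0) :
    ∃ g, ∀ l, l.length = n + 1 → bar g l = f l := by
  obtain ⟨w, hw⟩ := exists_koszul_tower_sub hf h0 n 0 (by omega)
  set h : List (I →₀ ℕ) → k := f - del (w ![]) with hh
  have hk : tower f 0 - delForm w = ofCochain h := by
    ext1 v
    rw [Subsingleton.elim v ![]]
    rfl
  rw [hk] at hw
  -- Koszul-closedness in form degree 0 says that `h` vanishes as soon as its first entry contains a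
  -- generator.
  have h1 : ∀ l, l.length = n + 1 → h l = extHead (fixHead 0 h) l := by
    intro l hl
    match l, hl with
    | b :: l, hl =>
      by_cases hb : b = 0
      · subst hb
        rw [extHead, eps_zero, one_mul, fixHead_apply]
      · rw [extHead, eps_of_ne hb, zero_mul]
        obtain ⟨i, hi⟩ := Finsupp.ne_iff.1 hb
        have hi' : Finsupp.single i 1 ≤ b := by
          rw [Finsupp.single_le_iff]
          exact Nat.one_le_iff_ne_zero.2 hi
        have := hw (fun _ => Finsupp.single i 1) ((b - Finsupp.single i 1) :: l)
          (by simpa using hl)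
        rwa [koszul_ofCochain, mergeLin_single, merge_cons, add_tsub_cancel_of_le hi'] at this
  -- With `g = fixHead 0 h` one has `h = extHead g` in this length, and the contraction turns `bar g
  -- l` into `del h (0 :: l)`. That equals `del f (0 :: l)`, which is `f l` by the cocycle
  -- condition.
  refine ⟨fixHead 0 h, fun l hl => ?_⟩
  have h2 : del f (0 :: l) = f l := by
    rw [del_extHead_of_bar_eq_zero hf (0 :: l) (by simp [hl]), extHead, eps_zero, one_mul]
  have h3 : del h (0 :: l) = f l := by
    rw [hh, map_sub, del_del, sub_zero, h2]
  have h4 := congrFun (fixHead_zero_del (extHead (fixHead 0 h))) l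
  rw [fixHead_extHead] at h4
  rw [bar_eq, ← h4, fixHead_apply, ← del_congr h1 _ (by simp [hl]), h3]

/-! ### Finite supports through the grading by total exponent -/

omit [CharZero k] in
/-- Restriction of a cochain to a set of total degrees commutes with the differential. -/
theorem del_restrict (f : List (I →₀ ℕ) → k) (P : (I →₀ ℕ) → Prop)
    [DecidablePred P] (l : List (I →₀ ℕ)) :
    del (fun l => if P l.sum then f l else 0) l = if P l.sum then del f l else 0 := by
  induction l generalizing f P with
  | nil => rw [del_nil, del_nil]; split_ifs <;> rfl
  | cons b l ih =>
    have h : fixHead b (fun l => if P l.sum then f l else 0) =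
        fun l => if P (b + l.sum) then fixHead b f l else 0 := by
      funext l
      simp only [fixHead_apply, List.sum_cons]
      congr
    rw [del_cons, del_cons, h, ih (fixHead b f) fun m => P (b + m)]
    have h2 : merge b (fun l => if P l.sum then f l else 0) l =
        if P (b + l.sum) then merge b f l else 0 := by
      match l with
      | [] =>
        rw [merge_nil, merge_nil]
        by_cases hb : b = 0
        · simp only [hb, eps_zero, one_mul, List.sum_nil, add_zero]
          congr
        · simp [eps_of_ne hb]
      | x :: l => simp only [merge_cons, List.sum_cons, add_assoc]; congr
    rw [h2, List.sum_cons]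
    split_ifs <;> simp

omit [CharZero k] in
theorem bar_restrict (f : List (I →₀ ℕ) → k) (P : (I →₀ ℕ) → Prop)
    [DecidablePred P] (l : List (I →₀ ℕ)) :
    bar (fun l => if P l.sum then f l else 0) l = if P l.sum then bar f l else 0 := by
  match l with
  | [] => rw [bar, bar]; split_ifs <;> rfl
  | b :: l =>
    rw [bar_cons, bar_cons, del_restrict]
    by_cases hb : b = 0
    · simp only [hb, List.sum_cons, zero_add]
      split_ifs <;> simp
    · rw [eps_of_ne hb]
      split_ifs <;> simp

/-- The entries and partial sums of a list are bounded by its sum, and only finitely many exponents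
lie below a given one. -/
theorem finite_setOf_sum_mem {T : Set (I →₀ ℕ)} (hT : T.Finite) (n : ℕ) :
    {l : List (I →₀ ℕ) | l.length = n ∧ l.sum ∈ T}.Finite := by
  classical
  induction n generalizing T with
  | zero => exact (Set.finite_singleton []).subset fun l hl => List.length_eq_zero_iff.1 hl.1
  | succ n ih =>
    have hB : (⋃ t ∈ T, (Finset.Iic t : Set (I →₀ ℕ))).Finite :=
      hT.biUnion fun t _ => Finset.finite_toSet _
    refine (Set.Finite.image2 List.cons hB (ih hB)).subset fun l hl => ?_
    match l, hl with
    | b :: l, hl =>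
      refine ⟨b, ?_, l, ⟨by simpa using hl.1, ?_⟩, rfl⟩
      all_goals
        refine Set.mem_biUnion hl.2 ?_
        simp

/-- The differential is compatible with restriction by total exponent, so a primitive can be cut
down to the finitely many sums that occur in `f`. -/
theorem exists_bar_eq_of_finite {f : List (I →₀ ℕ) → k} {n : ℕ}
    (hf : ∀ l, l.length = n + 2 → bar f l = 0) (h0 : antisymm (n + 1) f = 0)
    (hfin : {l | l.length = n + 1 ∧ f l ≠ 0}.Finite) :
    ∃ g, (∀ l, l.length = n + 1 → bar g l = f l) ∧ {l | l.length = n ∧ g l ≠ 0}.Finite := by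
  classical
  obtain ⟨g, hg⟩ := exists_bar_eq hf h0
  set T : Set (I →₀ ℕ) := List.sum '' {l | l.length = n + 1 ∧ f l ≠ 0} with hT
  refine ⟨fun l => if l.sum ∈ T then g l else 0, fun l hl => ?_,
    (finite_setOf_sum_mem (hfin.image List.sum) n).subset fun l hl => ⟨hl.1, ?_⟩⟩
  · rw [bar_restrict g (· ∈ T), hg l hl]
    split_ifs with h
    · rfl
    · by_contra hne
      exact h ⟨l, ⟨hl, fun h => hne h.symm⟩, rfl⟩
  · by_contra h
    exact hl.2 (if_neg h)

end BarComplex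

end

/-! ### Finiteness of antisymmetrizations, and passage from lists to tuples -/

noncomputable section

namespace BarComplex

variable {k : Type*} [Field k] {I : Type*}

/-- The tower evaluates `f` only at lists containing all inserted generators and all entries of `l`.
-/
theorem tower_eq_zero {f : List (I →₀ ℕ) → k} {i₀ : I}
    (hf : ∀ l, (∃ m ∈ l, m i₀ ≠ 0) → f l = 0) (p : ℕ) (i : Fin p → I) (l : List (I →₀ ℕ))
    (h : (∃ a, i a = i₀) ∨ ∃ m ∈ l, m i₀ ≠ 0) :
    tower f p (fun a => Finsupp.single (i a) 1) l = 0 := by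
  classical
  induction p generalizing l with
  | zero => exact hf l (h.resolve_left fun ⟨a, _⟩ => a.elim0)
  | succ p ih =>
    rw [tower_succ, headZero_apply, koszul_single]
    refine Finset.sum_eq_zero fun j _ => ?_
    rw [show (j.removeNth fun a => Finsupp.single (i a) (1 : k)) =
      fun a => Finsupp.single (j.removeNth i a) 1 from rfl, ih _ _ _, smul_zero]
    rcases h with ⟨a, ha⟩ | ⟨m, hm, hm'⟩
    · rcases Fin.eq_self_or_eq_succAbove j a with rfl | ⟨b, rfl⟩
      · exact Or.inr ⟨_, List.mem_cons_self, by simp [ha]⟩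
      · exact Or.inl ⟨b, ha⟩
    · exact Or.inr ⟨m, List.mem_cons_of_mem _ hm, hm'⟩

theorem finite_antisymm {f : List (I →₀ ℕ) → k} {n : ℕ}
    (hfin : {l | l.length = n ∧ f l ≠ 0}.Finite) :
    {i : Fin n → I | antisymm n f (fun a => Finsupp.single (i a) 1) ≠ 0}.Finite := by
  classical
  set J : Set I := ⋃ l ∈ {l | l.length = n ∧ f l ≠ 0}, ⋃ m ∈ {m | m ∈ l}, (m.support : Set I)
  have hJ : J.Finite := hfin.biUnion fun l _ =>
    (List.finite_toSet l).biUnion fun m _ => Finset.finite_toSet _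
  refine (Set.Finite.pi fun _ : Fin n => hJ).subset fun i hi a _ => ?_
  by_contra hia
  refine hi ?_
  -- The support of `f` is controlled in length `n` only, so `f` is truncated first.
  rw [antisymm_congr (g := fun l => if l.length = n then f l else 0)
    fun l hl => (if_pos hl).symm]
  refine tower_eq_zero (i₀ := i a) (fun l hl => ?_) n (fun b => i b.rev) []
    (Or.inl ⟨a.rev, by simp⟩)
  obtain ⟨m, hm, hm'⟩ := hl
  split_ifs with h
  · by_contra hne
    exact hia (Set.mem_biUnion (x := l) ⟨h, hne⟩ (Set.mem_biUnion (x := m) hm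
      (Finsupp.mem_support_iff.2 hm')))
  · rfl

theorem contractNth_succ {α : Type*} {n : ℕ} (j : Fin (n + 1)) (op : α → α → α)
    (a : Fin (n + 2) → α) :
    Fin.contractNth j.succ op a = Fin.cons (a 0) (Fin.contractNth j op (Fin.tail a)) := by
  funext i
  induction i using Fin.cases with
  | zero => simp [Fin.contractNth]
  | succ i => simp [Fin.contractNth, Fin.tail]

theorem contractNth_zero {α : Type*} {n : ℕ} (op : α → α → α) (a : Fin (n + 2) → α) :
    Fin.contractNth 0 op a = Fin.cons (op (a 0) (a 1)) (Fin.tail (Fin.tail a)) := by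
  funext i
  induction i using Fin.cases with
  | zero => simp [Fin.contractNth]
  | succ i => simp [Fin.contractNth, Fin.tail]

theorem init_eq_cons {α : Type*} {n : ℕ} (a : Fin (n + 2) → α) :
    Fin.init a = (Fin.cons (a 0) (Fin.init (Fin.tail a)) : Fin (n + 1) → α) := by
  funext i
  induction i using Fin.cases with
  | zero => rfl
  | succ i => rfl

theorem ofFn_eq_cons {α : Type*} {n : ℕ} (a : Fin (n + 1) → α) :
    List.ofFn a = a 0 :: List.ofFn (Fin.tail a) := List.ofFn_succ

/-- `del` on tuples. -/
theorem del_ofFn {n : ℕ} {F : (Fin n → I →₀ ℕ) → k} {f : List (I →₀ ℕ) → k}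
    (h : ∀ m, f (List.ofFn m) = F m) (a : Fin (n + 1) → I →₀ ℕ) :
    del f (List.ofFn a) =
      -(∑ j : Fin n, (-1) ^ ((j : ℕ) + 1) * F (Fin.contractNth j.castSucc (· + ·) a))
      - (-1) ^ (n + 1) * (F (Fin.init a) * eps k (a (Fin.last n))) := by
  induction n generalizing f with
  | zero =>
    have h' : f [] = F (Fin.init a) := (h ![]).trans (congrArg F (Subsingleton.elim _ _))
    rw [ofFn_eq_cons, List.ofFn_zero, del_cons, del_nil, merge_nil, h']
    simp [mul_comm]
  | succ n ih =>
    have h' : ∀ m, fixHead (a 0) f (List.ofFn m) = F (Fin.cons (a 0) m) := fun m => by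
      rw [← h, ofFn_eq_cons (Fin.cons _ _)]
      rfl
    have h0 : merge (a 0) f (List.ofFn (Fin.tail a)) = F (Fin.contractNth 0 (· + ·) a) := by
      rw [contractNth_zero, ← h, ofFn_eq_cons (Fin.tail a), merge_cons, ofFn_eq_cons (Fin.cons _ _)]
      rfl
    rw [ofFn_eq_cons, del_cons, ih h' (Fin.tail a), h0, Fin.sum_univ_succ, init_eq_cons]
    simp only [Fin.castSucc_zero, Fin.val_zero, Fin.val_succ, Fin.castSucc_succ, contractNth_succ,
      pow_succ _ (_ + 1), mul_neg_one, neg_mul, Finset.sum_neg_distrib]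
    have : Fin.tail a (Fin.last n) = a (Fin.last (n + 1)) := rfl
    rw [this]
    ring

end BarComplex

/-! ### Hochschild cochains in monomial coordinates -/

namespace Hochschild

open BarComplex

variable {k A : Type*} [Field k] [Ring A] [Algebra k A] [TopologicalSpace A] [ContinuousMul A]

/-- A multiplicative family of monomials in `A` such that continuous cochains are the same as
finitely supported functions on tuples of monomials. -/
structure MonomialCoordinates (ε : Augmentation k A) (I : Type*) where
  /-- The monomials. -/
  mon : (I →₀ ℕ) → A
  mon_add : ∀ a b, mon (a + b) = mon a * mon b
  map_mon : ∀ m, ε (mon m) = eps k m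
  /-- The values of a cochain on tuples of monomials. -/
  coeff : ∀ n, Cochain k A n ≃ₗ[k] ((Fin n → I →₀ ℕ) →₀ k)
  coeff_apply : ∀ {n} (f : Cochain k A n) (m), coeff n f m = f fun i => mon (m i)

namespace MonomialCoordinates

variable {ε : Augmentation k A} {I : Type*} (C : MonomialCoordinates ε I)

/-- A continuous cochain as a cochain of the bar complex of `I →₀ ℕ`. -/
def toBar (n : ℕ) : Cochain k A n →ₗ[k] (List (I →₀ ℕ) → k) where
  -- Truncation and padding by `0` give junk values at lists of other lengths; only those of length
  -- `n` are meaningful.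
  toFun f l := f fun i => C.mon (l.getD i 0)
  map_add' _ _ := rfl
  map_smul' _ _ := rfl

theorem toBar_ofFn {n : ℕ} (f : Cochain k A n) (m : Fin n → I →₀ ℕ) :
    C.toBar n f (List.ofFn m) = C.coeff n f m := by
  rw [C.coeff_apply]
  exact congrArg f.1 (funext fun i => by simp)

theorem exists_ofFn {α : Type*} {n : ℕ} {l : List α} (hl : l.length = n) :
    ∃ m : Fin n → α, List.ofFn m = l := by
  subst hl
  exact ⟨l.get, List.ofFn_get l⟩

theorem ext_toBar {n : ℕ} {f g : Cochain k A n}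
    (h : ∀ l, l.length = n → C.toBar n f l = C.toBar n g l) : f = g := by
  refine (C.coeff n).injective (Finsupp.ext fun m => ?_)
  rw [← toBar_ofFn, ← toBar_ofFn, h _ (List.length_ofFn)]

/-- Restriction to monomials is a map of complexes, since monomials multiply by adding exponents and
the augmentation restricts to `eps`. -/
theorem bar_toBar {n : ℕ} (f : Cochain k A n) (l : List (I →₀ ℕ)) (hl : l.length = n + 1) :
    bar (C.toBar n f) l = C.toBar (n + 1) (d ε n f) l := by
  obtain ⟨a, rfl⟩ := exists_ofFn hl
  have h1 : bar (C.toBar n f) (List.ofFn a) =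
      eps k (a 0) * C.toBar n f (List.ofFn (Fin.tail a)) - del (C.toBar n f) (List.ofFn a) := by
    rw [ofFn_eq_cons, bar_cons]
  have hc (j : Fin n) : (fun i => C.mon (Fin.contractNth j.castSucc (· + ·) a i)) =
      contract j fun i => C.mon (a i) := by
    funext i
    simp only [contract, Fin.contractNth]
    split_ifs
    · rfl
    · exact C.mon_add _ _
    · rfl
  rw [h1, del_ofFn (C.toBar_ofFn f), toBar_ofFn, toBar_ofFn, C.coeff_apply,
    C.coeff_apply, C.coeff_apply, d_apply, dFun, C.map_mon, C.map_mon]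
  simp only [C.coeff_apply, hc]
  have h2 : (Fin.tail fun i => C.mon (a i)) = fun i => C.mon (Fin.tail a i) := rfl
  have h3 : (Fin.init fun i => C.mon (a i)) = fun i => C.mon (Fin.init a i) := rfl
  rw [h2, h3]
  ring

theorem finite_toBar {n : ℕ} (f : Cochain k A n) :
    {l | l.length = n ∧ C.toBar n f l ≠ 0}.Finite := by
  refine ((C.coeff n f).support.finite_toSet.image List.ofFn).subset fun l hl => ?_
  obtain ⟨a, rfl⟩ := exists_ofFn hl.1
  exact ⟨a, Finsupp.mem_support_iff.2 (by rw [← toBar_ofFn]; exact hl.2), rfl⟩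

theorem exists_toBar_eq {n : ℕ} {g : List (I →₀ ℕ) → k} (hg : {l | l.length = n ∧ g l ≠ 0}.Finite) :
    ∃ f : Cochain k A n, ∀ l, l.length = n → C.toBar n f l = g l := by
  have hfin : (Function.support fun m : Fin n → I →₀ ℕ => g (List.ofFn m)).Finite :=
    Set.Finite.of_finite_image (f := List.ofFn)
      (hg.subset (by rintro _ ⟨m, hm, rfl⟩; exact ⟨List.length_ofFn, hm⟩))
      (List.ofFn_injective.injOn)
  refine ⟨(C.coeff n).symm (Finsupp.ofSupportFinite _ hfin), fun l hl => ?_⟩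
  obtain ⟨a, rfl⟩ := exists_ofFn hl
  rw [toBar_ofFn, LinearEquiv.apply_symm_apply]
  rfl

/-- The antisymmetrization of a cochain on generators. -/
def alt (n : ℕ) : Cochain k A n →ₗ[k] (I →₀ k) [⋀^Fin n]→ₗ[k] k := antisymm n ∘ₗ C.toBar n

theorem alt_eq_zero_of_mem_coboundaries {n : ℕ} {f : Cochain k A n}
    (hf : f ∈ coboundaries ε n) : C.alt n f = 0 := by
  cases n with
  | zero => rw [(Submodule.mem_bot k).1 hf, map_zero]
  | succ n =>
    obtain ⟨g, rfl⟩ := hf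
    exact (antisymm_congr (C.bar_toBar g)).symm.trans (antisymm_bar n _)

theorem bar_toBar_eq_zero {n : ℕ} {f : Cochain k A n} (hf : f ∈ cocycles ε n)
    (l : List (I →₀ ℕ)) (hl : l.length = n + 1) : bar (C.toBar n f) l = 0 := by
  rw [C.bar_toBar f l hl, LinearMap.mem_ker.1 hf, map_zero]
  rfl

/-- The primitive found in the bar complex has finite support, hence comes from a continuous
cochain. In degree 0 antisymmetrization is evaluation, and a vanishing one leaves only zero. -/
theorem mem_coboundaries [CharZero k] {n : ℕ} {f : Cochain k A n} (hf : f ∈ cocycles ε n)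
    (h0 : C.alt n f = 0) : f ∈ coboundaries ε n := by
  cases n with
  | zero =>
    refine (Submodule.mem_bot k).2 (C.ext_toBar fun l hl => ?_)
    rw [List.length_eq_zero_iff.1 hl, map_zero]
    exact congrArg (fun w => w ![]) h0
  | succ n =>
    obtain ⟨g, hg, hfin⟩ := exists_bar_eq_of_finite (C.bar_toBar_eq_zero hf) h0 (C.finite_toBar f)
    obtain ⟨g', hg'⟩ := C.exists_toBar_eq hfin
    refine ⟨g', C.ext_toBar fun l hl => ?_⟩
    rw [← C.bar_toBar g' l hl, ← hg l hl, bar_eq, bar_eq, Pi.sub_apply, Pi.sub_apply,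
      del_congr hg' l hl]
    match l, hl with
    | b :: l, hl => simp only [extHead, hg' l (by simpa using hl)]

end MonomialCoordinates

end Hochschild

end

noncomputable section

/-! ## Antisymmetrization of finitely supported functions on tuples -/

namespace ExteriorMonomials

variable {k : Type*} [Field k] {I : Type*} {n : ℕ}

/-- The antisymmetrization of a finitely supported function on `n`-tuples. -/
def altSum (n : ℕ) : ((Fin n → I) →₀ k) →ₗ[k] ((Fin n → I) →₀ k) :=
  ∑ s : Equiv.Perm (Fin n), (Equiv.Perm.sign s : ℤ) • Finsupp.lmapDomain k k (· ∘ s)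

theorem altSum_apply (c : (Fin n → I) →₀ k) (i : Fin n → I) :
    altSum n c i = ∑ s : Equiv.Perm (Fin n), (Equiv.Perm.sign s : ℤ) • c (i ∘ s.symm) := by
  simp only [altSum, LinearMap.sum_apply, Finsupp.finsetSum_apply, LinearMap.smul_apply,
    Finsupp.smul_apply, Finsupp.lmapDomain_apply]
  refine Finset.sum_congr rfl fun s _ => ?_
  have h : i = (i ∘ s.symm) ∘ s := by funext a; simp
  conv_lhs => rw [h]
  congr 1
  exact Finsupp.mapDomain_apply (f := (· ∘ s)) (s.surjective.injective_comp_right) c _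

/-- The value of `altSum` as a sum of determinants. -/
theorem sum_det (c : (Fin n → I) →₀ k) (i : Fin n → I) :
    (c.sum fun j x => x * Matrix.det (Matrix.of fun a b => Finsupp.single (i b) (1 : k) (j a))) =
      altSum n c i := by
  classical
  induction c using Finsupp.induction_linear with
  | zero => simp
  | add c c' hc hc' =>
    rw [Finsupp.sum_add_index' (by simp) (fun _ _ _ => add_mul _ _ _), hc, hc', map_add,
      Finsupp.add_apply]
  | single j x =>
    rw [Finsupp.sum_single_index (by simp), Matrix.det_apply, altSum_apply, Finset.mul_sum]
    refine Finset.sum_congr rfl fun s _ => ?_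
    have h : (∏ a, (Matrix.of fun a b => Finsupp.single (i b) (1 : k) (j a)) (s a) a) =
        if j = i ∘ s.symm then 1 else 0 := by
      simp only [Matrix.of_apply, Finsupp.single_apply, Finset.prod_ite_zero, Finset.prod_const_one,
        Finset.mem_univ, true_implies]
      congr 1
      refine propext ⟨fun h => funext fun a => ?_, fun h a => ?_⟩
      · have := h (s.symm a)
        rw [Equiv.apply_symm_apply] at this
        exact this.symm
      · rw [h]; simp
    rw [h, Finsupp.single_apply]
    split_ifs <;> simp [Units.smul_def, mul_comm]

/-- The element of the exterior algebra with given coefficients. -/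
def ofCoeff (n : ℕ) : ((Fin n → I) →₀ k) →ₗ[k] ExteriorAlgebra k (I →₀ k) :=
  Finsupp.linearCombination k fun j => ExteriorAlgebra.ιMulti k n fun a => Finsupp.single (j a) 1

theorem ofCoeff_single (j : Fin n → I) : ofCoeff (k := k) n (Finsupp.single j 1) =
    ExteriorAlgebra.ιMulti k n fun a => Finsupp.single (j a) 1 := by
  simp [ofCoeff]

/-- Permuting the factors of an exterior product changes it by the sign already present in `altSum`,
so all `n!` terms coincide. -/
theorem ofCoeff_altSum (c : (Fin n → I) →₀ k) :
    ofCoeff n (altSum n c) = (n ! : k) • ofCoeff n c := by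
  suffices h : ofCoeff n ∘ₗ altSum n = (n ! : k) • ofCoeff (k := k) (I := I) n from
    LinearMap.congr_fun h c
  refine Finsupp.lhom_ext' fun j => LinearMap.ext_ring ?_
  simp only [LinearMap.comp_apply, Finsupp.lsingle_apply, LinearMap.smul_apply, ofCoeff_single,
    altSum, LinearMap.sum_apply, map_sum, map_zsmul, Finsupp.lmapDomain_apply,
    Finsupp.mapDomain_single]
  have h (s : Equiv.Perm (Fin n)) : (Equiv.Perm.sign s : ℤ) •
      (ExteriorAlgebra.ιMulti k n fun a => Finsupp.single ((j ∘ s) a) (1 : k)) =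
      ExteriorAlgebra.ιMulti k n fun a => Finsupp.single (j a) (1 : k) := by
    have := (ExteriorAlgebra.ιMulti k n).map_perm (fun a => Finsupp.single (j a) (1 : k)) s
    refine (congrArg ((Equiv.Perm.sign s : ℤ) • ·) this).trans ?_
    rw [Units.smul_def, smul_smul]
    simp
  rw [Finset.sum_congr rfl fun s _ => h s]
  simp [Fintype.card_perm, Nat.cast_smul_eq_nsmul]

/-- Exterior products of vectors span; modulo the span of products of basis vectors such a product
is an alternating map that vanishes on basis tuples. -/
theorem exists_sum_ofCoeff (w : ExteriorAlgebra k (I →₀ k)) :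
    ∃ c : (Σ n, Fin n → I) →₀ k,
      w = ∑ n ∈ c.splitSupport, ofCoeff n (c.split n) := by
  let T : ((Σ n, Fin n → I) →₀ k) →ₗ[k] ExteriorAlgebra k (I →₀ k) :=
    Finsupp.linearCombination k fun x =>
      ExteriorAlgebra.ιMulti k x.1 fun a => Finsupp.single (x.2 a) 1
  have hT : LinearMap.range T = ⊤ := by
    rw [eq_top_iff, ← ExteriorAlgebra.ιMulti_span, Submodule.span_le]
    rintro _ ⟨⟨n, v⟩, rfl⟩
    have h0 : (LinearMap.range T).mkQ.compAlternatingMap (ExteriorAlgebra.ιMulti k n) = 0 := by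
      refine Module.Basis.ext_alternating (Finsupp.basisSingleOne (R := k)) fun i _ => ?_
      simp only [Finsupp.coe_basisSingleOne]
      refine (Submodule.Quotient.mk_eq_zero _).2 ⟨Finsupp.single ⟨n, i⟩ 1, ?_⟩
      simp [T]
    exact (Submodule.Quotient.mk_eq_zero _).1 (congrArg (fun g => g v) h0)
  obtain ⟨c, rfl⟩ := LinearMap.range_eq_top.1 hT w
  refine ⟨c, ?_⟩
  rw [Finsupp.linearCombination_apply, Finsupp.sigma_sum]
  rfl

end ExteriorMonomials

/-! ### Cup products of the cocycles dual to the generators -/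

namespace Hochschild

open BarComplex ExteriorMonomials

variable {k A : Type*} [Field k] [Ring A] [Algebra k A] [TopologicalSpace A] [ContinuousMul A]
  {ε : Augmentation k A}

/-- Equal cochains up to reindexing define equal elements of the cohomology algebra. -/
theorem of_mk_eq {m n : ℕ} (e : m = n) (f : cocycles ε m) (g : cocycles ε n)
    (h : ∀ a : Fin m → A, f.1 a = g.1 (fun i => a (Fin.cast e.symm i))) :
    DirectSum.of (HH ε) m (HH.mk ε m f) = DirectSum.of (HH ε) n (HH.mk ε n g) :=
  DirectSum.of_eq_of_gradedMonoid_eq (gradedMk_eq ε e f g h)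

theorem mem_cocycles_of_eq {m n : ℕ} (e : m = n) {f : Cochain k A m} {g : Cochain k A n}
    (h : ∀ a : Fin m → A, f a = g (fun i => a (Fin.cast e.symm i))) (hf : f ∈ cocycles ε m) :
    g ∈ cocycles ε n := by
  subst e
  have : f = g := Cochain.ext h
  rwa [← this]

omit [ContinuousMul A] in
theorem exists_cast {m n : ℕ} (e : m = n) (f : Cochain k A m) :
    ∃ g : Cochain k A n, ∀ a : Fin m → A, f a = g (fun i => a (Fin.cast e.symm i)) := by
  subst e
  exact ⟨f, fun _ => rfl⟩

theorem of_mk_mul {p q : ℕ} (f : cocycles ε p) (g : cocycles ε q) :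
    (DirectSum.of (HH ε) p (HH.mk ε p f) * DirectSum.of (HH ε) q (HH.mk ε q g) : Cohomology ε) =
      DirectSum.of (HH ε) (p + q)
        (HH.mk ε (p + q) ⟨cup f.1 g.1, cup_mem_cocycles ε f.2 g.2⟩) := by
  rw [DirectSum.of_mul_of, gMul_mk]

namespace MonomialCoordinates

variable {I : Type*} (C : MonomialCoordinates ε I)

/-- The cochain that is dual to a tuple of generators. -/
def dualCochain {n : ℕ} (j : Fin n → I) : Cochain k A n :=
  (C.coeff n).symm (Finsupp.single (fun a => Finsupp.single (j a) 1) 1)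

theorem toBar_dualCochain {n : ℕ} (j : Fin n → I) (l : List (I →₀ ℕ)) (hl : l.length = n) :
    C.toBar n (C.dualCochain j) l = indicator (List.ofFn j) l := by
  classical
  obtain ⟨a, rfl⟩ := exists_ofFn hl
  rw [toBar_ofFn, dualCochain, LinearEquiv.apply_symm_apply]
  clear hl
  induction n with
  | zero => simp [indicator, Subsingleton.elim a (fun i => Finsupp.single (j i) 1)]
  | succ n ih =>
    rw [ofFn_eq_cons, ofFn_eq_cons, indicator, ← ih, Finsupp.single_apply, Finsupp.single_apply,
      ite_zero_mul_ite_zero, mul_one]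
    congr 1
    refine propext ⟨fun h => ?_, fun ⟨h0, h⟩ => ?_⟩
    · subst h; exact ⟨rfl, rfl⟩
    · funext b
      induction b using Fin.cases with
      | zero => exact h0.symm
      | succ b => exact congrFun h b

theorem alt_dualCochain {n : ℕ} (j : Fin n → I) (v) :
    C.alt n (C.dualCochain j) v = Matrix.det (Matrix.of fun a b => v b (j a)) := by
  rw [alt, LinearMap.comp_apply, antisymm_congr (C.toBar_dualCochain j), antisymm_indicator]

/-- The `1`-cocycle dual to a generator. -/
def genCocycle (i : I) : cocycles ε 1 :=
  ⟨C.dualCochain fun _ => i, by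
    refine LinearMap.mem_ker.2 (C.ext_toBar fun l hl => ?_)
    rw [← C.bar_toBar _ l hl, map_zero]
    match l, hl with
    | [b, x], _ =>
      have h (m : I →₀ ℕ) : C.toBar 1 (C.dualCochain fun _ => i) [m] =
          indicator [i] [m] := C.toBar_dualCochain _ _ rfl
      -- The indicator of a generator is a derivation: an exponent of degree one splits only with
      -- one summand zero.
      have h1 : indicator (k := k) [i] [b + x] =
          eps k b * indicator [i] [x] + eps k x * indicator [i] [b] := by
        classical
        simp only [indicator, mul_one]
        by_cases hb : b = 0
        · by_cases hx : x = 0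
          · subst hb hx
            simp [eq_comm (a := (0 : I →₀ ℕ))]
          · simp [hb, eps_zero, eps_of_ne hx]
        · by_cases hx : x = 0
          · simp [hx, eps_zero, eps_of_ne hb]
          · rw [eps_of_ne hb, eps_of_ne hx, if_neg]
            · ring
            · intro h
              have hd := congrArg Finsupp.degree h
              rw [map_add, Finsupp.degree_single] at hd
              have h1 : Finsupp.degree b ≠ 0 := fun h => hb ((Finsupp.degree_eq_zero_iff b).1 h)
              have h2 : Finsupp.degree x ≠ 0 := fun h => hx ((Finsupp.degree_eq_zero_iff x).1 h)
              omega
      rw [bar_cons, del_cons, merge_cons, del_cons, del_nil, merge_nil, fixHead_apply, h, h, h, h1]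
      simp⟩

/-- The generators of the cohomology. -/
def gen (i : I) : HH ε 1 := HH.mk ε 1 (C.genCocycle i)

theorem dualCochain_mon {n : ℕ} (j : Fin n → I) (m : Fin n → I →₀ ℕ) :
    C.dualCochain j (fun i => C.mon (m i)) = indicator (List.ofFn j) (List.ofFn m) := by
  rw [← C.coeff_apply, ← toBar_ofFn, toBar_dualCochain _ _ _ List.length_ofFn]

/-- A cochain is determined by its values on monomials, and there both sides are the same product of
indicators; `1 + n` is recast as `n + 1`. -/
theorem cup_dualCochain {n : ℕ} (j : Fin (n + 1) → I) (a : Fin (1 + n) → A) :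
    cup (C.genCocycle (j 0)).1 (C.dualCochain (Fin.tail j)) a =
      C.dualCochain j fun i => a (Fin.cast (Nat.add_comm 1 n).symm i) := by
  obtain ⟨f, hf⟩ := exists_cast (Nat.add_comm 1 n)
    (cup (C.genCocycle (j 0)).1 (C.dualCochain (Fin.tail j)))
  rw [hf]
  refine congrArg (fun g : Cochain k A (n + 1) => g _) ?_
  refine (C.coeff _).injective (Finsupp.ext fun m => ?_)
  have h := hf fun i => C.mon (m (Fin.cast (Nat.add_comm 1 n) i))
  rw [C.coeff_apply, C.coeff_apply, dualCochain_mon]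
  refine h.symm.trans ?_
  rw [cup_apply]
  have h1 := C.dualCochain_mon (fun _ : Fin 1 => j 0) fun _ => m 0
  have h2 := C.dualCochain_mon (Fin.tail j) (Fin.tail m)
  have h3 : (fun i : Fin n => C.mon (m (Fin.cast (Nat.add_comm 1 n) (Fin.natAdd 1 i)))) =
      fun i => C.mon (Fin.tail m i) := by
    funext i
    exact congrArg (fun x => C.mon (m x)) (Fin.ext (by simp))
  have h4 : (fun i : Fin 1 => C.mon (m (Fin.cast (Nat.add_comm 1 n) (Fin.castAdd n i)))) =
      fun _ => C.mon (m 0) := by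
    funext i
    exact congrArg (fun x => C.mon (m x)) (Fin.ext (by simp))
  rw [h3, h4, h2, ofFn_eq_cons j, ofFn_eq_cons m, indicator]
  refine congrArg (· * _) (h1.trans ?_)
  simp [indicator]

theorem dualCochain_mem_cocycles {n : ℕ} (j : Fin n → I) : C.dualCochain j ∈ cocycles ε n := by
  induction n with
  | zero =>
    refine LinearMap.mem_ker.2 (Cochain.ext fun a => ?_)
    have h : Fin.init a = Fin.tail a := Subsingleton.elim _ _
    have h' : a (Fin.last 0) = a 0 := rfl
    rw [d_apply, dFun, h, h', Finset.univ_eq_empty, Finset.sum_empty, Cochain.zero_apply]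
    ring
  | succ n ih =>
    exact mem_cocycles_of_eq (Nat.add_comm 1 n) (C.cup_dualCochain j)
      (cup_mem_cocycles ε (C.genCocycle (j 0)).2 (ih _))

theorem prod_gen {n : ℕ} (j : Fin n → I) :
    (List.ofFn fun a => (DirectSum.of (HH ε) 1 (C.gen (j a)) : Cohomology ε)).prod =
      DirectSum.of (HH ε) n (HH.mk ε n ⟨C.dualCochain j, C.dualCochain_mem_cocycles j⟩) := by
  induction n with
  | zero =>
    rw [List.ofFn_zero, List.prod_nil]
    refine of_mk_eq rfl (oneCocycle ε) _ fun a => ?_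
    have h := C.dualCochain_mon j ![]
    rw [List.ofFn_zero, List.ofFn_zero] at h
    exact (h.symm.trans (congrArg _ (Subsingleton.elim _ _)))
  | succ n ih =>
    rw [ofFn_eq_cons, List.prod_cons]
    refine (congrArg (_ * ·) (ih (Fin.tail j))).trans ?_
    rw [gen, of_mk_mul]
    exact of_mk_eq (Nat.add_comm 1 n) _ _ (C.cup_dualCochain j)

end MonomialCoordinates

end Hochschild

end

/-! ### The isomorphism with the exterior algebra -/

noncomputable section

namespace Hochschild

open BarComplex ExteriorMonomials

/-- Products of pairwise anticommuting elements commute up to the usual sign. -/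
theorem list_prod_anticomm {R : Type*} [Ring R] (l l' : List R)
    (h : ∀ a ∈ l, ∀ b ∈ l', a * b = -(b * a)) :
    l.prod * l'.prod = (-1) ^ (l.length * l'.length) * (l'.prod * l.prod) := by
  induction l with
  | nil => simp
  | cons a l ih =>
    have h1 : a * l'.prod = (-1) ^ l'.length * (l'.prod * a) := by
      have h := h a List.mem_cons_self
      clear ih
      induction l' with
      | nil => simp
      | cons b l' ih' =>
        rw [List.prod_cons, ← mul_assoc, h b List.mem_cons_self, neg_mul, mul_assoc,
          ih' (fun _ _ b hb => by rename_i h0 _ _; exact h0 _ (by assumption) b (List.mem_cons_of_mem _ hb))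
            (fun b hb => h b (List.mem_cons_of_mem _ hb)),
          List.length_cons, pow_succ, mul_neg_one, neg_mul, mul_assoc,
          ((Commute.neg_one_left b).pow_left _).left_comm]
    rw [List.prod_cons, mul_assoc, ih fun a ha => h a (List.mem_cons_of_mem _ ha),
      ((Commute.neg_one_left a).pow_left _).symm.left_comm, ← mul_assoc a, h1, List.length_cons,
      add_mul, one_mul, pow_add]
    simp only [mul_assoc]

variable {k A : Type*} [Field k] [Ring A] [Algebra k A] [TopologicalSpace A] [ContinuousMul A]
  {ε : Augmentation k A}

namespace MonomialCoordinates

variable {I : Type*} (C : MonomialCoordinates ε I)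

/-- Linear combinations of the generators. -/
def lin : (I →₀ k) →ₗ[k] Cohomology ε :=
  Finsupp.linearCombination k fun i => DirectSum.of (HH ε) 1 (C.gen i)

theorem lin_single (i : I) : C.lin (Finsupp.single i 1) = DirectSum.of (HH ε) 1 (C.gen i) := by
  simp [lin]

/-- Linear combinations of products of generators, as cocycles. -/
def dualSum (n : ℕ) : ((Fin n → I) →₀ k) →ₗ[k] cocycles ε n :=
  Finsupp.linearCombination k fun j => ⟨C.dualCochain j, C.dualCochain_mem_cocycles j⟩

theorem alt_dualSum {n : ℕ} (c : (Fin n → I) →₀ k) (i : Fin n → I) :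
    C.alt n (C.dualSum n c).1 (fun a => Finsupp.single (i a) 1) = altSum n c i := by
  rw [← sum_det]
  induction c using Finsupp.induction_linear with
  | zero => simp
  | add c c' hc hc' =>
    rw [Finsupp.sum_add_index' (by simp) (fun _ _ _ => add_mul _ _ _), ← hc, ← hc', map_add,
      Submodule.coe_add, map_add, AlternatingMap.add_apply]
  | single j x =>
    rw [Finsupp.sum_single_index (by simp), dualSum, Finsupp.linearCombination_single,
      Submodule.coe_smul, map_smul, AlternatingMap.smul_apply, alt_dualCochain, smul_eq_mul]

variable [CharZero k]

/-- The difference has vanishing antisymmetrization, since alternating maps are determined on basis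
tuples; then `mem_coboundaries` applies. -/
theorem mk_eq_of_alt_eq {n : ℕ} (f g : cocycles ε n)
    (h : ∀ i : Fin n → I, C.alt n f.1 (fun a => Finsupp.single (i a) 1) =
      C.alt n g.1 fun a => Finsupp.single (i a) 1) : HH.mk ε n f = HH.mk ε n g := by
  rw [← sub_eq_zero, ← map_sub, HH.mk_eq_zero]
  refine C.mem_coboundaries (f - g).2 ?_
  refine Module.Basis.ext_alternating (Finsupp.basisSingleOne (R := k)) fun i _ => ?_
  simp only [Finsupp.coe_basisSingleOne]
  rw [Submodule.coe_sub, map_sub, AlternatingMap.sub_apply, h, sub_self]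
  rfl

/-- The two products antisymmetrize to 2 by 2 determinants with exchanged rows. -/
theorem gen_anticomm (i j : I) :
    (DirectSum.of (HH ε) 1 (C.gen i) * DirectSum.of (HH ε) 1 (C.gen j) : Cohomology ε) +
      DirectSum.of (HH ε) 1 (C.gen j) * DirectSum.of (HH ε) 1 (C.gen i) = 0 := by
  have h (i j : I) :
      (DirectSum.of (HH ε) 1 (C.gen i) * DirectSum.of (HH ε) 1 (C.gen j) : Cohomology ε) =
      DirectSum.of (HH ε) 2
        (HH.mk ε 2 ⟨C.dualCochain ![i, j], C.dualCochain_mem_cocycles ![i, j]⟩) := by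
    rw [← C.prod_gen]
    simp
  rw [h, h, ← map_add, ← map_add, C.mk_eq_of_alt_eq _ 0 fun s => ?_, map_zero, map_zero]
  simp only [Submodule.coe_add, map_add, AlternatingMap.add_apply, alt_dualCochain,
    Matrix.det_fin_two, Submodule.coe_zero, map_zero, AlternatingMap.zero_apply]
  simp
  ring

theorem lin_anticomm (v w : I →₀ k) : C.lin v * C.lin w + C.lin w * C.lin v = 0 := by
  induction v using Finsupp.induction_linear with
  | zero => simp
  | add v v' hv hv' =>
    rw [map_add, add_mul, mul_add, add_add_add_comm, hv, hv', add_zero]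
  | single i c =>
    induction w using Finsupp.induction_linear with
    | zero => simp
    | add w w' hw hw' =>
      rw [map_add, add_mul, mul_add, add_add_add_comm, hw, hw', add_zero]
    | single j c' =>
      rw [← Finsupp.smul_single_one i c, ← Finsupp.smul_single_one j c', map_smul, map_smul, lin_single, lin_single, smul_mul_smul_comm,
        smul_mul_smul_comm, mul_comm c', ← smul_add, gen_anticomm, smul_zero]

theorem lin_sq (v : I →₀ k) : C.lin v * C.lin v = 0 := by
  have h := C.lin_anticomm v v
  rw [← two_smul k] at h
  exact (smul_eq_zero.1 h).resolve_left two_ne_zero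

/-- The homomorphism from the exterior algebra to the cohomology. -/
def exteriorHom : ExteriorAlgebra k (I →₀ k) →ₐ[k] Cohomology ε :=
  ExteriorAlgebra.lift k ⟨C.lin, C.lin_sq⟩

theorem exteriorHom_ι (v : I →₀ k) : C.exteriorHom (ExteriorAlgebra.ι k v) = C.lin v :=
  ExteriorAlgebra.lift_ι_apply _ _ _ _

theorem exteriorHom_ofCoeff {n : ℕ} (c : (Fin n → I) →₀ k) :
    C.exteriorHom (ofCoeff n c) = DirectSum.of (HH ε) n (HH.mk ε n (C.dualSum n c)) := by
  suffices h : C.exteriorHom.toLinearMap ∘ₗ ofCoeff n =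
      DirectSum.lof k ℕ (HH ε) n ∘ₗ HH.mk ε n ∘ₗ C.dualSum n from LinearMap.congr_fun h c
  refine Finsupp.lhom_ext' fun j => LinearMap.ext_ring ?_
  simp only [LinearMap.comp_apply, Finsupp.lsingle_apply, ofCoeff_single, dualSum,
    Finsupp.linearCombination_single, one_smul, AlgHom.toLinearMap_apply]
  refine Eq.trans ?_ (C.prod_gen j)
  rw [ExteriorAlgebra.ιMulti_apply, map_list_prod, List.map_ofFn]
  simp only [Function.comp_def, exteriorHom_ι, lin_single]

theorem exists_exteriorHom_ofCoeff_eq {n : ℕ} (x : HH ε n) :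
    ∃ c : (Fin n → I) →₀ k, C.exteriorHom (ofCoeff n c) = DirectSum.of (HH ε) n x := by
  obtain ⟨f, rfl⟩ := HH.mk_surjective ε n x
  let c₀ : (Fin n → I) →₀ k := Finsupp.ofSupportFinite
    (fun i => C.alt n f.1 fun a => Finsupp.single (i a) 1) (finite_antisymm (C.finite_toBar f.1))
  -- The function `c₀` is already alternating, so `altSum` multiplies it by `n!`.
  refine ⟨(n ! : k)⁻¹ • c₀, ?_⟩
  rw [exteriorHom_ofCoeff]
  refine congrArg _ (C.mk_eq_of_alt_eq _ _ fun i => ?_)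
  have h (s : Equiv.Perm (Fin n)) : (Equiv.Perm.sign s : ℤ) • c₀ (i ∘ s.symm) = c₀ i := by
    refine (congrArg ((Equiv.Perm.sign s : ℤ) • ·)
      ((C.alt n f.1).map_perm (fun a => Finsupp.single (i a) (1 : k)) s.symm)).trans ?_
    rw [Equiv.Perm.sign_symm, Units.smul_def, smul_smul]
    simp
    rfl
  rw [alt_dualSum, map_smul, Finsupp.smul_apply, altSum_apply, Finset.sum_congr rfl fun s _ => h s]
  have hn : (n ! : k) ≠ 0 := Nat.cast_ne_zero.2 (Nat.factorial_ne_zero n)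
  simp only [Finset.sum_const, Finset.card_univ, Fintype.card_perm, Fintype.card_fin,
    nsmul_eq_mul, smul_eq_mul]
  rw [inv_mul_cancel_left₀ hn]
  rfl

theorem exteriorHom_surjective : Function.Surjective C.exteriorHom := by
  intro x
  induction x using DirectSum.induction_on with
  | zero => exact ⟨0, map_zero _⟩
  | of n x => exact (C.exists_exteriorHom_ofCoeff_eq x).imp' _ fun _ h => h
  | add x y hx hy =>
    obtain ⟨v, rfl⟩ := hx
    obtain ⟨w, rfl⟩ := hy
    exact ⟨v + w, map_add _ _ _⟩

/-- Coboundaries antisymmetrize to zero, so `altSum n c = 0`, and then `n!` times the exterior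
element vanishes. -/
theorem ofCoeff_eq_zero {n : ℕ} {c : (Fin n → I) →₀ k}
    (h : HH.mk ε n (C.dualSum n c) = 0) : ofCoeff n c = 0 := by
  have h0 : altSum n c = 0 := by
    ext i
    rw [← C.alt_dualSum, C.alt_eq_zero_of_mem_coboundaries ((HH.mk_eq_zero ε _).1 h)]
    rfl
  have h1 := ofCoeff_altSum c
  rw [h0, map_zero] at h1
  exact (smul_eq_zero.1 h1.symm).resolve_left (Nat.cast_ne_zero.2 (Nat.factorial_ne_zero n))

theorem exteriorHom_injective : Function.Injective C.exteriorHom := by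
  refine (injective_iff_map_eq_zero _).2 fun w hw => ?_
  obtain ⟨c, rfl⟩ := exists_sum_ofCoeff w
  refine Finset.sum_eq_zero fun n hn => C.ofCoeff_eq_zero ?_
  rw [map_sum] at hw
  simp only [exteriorHom_ofCoeff] at hw
  -- Each homogeneous part of `w` is sent to its own degree, so projection isolates it.
  have h := congrArg (DirectSum.component k ℕ (HH ε) n) hw
  rw [map_sum, map_zero, Finset.sum_eq_single n] at h
  · rwa [← DirectSum.lof_eq_of k, DirectSum.component.lof_self] at h
  · intro m _ hm
    rw [← DirectSum.lof_eq_of k, DirectSum.component.of, dif_neg hm]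
  · exact fun h => absurd hn h

/-- The cohomology is the exterior algebra on the generators. -/
def exteriorEquiv : ExteriorAlgebra k (I →₀ k) ≃ₐ[k] Cohomology ε :=
  AlgEquiv.ofBijective C.exteriorHom ⟨C.exteriorHom_injective, C.exteriorHom_surjective⟩

theorem exteriorEquiv_ι_single (i : I) :
    C.exteriorEquiv (ExteriorAlgebra.ι k (Finsupp.single i 1)) = DirectSum.of (HH ε) 1 (C.gen i) :=
  (C.exteriorHom_ι _).trans (C.lin_single i)

theorem gen_injective : Function.Injective C.gen := by
  intro i j h
  have h' : C.exteriorEquiv (ExteriorAlgebra.ι k (Finsupp.single i 1)) =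
      C.exteriorEquiv (ExteriorAlgebra.ι k (Finsupp.single j 1)) := by
    rw [exteriorEquiv_ι_single, exteriorEquiv_ι_single, h]
  exact Finsupp.single_left_injective one_ne_zero
    ((ExteriorAlgebra.ι_inj k _ _).1 (C.exteriorEquiv.injective h'))

theorem adjoin_gen : Algebra.adjoin k (Set.range fun i => DirectSum.of (HH ε) 1 (C.gen i)) =
    (⊤ : Subalgebra k (Cohomology ε)) := by
  refine Algebra.eq_top_iff.2 fun x => ?_
  obtain ⟨w, rfl⟩ := C.exteriorHom_surjective x
  induction w using ExteriorAlgebra.induction with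
  | algebraMap r => rw [AlgHom.commutes]; exact Subalgebra.algebraMap_mem _ _
  | ι v =>
    rw [exteriorHom_ι]
    induction v using Finsupp.induction_linear with
    | zero => rw [map_zero]; exact Subalgebra.zero_mem _
    | add v w hv hw => rw [map_add]; exact Subalgebra.add_mem _ hv hw
    | single i c =>
      rw [lin, Finsupp.linearCombination_single]
      exact Subalgebra.smul_mem _ (Algebra.subset_adjoin (Set.mem_range_self i)) c
  | mul a b ha hb => rw [map_mul]; exact Subalgebra.mul_mem _ ha hb
  | add a b ha hb => rw [map_add]; exact Subalgebra.add_mem _ ha hb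

/-- Both classes come from the exterior algebra, where by bilinearity only products of anticommuting
basis vectors must be exchanged. -/
theorem graded_comm (C : MonomialCoordinates ε I) (p q : ℕ) (x : HH ε p) (y : HH ε q) :
    (DirectSum.of (HH ε) p x * DirectSum.of (HH ε) q y : Cohomology ε) =
      (-1) ^ (p * q) * (DirectSum.of (HH ε) q y * DirectSum.of (HH ε) p x) := by
  obtain ⟨c, hc⟩ := C.exists_exteriorHom_ofCoeff_eq x
  obtain ⟨c', hc'⟩ := C.exists_exteriorHom_ofCoeff_eq y
  have h1 : (-1 : Cohomology ε) = C.exteriorHom (-1) := by rw [map_neg, map_one]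
  rw [← hc, ← hc', h1, ← map_pow, ← map_mul, ← map_mul, ← map_mul]
  congr 1
  clear hc hc'
  have hm (j : Fin p → I) (j' : Fin q → I) :
      ofCoeff (k := k) p (Finsupp.single j 1) * ofCoeff q (Finsupp.single j' 1) =
      (-1) ^ (p * q) * (ofCoeff q (Finsupp.single j' 1) * ofCoeff p (Finsupp.single j 1)) := by
    rw [ofCoeff_single, ofCoeff_single, ExteriorAlgebra.ιMulti_apply, ExteriorAlgebra.ιMulti_apply,
      list_prod_anticomm, List.length_ofFn, List.length_ofFn]
    intro a ha b hb
    obtain ⟨i, rfl⟩ := List.mem_ofFn.1 ha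
    obtain ⟨i', rfl⟩ := List.mem_ofFn.1 hb
    exact eq_neg_of_add_eq_zero_left (ExteriorAlgebra.ι_add_mul_swap _ _)
  induction c using Finsupp.induction_linear with
  | zero => simp
  | add c d hc hd => rw [map_add, add_mul, mul_add, mul_add, hc, hd]
  | single j r =>
    induction c' using Finsupp.induction_linear with
    | zero => simp
    | add c d hc hd => rw [map_add, add_mul, mul_add, mul_add, hc, hd]
    | single j' r' =>
      rw [← Finsupp.smul_single_one j r, ← Finsupp.smul_single_one j' r', map_smul, map_smul, smul_mul_smul_comm, smul_mul_smul_comm, hm,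
        mul_smul_comm, mul_comm r']

end MonomialCoordinates

end Hochschild

end

/-! ### Continuous cochains on the incidence algebra -/

noncomputable section

namespace GraphIncidence

open Hochschild BarComplex

variable {k : Type*} [Field k]

namespace IncAlg

/-- The indicator function of a type. -/
def delta (k : Type*) [Field k] (t : Types) : IncAlg k := fun s => open Classical in
  if s = t then 1 else 0

open Classical in
theorem delta_apply (t s : Types) : delta k t s = if s = t then 1 else 0 := rfl

open Classical in
/-- Restriction of a function to a finite set of types. -/
def restrict (S : Finset Types) (a : IncAlg k) : IncAlg k := fun t => if t ∈ S then a t else 0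

theorem restrict_eq_sum (S : Finset Types) (a : IncAlg k) :
    restrict S a = ∑ t ∈ S, a t • delta k t := by
  classical
  funext s
  have h : (∑ t ∈ S, a t • delta k t : IncAlg k) s = ∑ t ∈ S, a t * delta k t s :=
    Finset.sum_apply (M := fun _ : Types => k) s S fun t => a t • delta k t
  rw [h, restrict]
  simp only [delta_apply, mul_ite, mul_one, mul_zero]
  exact (Finset.sum_ite_eq S s fun t => a t).symm

theorem restrict_add (S : Finset Types) (a : IncAlg k) :
    restrict S a + (a - restrict S a) = a := add_sub_cancel _ _

theorem sub_restrict_apply_of_mem {S : Finset Types} (a : IncAlg k) {t : Types} (h : t ∈ S) :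
    (a - restrict S a) t = 0 := by
  change a t - restrict S a t = 0
  rw [restrict, if_pos h, sub_self]

theorem sub_restrict_apply_of_eq_zero {S : Finset Types} {a : IncAlg k} {t : Types} (h : a t = 0) :
    (a - restrict S a) t = 0 := by
  change a t - restrict S a t = 0
  rw [restrict, h, ite_self, sub_self]

end IncAlg

open IncAlg

theorem exists_finset_of_isOpen {U : Set (IncAlg k)} (hU : IsOpen U) (h0 : 0 ∈ U) :
    ∃ S : Finset Types, ∀ a : IncAlg k, (∀ t ∈ S, a t = 0) → a ∈ U := by
  let _ : TopologicalSpace k := ⊥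
  obtain ⟨S, u, hu, hS⟩ := (isOpen_pi_iff (A := fun _ : Types => k)).1 hU 0 h0
  refine ⟨S, fun a ha => hS fun t ht => ?_⟩
  rw [ha t ht]
  exact (hu t ht).2

/-- This is continuity at the origin, so all arguments must vanish on `S`;
`exists_finset_of_cochain` improves this to a single argument. -/
theorem exists_finset_forall_eq_zero {n : ℕ} (f : Cochain k (IncAlg k) (n + 1)) :
    ∃ S : Finset Types, ∀ a, (∀ i, ∀ t ∈ S, a i t = 0) → f a = 0 := by
  classical
  have h0 : f 0 = 0 := f.1.map_coord_zero 0 rfl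
  obtain ⟨J, u, hu, hJ⟩ := isOpen_pi_iff.1 (f.isLocallyConstant.isOpen_fiber 0) 0 h0
  choose! S hS using fun i (hi : i ∈ J) => exists_finset_of_isOpen (hu i hi).1 (hu i hi).2
  exact ⟨J.biUnion S, fun a ha => hJ fun i hi => hS i hi _ fun t ht =>
    ha i t (Finset.mem_biUnion.2 ⟨i, hi, ht⟩)⟩

/-- Fixing one argument of a cochain. -/
def fixArg {n : ℕ} (f : Cochain k (IncAlg k) (n + 1)) (j : Fin (n + 1)) (b : IncAlg k) :
    Cochain k (IncAlg k) n :=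
  ⟨f.1.curryMid j b, by
    have h : IsLocallyConstant (f.1 : (Fin (n + 1) → IncAlg k) → k) := f.2
    exact h.comp_continuous (continuous_const.finInsertNth j continuous_id)⟩

theorem fixArg_apply {n : ℕ} (f : Cochain k (IncAlg k) (n + 1)) (j : Fin (n + 1)) (b : IncAlg k)
    (a) : fixArg f j b a = f (j.insertNth b a) := rfl

/-- A continuous cochain factors through a finite set of types in each argument. -/
theorem exists_finset_of_cochain {n : ℕ} (f : Cochain k (IncAlg k) n) :
    ∃ S : Finset Types, ∀ a i, (∀ t ∈ S, a i t = 0) → f a = 0 := by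
  classical
  induction n with
  | zero => exact ⟨∅, fun _ i => i.elim0⟩
  | succ n ih =>
    obtain ⟨S₀, hS₀⟩ := exists_finset_forall_eq_zero f
    choose S hS using fun j t => ih (fixArg f j (delta k t))
    refine ⟨S₀ ∪ Finset.univ.biUnion fun j => S₀.biUnion (S j), fun a i hi => ?_⟩
    have hi₀ : ∀ t ∈ S₀, a i t = 0 := fun t ht => hi t (Finset.mem_union_left _ ht)
    -- Multilinear expansion leaves one term per set `s` of restricted arguments. For `s` empty
    -- every argument vanishes on `S₀`; otherwise some argument is a finite combination of
    -- indicators and can be fixed at one of them.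
    have ha : a = (fun j => restrict S₀ (a j)) + fun j => a j - restrict S₀ (a j) :=
      funext fun j => (restrict_add S₀ (a j)).symm
    rw [ha]
    refine (f.1.map_add_univ _ _).trans (Finset.sum_eq_zero fun s _ => ?_)
    rcases s.eq_empty_or_nonempty with rfl | ⟨j, hj⟩
    · rw [Finset.piecewise_empty]
      exact hS₀ _ fun i t ht => sub_restrict_apply_of_mem _ ht
    · set y := s.piecewise (fun j => restrict S₀ (a j)) fun j => a j - restrict S₀ (a j) with hy
      have hyj : y j = ∑ t ∈ S₀, a j t • delta k t := by
        rw [hy, Finset.piecewise_eq_of_mem _ _ _ hj, restrict_eq_sum]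
      rw [← Function.update_eq_self j y, hyj, f.1.map_update_sum]
      refine Finset.sum_eq_zero fun t ht => ?_
      rw [f.1.map_update_smul]
      -- If the vanishing argument is the fixed one, its coefficients on `S₀` are zero; if not, the
      -- inductive finite set for the fixed indicator applies to it.
      rcases eq_or_ne i j with rfl | hij
      · rw [hi₀ t ht, zero_smul]
      · obtain ⟨i', rfl⟩ := Fin.exists_succAbove_eq hij
        have h := hS j t (j.removeNth y) i' fun t' ht' => by
          have h0 := hi t' (Finset.mem_union_right _ (Finset.mem_biUnion.2
            ⟨j, Finset.mem_univ _, Finset.mem_biUnion.2 ⟨t, ht, ht'⟩⟩))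
          change y (j.succAbove i') t' = 0
          by_cases hs : j.succAbove i' ∈ s
          · rw [hy, Finset.piecewise_eq_of_mem _ _ _ hs, restrict, h0, ite_self]
          · rw [hy, Finset.piecewise_eq_of_notMem _ _ _ hs]
            exact sub_restrict_apply_of_eq_zero h0
        rw [fixArg_apply, Fin.insertNth_removeNth] at h
        rw [h, smul_zero]

theorem exists_cochain_eq_sum {n : ℕ} (f : Cochain k (IncAlg k) n) :
    ∃ S : Finset Types, ∀ a, f a = ∑ r ∈ Fintype.piFinset fun _ : Fin n => S,
      f (fun i => delta k (r i)) * ∏ i, a i (r i) := by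
  classical
  obtain ⟨S, hS⟩ := exists_finset_of_cochain f
  refine ⟨S, fun a => ?_⟩
  have ha : a = (fun j => restrict S (a j)) + fun j => a j - restrict S (a j) :=
    funext fun j => (restrict_add S (a j)).symm
  have h1 : f a = f fun j => restrict S (a j) := by
    conv_lhs => rw [ha]
    refine (f.1.map_add_univ _ _).trans ?_
    rw [Fintype.sum_eq_single Finset.univ, Finset.piecewise_univ]
    intro s hs
    obtain ⟨i, hi⟩ : ∃ i, i ∉ s := by
      by_contra h
      push Not at h
      exact hs (Finset.eq_univ_iff_forall.2 h)
    refine hS _ i fun t ht => ?_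
    rw [Finset.piecewise_eq_of_notMem _ _ _ hi]
    exact sub_restrict_apply_of_mem _ ht
  rw [h1]
  simp only [restrict_eq_sum]
  refine (f.1.map_sum_finset (fun i t => a i t • delta k t) _).trans ?_
  refine Finset.sum_congr rfl fun r _ => ?_
  rw [f.1.map_smul_univ (fun i => a i (r i)) fun i => delta k (r i), smul_eq_mul, mul_comm]

/-- Evaluation at a type. -/
def evalType (t : Types) : IncAlg k →ₗ[k] k where
  toFun a := a t
  map_add' _ _ := rfl
  map_smul' _ _ := rfl

/-- The pairing of the incidence coalgebra with the incidence algebra. -/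
def pairing : (Types →₀ k) →ₗ[k] IncAlg k →ₗ[k] k :=
  Finsupp.linearCombination k evalType

theorem pairing_single (t : Types) (a : IncAlg k) : pairing (Finsupp.single t 1) a = a t := by
  rw [pairing, Finsupp.linearCombination_single, one_smul]
  rfl

theorem isLocallyConstant_pairing (c : Types →₀ k) : IsLocallyConstant (pairing c : IncAlg k → k) := by
  induction c using Finsupp.induction_linear with
  | zero => rw [map_zero]; exact IsLocallyConstant.const 0
  | add c d hc hd => rw [map_add]; exact hc.comp₂ hd (· + ·)
  | single t x =>
    rw [pairing, Finsupp.linearCombination_single]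
    exact (isLocallyConstant_apply t).comp (x * ·)

/-- The cochain `a ↦ ∏ᵢ ⟨uᵢ, aᵢ⟩`. -/
def prodCochain {n : ℕ} (u : Fin n → Types →₀ k) : Cochain k (IncAlg k) n :=
  ⟨(MultilinearMap.mkPiAlgebra k (Fin n) k).compLinearMap fun i => pairing (u i), by
    have h (s : Finset (Fin n)) : IsLocallyConstant fun a : Fin n → IncAlg k =>
        ∏ i ∈ s, pairing (u i) (a i) := by
      classical
      induction s using Finset.induction_on with
      | empty => exact IsLocallyConstant.const (1 : k)
      | insert j s hj ih =>
        simp only [Finset.prod_insert hj]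
        exact ((isLocallyConstant_pairing (u j)).comp_continuous (continuous_apply j)).comp₂ ih
          (· * ·)
    exact h Finset.univ⟩

theorem prodCochain_apply {n : ℕ} (u : Fin n → Types →₀ k) (a) :
    prodCochain u a = ∏ i, pairing (u i) (a i) := rfl

theorem sum_apply {n : ℕ} {ι : Type*} (s : Finset ι) (g : ι → Cochain k (IncAlg k) n) (a) :
    (∑ x ∈ s, g x) a = ∑ x ∈ s, g x a := by
  classical
  induction s using Finset.induction_on with
  | empty => rfl
  | insert j s hj ih => rw [Finset.sum_insert hj, Finset.sum_insert hj, Cochain.add_apply, ih]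

section Coordinates

variable {I : Type*} (mon : (I →₀ ℕ) → IncAlg k) (T : (Types →₀ k) ≃ₗ[k] ((I →₀ ℕ) →₀ k))

/-- The cochain with given values on tuples of monomials. -/
def ofValues (n : ℕ) : ((Fin n → I →₀ ℕ) →₀ k) →ₗ[k] Cochain k (IncAlg k) n :=
  Finsupp.linearCombination k fun m => prodCochain fun i => T.symm (Finsupp.single (m i) 1)

/-- The functionals `T.symm (single m 1)` are dual to the monomials. -/
theorem ofValues_apply_mon (hT : ∀ c m, T c m = pairing c (mon m)) {n : ℕ} (c : (Fin n → I →₀ ℕ) →₀ k) (m : Fin n → I →₀ ℕ) :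
    ofValues T n c (fun i => mon (m i)) = c m := by
  classical
  induction c using Finsupp.induction_linear with
  | zero => rw [map_zero]; rfl
  | add c d hc hd => rw [map_add, Cochain.add_apply, hc, hd, Finsupp.add_apply]
  | single m' x =>
    rw [ofValues, Finsupp.linearCombination_single, Cochain.smul_apply, prodCochain_apply]
    simp only [← hT, LinearEquiv.apply_symm_apply, Finsupp.single_apply]
    by_cases h : m' = m
    · subst h
      simp
    · obtain ⟨i, hi⟩ := Function.ne_iff.1 h
      rw [if_neg h, Finset.prod_eq_zero (Finset.mem_univ i) (if_neg hi), mul_zero]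

theorem prodCochain_single_mem_range {n : ℕ} (r : Fin n → Types) :
    prodCochain (fun i => Finsupp.single (r i) 1) ∈ LinearMap.range (ofValues (k := k) T n) := by
  classical
  have h : prodCochain (fun i => Finsupp.single (r i) (1 : k)) =
      ∑ m ∈ Fintype.piFinset fun i => (T (Finsupp.single (r i) 1)).support,
        (∏ i, T (Finsupp.single (r i) 1) (m i)) •
          prodCochain fun i => T.symm (Finsupp.single (m i) 1) := by
    refine Cochain.ext fun a => ?_
    rw [sum_apply]
    simp only [Cochain.smul_apply, prodCochain_apply, ← Finset.prod_mul_distrib]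
    refine Eq.trans ?_ (Finset.prod_univ_sum (fun i => (T (Finsupp.single (r i) 1)).support)
      fun i m => T (Finsupp.single (r i) 1) m * pairing (T.symm (Finsupp.single m 1)) (a i))
    refine Finset.prod_congr rfl fun i _ => ?_
    have hs : Finsupp.single (r i) (1 : k) = ∑ m ∈ (T (Finsupp.single (r i) 1)).support,
        T (Finsupp.single (r i) 1) m • T.symm (Finsupp.single m 1) := by
      apply T.injective
      rw [map_sum]
      simp only [map_smul, LinearEquiv.apply_symm_apply, Finsupp.smul_single_one]
      exact (Finsupp.sum_single _).symm
    conv_lhs => rw [hs]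
    simp only [map_sum, map_smul, LinearMap.sum_apply, LinearMap.smul_apply, smul_eq_mul]
  rw [h]
  refine Submodule.sum_mem _ fun m _ => Submodule.smul_mem _ _ ⟨Finsupp.single m 1, ?_⟩
  rw [ofValues, Finsupp.linearCombination_single, one_smul]

/-- Values on monomials recover the coefficients. Conversely a continuous cochain is a finite sum of
products of evaluations at types, each a finite combination of functionals dual to monomials. -/
theorem ofValues_bijective (hT : ∀ c m, T c m = pairing c (mon m)) (n : ℕ) : Function.Bijective (ofValues (k := k) T n) := by
  refine ⟨(injective_iff_map_eq_zero _).2 fun c hc => Finsupp.ext fun m => ?_, fun f => ?_⟩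
  · rw [← ofValues_apply_mon mon T hT c m, hc]
    rfl
  · obtain ⟨S, hS⟩ := exists_cochain_eq_sum f
    have h : f = ∑ r ∈ Fintype.piFinset fun _ : Fin n => S,
        f (fun i => delta k (r i)) • prodCochain fun i => Finsupp.single (r i) 1 := by
      refine Cochain.ext fun a => ?_
      rw [hS, sum_apply]
      simp only [Cochain.smul_apply, prodCochain_apply, pairing_single]
    rw [h]
    exact Submodule.sum_mem _ fun r _ => Submodule.smul_mem _ _ (prodCochain_single_mem_range T r)

/-- Monomial coordinates from an isomorphism of the incidence coalgebra with the dual of the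
span of the monomials. -/
def monomialCoordinates (mon_add : ∀ a b, mon (a + b) = mon a * mon b)
    (map_mon : ∀ m, augmentation k (mon m) = eps k m)
    (hT : ∀ c m, T c m = pairing c (mon m)) : MonomialCoordinates (augmentation k) I where
  mon := mon
  mon_add := mon_add
  map_mon := map_mon
  coeff n := (LinearEquiv.ofBijective _ (ofValues_bijective mon T hT n)).symm
  coeff_apply {n} f m := by
    obtain ⟨c, rfl⟩ := (ofValues_bijective mon T hT n).2 f
    rw [ofValues_apply_mon mon T hT]
    exact congrFun (congrArg _ ((LinearEquiv.ofBijective _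
      (ofValues_bijective mon T hT n)).symm_apply_apply c)) m

end Coordinates

end GraphIncidence

end

noncomputable section

namespace GraphIncidence

/-! ## Isomorphism classes of graphs -/

/-- The interval `[∅, V]` of subsets of the vertex set of a graph. -/
def fullInterval {V : Type} [Finite V] (H : SimpleGraph V) : IntervalProduct where
  ι := Unit
  G := fun _ => ⟨V, H⟩
  bot := fun _ => ∅
  top := fun _ => Set.univ
  le := fun _ => Set.empty_subset _

/-- The graph of `[∅, V]` is the given graph. -/
def fullIntervalIso {V : Type} [Finite V] (H : SimpleGraph V) : (fullInterval H).graph ≃g H where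
  toFun x := x.2.1
  invFun v := ⟨(), v, trivial, id⟩
  left_inv _ := rfl
  right_inv _ := rfl
  map_rel_iff' := ⟨fun h => ⟨rfl, h⟩, fun ⟨_, h⟩ => h⟩

/-- The isomorphism class of a finite graph. -/
def typeOf {V : Type} [Finite V] (H : SimpleGraph V) : Types := ty (fullInterval H)

theorem typeOf_eq_iff {V W : Type} [Finite V] [Finite W] {H : SimpleGraph V} {K : SimpleGraph W} :
    typeOf H = typeOf K ↔ Nonempty (H ≃g K) := by
  refine Quotient.eq.trans ⟨fun ⟨e⟩ => ?_, fun ⟨e⟩ => ?_⟩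
  · exact ⟨((fullIntervalIso H).symm.trans e).trans (fullIntervalIso K)⟩
  · exact ⟨((fullIntervalIso H).trans e).trans (fullIntervalIso K).symm⟩

theorem typeOf_congr {V W : Type} [Finite V] [Finite W] {H : SimpleGraph V} {K : SimpleGraph W}
    (e : H ≃g K) : typeOf H = typeOf K := typeOf_eq_iff.2 ⟨e⟩

theorem ty_eq_typeOf (X : IntervalProduct) : ty X = typeOf X.graph :=
  ty_eq (fullIntervalIso X.graph).symm

theorem exists_typeOf (t : Types) : ∃ (V : Type) (_ : Finite V) (H : SimpleGraph V),
    t = typeOf H :=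
  Quotient.inductionOn t fun X => ⟨_, inferInstance, X.graph, ty_eq_typeOf X⟩

namespace IncAlg

variable {k : Type*} [Field k]

theorem mul_typeOf (f g : IncAlg k) {V : Type} [Finite V] [Fintype (Set V)] (H : SimpleGraph V) :
    (f * g) (typeOf H) = ∑ S : Set V, f (typeOf (H.induce S)) * g (typeOf (H.induce Sᶜ)) := by
  rw [typeOf, mul_apply]
  refine Fintype.sum_equiv ((fullInterval H).elemEquiv.trans
    (Equiv.Set.congr (fullIntervalIso H).toEquiv)) _ _ fun z => ?_
  set S := (fullInterval H).elemEquiv z with hS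
  have h (v) : fullIntervalIso H v ∈ Equiv.Set.congr (fullIntervalIso H).toEquiv S ↔ v ∈ S :=
    (fullIntervalIso H).toEquiv.injective.mem_set_image
  congr 1
  · exact congrArg f ((ty_eq_typeOf _).trans (typeOf_congr
      (((fullInterval H).lowerIso z).trans (induceIso (fullIntervalIso H) _ _ h))))
  · exact congrArg g ((ty_eq_typeOf _).trans (typeOf_congr
      (((fullInterval H).upperIso z).trans
        (induceIso (fullIntervalIso H) _ _ fun v => not_congr (h v)))))

theorem one_typeOf_ne_zero {V : Type} [Finite V] {H : SimpleGraph V}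
    (h : (1 : IncAlg k) (typeOf H) ≠ 0) : IsEmpty V := by
  rw [typeOf, one_apply] at h
  have h' := (bot_eq_top_iff _).1 (by_contra fun h' => h (if_neg h'))
  exact (fullIntervalIso H).symm.toEquiv.isEmpty

theorem one_typeOf {V : Type} [Finite V] [IsEmpty V] (H : SimpleGraph V) :
    (1 : IncAlg k) (typeOf H) = 1 := by
  rw [typeOf, one_apply, if_pos]
  rw [bot_eq_top_iff]
  exact (fullIntervalIso H).toEquiv.isEmpty

end IncAlg

/-! ## The monoid of isomorphism classes -/

instance : Add Types :=
  ⟨Quotient.lift₂ (fun X Y => typeOf (X.graph ⊕g Y.graph)) fun _ _ _ _ ⟨e⟩ ⟨f⟩ =>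
    typeOf_congr (SimpleGraph.Iso.sumCongr e f)⟩

theorem typeOf_sum {V W : Type} [Finite V] [Finite W] (H : SimpleGraph V) (K : SimpleGraph W) :
    typeOf (H ⊕g K) = typeOf H + typeOf K :=
  (typeOf_congr (SimpleGraph.Iso.sumCongr (fullIntervalIso H) (fullIntervalIso K))).symm

instance : Zero Types := ⟨typeOf (⊥ : SimpleGraph Empty)⟩

theorem typeOf_of_isEmpty {V : Type} [Finite V] [IsEmpty V] (H : SimpleGraph V) : typeOf H = 0 :=
  typeOf_congr ⟨Equiv.equivOfIsEmpty V Empty, fun {a} => isEmptyElim a⟩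

/-- Adding an empty graph. -/
def emptySumIso {V : Type} (H : SimpleGraph V) : (⊥ : SimpleGraph Empty) ⊕g H ≃g H where
  toEquiv := Equiv.emptySum Empty V
  map_rel_iff' {a b} := by
    rcases a with a | a
    · exact a.elim
    rcases b with b | b
    · exact b.elim
    simp

instance : AddCommMonoid Types where
  add_assoc a b c := by
    obtain ⟨V, _, H, rfl⟩ := exists_typeOf a
    obtain ⟨W, _, K, rfl⟩ := exists_typeOf b
    obtain ⟨U, _, L, rfl⟩ := exists_typeOf c
    simp only [← typeOf_sum]
    exact typeOf_congr SimpleGraph.Iso.sumAssoc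
  zero_add a := by
    obtain ⟨V, _, H, rfl⟩ := exists_typeOf a
    exact (typeOf_sum _ _).symm.trans (typeOf_congr (emptySumIso H))
  add_zero a := by
    obtain ⟨V, _, H, rfl⟩ := exists_typeOf a
    exact (typeOf_sum _ _).symm.trans
      (typeOf_congr (SimpleGraph.Iso.sumComm.trans (emptySumIso H)))
  add_comm a b := by
    obtain ⟨V, _, H, rfl⟩ := exists_typeOf a
    obtain ⟨W, _, K, rfl⟩ := exists_typeOf b
    simp only [← typeOf_sum]
    exact typeOf_congr SimpleGraph.Iso.sumComm
  nsmul := nsmulRec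

/-- A set of vertices with no edges to its complement. -/
def IsClosed {V : Type} (H : SimpleGraph V) (S : Set V) : Prop :=
  ∀ u v, H.Adj u v → u ∈ S → v ∈ S

theorem IsClosed.adj_iff {V : Type} {H : SimpleGraph V} {S : Set V} (h : IsClosed H S) {u v : V}
    (huv : H.Adj u v) : u ∈ S ↔ v ∈ S :=
  ⟨h u v huv, h v u huv.symm⟩

/-- A graph is the disjoint union of a closed set of vertices and its complement. -/
theorem IsClosed.typeOf_eq {V : Type} [Finite V] {H : SimpleGraph V} {S : Set V}
    (h : IsClosed H S) : typeOf H = typeOf (H.induce S) + typeOf (H.induce Sᶜ) := by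
  classical
  rw [← typeOf_sum]
  refine (typeOf_congr ⟨Equiv.Set.sumCompl S, fun {a b} => ?_⟩).symm
  rcases a with a | a <;> rcases b with b | b
  · simp
  · simp only [Equiv.Set.sumCompl_apply_inl, Equiv.Set.sumCompl_apply_inr, SimpleGraph.sum_adj,
      iff_false]
    exact fun hab => b.2 (h _ _ hab a.2)
  · simp only [Equiv.Set.sumCompl_apply_inl, Equiv.Set.sumCompl_apply_inr, SimpleGraph.sum_adj,
      iff_false]
    exact fun hab => a.2 (h _ _ hab.symm b.2)
  · simp

theorem IsClosed.eq_univ {V : Type} {H : SimpleGraph V} {S : Set V} (h : IsClosed H S)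
    (hc : H.Connected) (hne : S.Nonempty) : S = Set.univ := by
  obtain ⟨u, hu⟩ := hne
  refine Set.eq_univ_of_forall fun v => ?_
  obtain ⟨w⟩ := hc.preconnected u v
  induction w with
  | nil => exact hu
  | cons huv _ ih => exact ih (h _ _ huv hu)

/-- The isomorphism classes of connected graphs. -/
abbrev ConnectedTypes : Type 1 :=
  {t : Types // ∃ (V : Type) (_ : Finite V) (H : SimpleGraph V), H.Connected ∧ t = typeOf H}

theorem ConnectedTypes.connected (c : ConnectedTypes) {V : Type} [Finite V] {H : SimpleGraph V}
    (h : typeOf H = c.1) : H.Connected := by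
  obtain ⟨_, W, _, K, hK, rfl⟩ := c
  obtain ⟨e⟩ := typeOf_eq_iff.1 h
  exact e.connected_iff.2 hK

/-- The type of a connected graph. -/
def ConnectedTypes.mk {V : Type} [Finite V] (H : SimpleGraph V) (h : H.Connected) :
    ConnectedTypes := ⟨typeOf H, V, _, H, h, rfl⟩

/-- The disjoint union of a multiset of connected graphs. -/
def union : (ConnectedTypes →₀ ℕ) →+ Types :=
  Finsupp.liftAddHom fun c => multiplesHom Types c.1

theorem union_single (c : ConnectedTypes) : union (Finsupp.single c 1) = c.1 := by
  simp [union]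

/-- Split off the component of a vertex and induct on the number of vertices. -/
theorem union_surjective : Function.Surjective union := by
  intro t
  obtain ⟨V, _, H, rfl⟩ := exists_typeOf t
  induction hn : Nat.card V using Nat.strong_induction_on generalizing V with
  | _ n ih =>
    rcases isEmpty_or_nonempty V with hV | ⟨⟨v⟩⟩
    · exact ⟨0, (map_zero _).trans (typeOf_of_isEmpty H).symm⟩
    · set S := (H.connectedComponentMk v).supp with hS
      have hcl : IsClosed H S := fun u w huw hu =>
        (H.connectedComponentMk v).mem_supp_of_adj_mem_supp hu huw
      have hv : v ∈ S := rfl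
      have hlt : Nat.card ↥Sᶜ < n := by
        rw [← hn]
        refine Finite.card_subtype_lt (x := v) ?_
        exact fun h => h hv
      obtain ⟨m, hm⟩ := ih _ hlt _ inferInstance (H.induce Sᶜ) rfl
      refine ⟨Finsupp.single (ConnectedTypes.mk (H.induce S)
        (H.connectedComponentMk v).connected_toSimpleGraph) 1 + m, ?_⟩
      rw [map_add, union_single, hm, hcl.typeOf_eq]
      rfl

/-- The number of closed sets of vertices that induce a graph of type `c`. -/
def closedCount {V : Type} [Finite V] (c : Types) (H : SimpleGraph V) : ℕ :=
  {S : Set V | IsClosed H S ∧ typeOf (H.induce S) = c}.ncard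

theorem closedCount_congr {V W : Type} [Finite V] [Finite W] {H : SimpleGraph V}
    {K : SimpleGraph W} (c : Types) (e : H ≃g K) : closedCount c H = closedCount c K := by
  have h : {S : Set W | IsClosed K S ∧ typeOf (K.induce S) = c} =
      Set.image e.toEquiv '' {S : Set V | IsClosed H S ∧ typeOf (H.induce S) = c} := by
    have key (S : Set V) : IsClosed K (e.toEquiv '' S) ∧ typeOf (K.induce (e.toEquiv '' S)) = c ↔
        IsClosed H S ∧ typeOf (H.induce S) = c := by
      refine and_congr ⟨fun h u v huv hu => ?_, fun h => ?_⟩ ?_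
      · exact e.toEquiv.injective.mem_set_image.1
          (h _ _ (e.map_adj_iff.2 huv) (Set.mem_image_of_mem _ hu))
      · rintro _ v huv ⟨u, hu, rfl⟩
        refine ⟨e.symm v, h u _ ?_ hu, e.apply_symm_apply v⟩
        rw [← e.map_adj_iff, e.apply_symm_apply]
        exact huv
      · rw [typeOf_congr (induceIso e S _ fun v => e.toEquiv.injective.mem_set_image)]
    ext S
    constructor
    · intro hS
      have hS' := e.toEquiv.image_symm_image S
      -- The vertex type of the induced graph depends on `S`, so the equality is carried by a
      -- variable set instead of being rewritten.
      have aux : ∀ T, T = S → IsClosed K T ∧ typeOf (K.induce T) = c := by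
        rintro _ rfl
        exact hS
      exact ⟨e.toEquiv.symm '' S, (key _).1 (aux _ hS'), hS'⟩
    · rintro ⟨S, hS, rfl⟩
      exact (key S).2 hS
  rw [closedCount, closedCount, h, Set.ncard_image_of_injective _ e.toEquiv.injective.image_injective]

/-- For connected `c` the closed sets counted are the components of type `c`, and a connected set of
vertices cannot meet both summands. -/
theorem closedCount_sum {V W : Type} [Finite V] [Finite W] (H : SimpleGraph V) (K : SimpleGraph W)
    (c : ConnectedTypes) : closedCount c.1 (H ⊕g K) = closedCount c.1 H + closedCount c.1 K := by
  have hl (S : Set V) : IsClosed (H ⊕g K) (Sum.inl '' S) ∧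
      typeOf ((H ⊕g K).induce (Sum.inl '' S)) = c.1 ↔
        IsClosed H S ∧ typeOf (H.induce S) = c.1 := by
    refine and_congr ⟨fun h u v huv hu => ?_, fun h => ?_⟩ ?_
    · simpa using h (Sum.inl u) (Sum.inl v) (by simpa using huv) (by simpa using hu)
    · rintro _ (v | v) huv ⟨u, hu, rfl⟩
      · exact ⟨v, h u v (by simpa using huv) hu, rfl⟩
      · simp at huv
    · rw [typeOf_congr (K := (H ⊕g K).induce (Sum.inl '' S)) (H := H.induce S)
        ⟨Equiv.Set.image _ S Sum.inl_injective, by simp⟩]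
  have hr (S : Set W) : IsClosed (H ⊕g K) (Sum.inr '' S) ∧
      typeOf ((H ⊕g K).induce (Sum.inr '' S)) = c.1 ↔
        IsClosed K S ∧ typeOf (K.induce S) = c.1 := by
    refine and_congr ⟨fun h u v huv hu => ?_, fun h => ?_⟩ ?_
    · simpa using h (Sum.inr u) (Sum.inr v) (by simpa using huv) (by simpa using hu)
    · rintro _ (v | v) huv ⟨u, hu, rfl⟩
      · simp at huv
      · exact ⟨v, h u v (by simpa using huv) hu, rfl⟩
    · rw [typeOf_congr (K := (H ⊕g K).induce (Sum.inr '' S)) (H := K.induce S)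
        ⟨Equiv.Set.image _ S Sum.inr_injective, by simp⟩]
  have h : {S : Set (V ⊕ W) | IsClosed (H ⊕g K) S ∧ typeOf ((H ⊕g K).induce S) = c.1} =
      Set.image Sum.inl '' {S : Set V | IsClosed H S ∧ typeOf (H.induce S) = c.1} ∪
      Set.image Sum.inr '' {S : Set W | IsClosed K S ∧ typeOf (K.induce S) = c.1} := by
    ext S
    constructor
    · rintro ⟨hS, hc⟩
      have aux : ∀ T, T = S → IsClosed (H ⊕g K) T ∧ typeOf ((H ⊕g K).induce T) = c.1 := by
        rintro _ rfl
        exact ⟨hS, hc⟩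
      have hconn := c.connected hc
      obtain ⟨⟨x, hx⟩⟩ := hconn.nonempty
      rcases x with x | x
      · have hcl : IsClosed ((H ⊕g K).induce S) {y | y.1.isLeft} := by
          rintro ⟨u | u, hu⟩ ⟨v | v, hv⟩ huv h <;> simp_all
        have huniv := hcl.eq_univ hconn ⟨⟨Sum.inl x, hx⟩, rfl⟩
        have hS' : Sum.inl '' (Sum.inl ⁻¹' S) = S := by
          refine Set.image_preimage_eq_of_subset fun y hy => ?_
          have : (⟨y, hy⟩ : S) ∈ ({y | y.1.isLeft} : Set S) := huniv ▸ Set.mem_univ _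
          rcases y with y | y
          · exact ⟨y, rfl⟩
          · simp at this
        exact Or.inl ⟨_, (hl _).1 (aux _ hS'), hS'⟩
      · have hcl : IsClosed ((H ⊕g K).induce S) {y | y.1.isRight} := by
          rintro ⟨u | u, hu⟩ ⟨v | v, hv⟩ huv h <;> simp_all
        have huniv := hcl.eq_univ hconn ⟨⟨Sum.inr x, hx⟩, rfl⟩
        have hS' : Sum.inr '' (Sum.inr ⁻¹' S) = S := by
          refine Set.image_preimage_eq_of_subset fun y hy => ?_
          have : (⟨y, hy⟩ : S) ∈ ({y | y.1.isRight} : Set S) := huniv ▸ Set.mem_univ _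
          rcases y with y | y
          · simp at this
          · exact ⟨y, rfl⟩
        exact Or.inr ⟨_, (hr _).1 (aux _ hS'), hS'⟩
    · rintro (⟨S, hS, rfl⟩ | ⟨S, hS, rfl⟩)
      · exact (hl S).2 hS
      · exact (hr S).2 hS
  rw [closedCount, h, Set.ncard_union_eq,
    Set.ncard_image_of_injective _ Sum.inl_injective.image_injective,
    Set.ncard_image_of_injective _ Sum.inr_injective.image_injective]
  · rfl
  · rw [Set.disjoint_left]
    -- Only the empty set is an image from both sides, and a connected graph is nonempty.
    rintro _ ⟨S, hS, rfl⟩ ⟨S', -, h⟩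
    obtain ⟨⟨x, hx⟩⟩ := (c.connected hS.2).nonempty
    obtain ⟨y, -, hy⟩ := h ▸ Set.mem_image_of_mem Sum.inl hx
    exact Sum.inr_ne_inl hy

open Classical in
theorem closedCount_connected {V : Type} [Finite V] (H : SimpleGraph V) (hH : H.Connected)
    (c : ConnectedTypes) : closedCount c.1 H = if typeOf H = c.1 then 1 else 0 := by
  have huniv : typeOf (H.induce Set.univ) = typeOf H :=
    typeOf_congr ⟨Equiv.Set.univ V, Iff.rfl⟩
  split_ifs with h
  · rw [closedCount, Set.ncard_eq_one]
    refine ⟨Set.univ, Set.eq_singleton_iff_unique_mem.2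
      ⟨⟨fun _ _ _ _ => trivial, huniv.trans h⟩, fun S hS => ?_⟩⟩
    obtain ⟨⟨x, hx⟩⟩ := (c.connected hS.2).nonempty
    exact hS.1.eq_univ hH ⟨x, hx⟩
  · rw [closedCount, Set.ncard_eq_zero, Set.eq_empty_iff_forall_notMem]
    intro S hS
    obtain ⟨⟨x, hx⟩⟩ := (c.connected hS.2).nonempty
    obtain rfl := hS.1.eq_univ hH ⟨x, hx⟩
    exact h (huniv.symm.trans hS.2)

end GraphIncidence

end

/-! ### Triangular maps and freeness of the monoid of graphs -/

noncomputable section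

/-- Induction on finitely supported natural-valued functions by adding one unit at a time. -/
theorem Finsupp.induction_single_one {I : Type*} {P : (I →₀ ℕ) → Prop} (m : I →₀ ℕ) (zero : P 0)
    (add : ∀ i m, P m → P (Finsupp.single i 1 + m)) : P m := by
  induction m using Finsupp.induction with
  | zero => exact zero
  | single_add i n m _ _ ih =>
    clear * - ih add
    induction n with
    | zero => rwa [Finsupp.single_zero, zero_add]
    | succ n hn =>
      rw [add_comm n 1, Finsupp.single_add, add_assoc]
      exact add _ _ hn

/-- A triangular linear map with nonzero diagonal is bijective. -/
theorem LinearMap.bijective_of_triangular {k α : Type*} [Field k] (e : α → ℕ)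
    (T : (α →₀ k) →ₗ[k] (α →₀ k)) (diag : ∀ a, T (Finsupp.single a 1) a ≠ 0)
    (lt : ∀ a b, T (Finsupp.single a 1) b ≠ 0 → b ≠ a → e b < e a) : Function.Bijective T := by
  classical
  have hsum (x : α →₀ k) (a : α) : T x a = ∑ b ∈ x.support, x b * T (Finsupp.single b 1) a := by
    conv_lhs => rw [← Finsupp.sum_single x, Finsupp.sum, map_sum, Finsupp.finsetSum_apply]
    refine Finset.sum_congr rfl fun b _ => ?_
    rw [← Finsupp.smul_single_one, map_smul, Finsupp.smul_apply, smul_eq_mul]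
  constructor
  · refine (injective_iff_map_eq_zero T).2 fun x hx => by_contra fun hne => ?_
    -- At an index `a` of maximal `e` no other element of the support contributes to the coordinate.
    obtain ⟨a, ha, hmax⟩ := x.support.exists_max_image e (Finsupp.support_nonempty_iff.2 hne)
    have h := hsum x a
    rw [hx, Finset.sum_eq_single a] at h
    · exact mul_ne_zero (Finsupp.mem_support_iff.1 ha) (diag a) h.symm
    · intro b hb hba
      by_contra h0
      exact (hmax b hb).not_gt (lt b a (right_ne_zero_of_mul h0) hba.symm)
    · exact fun h => absurd ha h
  · have key (n : ℕ) : ∀ a, e a = n → Finsupp.single a (1 : k) ∈ LinearMap.range T := by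
      induction n using Nat.strong_induction_on with
      | _ n ih =>
        rintro a rfl
        -- The off-diagonal part involves only basis vectors of smaller `e`, which are in the range
        -- by induction.
        have h1 : (T (Finsupp.single a 1)).erase a ∈ LinearMap.range T := by
          rw [← Finsupp.sum_single ((T (Finsupp.single a 1)).erase a)]
          refine Submodule.sum_mem _ fun b hb => ?_
          rw [Finsupp.support_erase, Finset.mem_erase, Finsupp.mem_support_iff] at hb
          rw [← Finsupp.smul_single_one]
          exact Submodule.smul_mem _ _ (ih _ (lt a b hb.2 hb.1) b rfl)
        have h2 := Submodule.sub_mem _ (LinearMap.mem_range_self T (Finsupp.single a 1)) h1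
        rw [sub_eq_of_eq_add (Finsupp.single_add_erase a (T (Finsupp.single a 1))).symm,
          ← Finsupp.smul_single_one] at h2
        exact (Submodule.smul_mem_iff _ (diag a)).1 h2
    refine LinearMap.range_eq_top.1 (Submodule.eq_top_iff'.2 fun x => ?_)
    rw [← Finsupp.sum_single x]
    refine Submodule.sum_mem _ fun b _ => ?_
    rw [← Finsupp.smul_single_one]
    exact Submodule.smul_mem _ _ (key _ b rfl)

namespace GraphIncidence

theorem isEmpty_of_typeOf_eq_zero {V : Type} [Finite V] {H : SimpleGraph V}
    (h : typeOf H = 0) : IsEmpty V := by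
  obtain ⟨e⟩ := (typeOf_eq_iff (K := (⊥ : SimpleGraph Empty))).1 h
  exact e.toEquiv.isEmpty

theorem closedCount_of_typeOf_eq_union (c : ConnectedTypes) (m : ConnectedTypes →₀ ℕ) :
    ∀ {V : Type} [Finite V] (H : SimpleGraph V), typeOf H = union m → closedCount c.1 H = m c := by
  classical
  induction m using Finsupp.induction_single_one with
  | zero =>
    intro V _ H h
    have := isEmpty_of_typeOf_eq_zero (h.trans (map_zero union))
    rw [closedCount, Finsupp.zero_apply, Set.ncard_eq_zero, Set.eq_empty_iff_forall_notMem]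
    intro S hS
    obtain ⟨⟨x, -⟩⟩ := (c.connected hS.2).nonempty
    exact isEmptyElim x
  | add d m ih =>
    intro V _ H h
    obtain ⟨W, _, K, hK⟩ := exists_typeOf (union m)
    obtain ⟨t, U, _, D, hD, rfl⟩ := d
    rw [map_add, union_single, hK, ← typeOf_sum] at h
    obtain ⟨e⟩ := typeOf_eq_iff.1 h
    rw [closedCount_congr _ e, closedCount_sum, ih K hK.symm, closedCount_connected D hD,
      Finsupp.add_apply, Finsupp.single_apply]
    simp only [Subtype.ext_iff]

/-- The multiplicity of `c` is the number of closed sets of type `c`, an isomorphism invariant of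
the union. -/
theorem union_bijective : Function.Bijective union := by
  refine ⟨fun m m' h => Finsupp.ext fun c => ?_, union_surjective⟩
  obtain ⟨V, _, H, hH⟩ := exists_typeOf (union m)
  rw [← closedCount_of_typeOf_eq_union c m H hH.symm,
    closedCount_of_typeOf_eq_union c m' H (hH.symm.trans h)]

/-- A decomposition of an isomorphism class comes from a decomposition of the vertex set. -/
theorem exists_induce_of_typeOf_eq_add {V : Type} [Finite V] {H : SimpleGraph V} {a b : Types}
    (h : typeOf H = a + b) :
    ∃ S : Set V, typeOf (H.induce S) = a ∧ typeOf (H.induce Sᶜ) = b := by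
  obtain ⟨A, _, K, rfl⟩ := exists_typeOf a
  obtain ⟨B, _, L, rfl⟩ := exists_typeOf b
  rw [← typeOf_sum] at h
  obtain ⟨e⟩ := typeOf_eq_iff.1 h
  have hl : Function.Injective fun x : A => e.symm (Sum.inl x) :=
    e.symm.injective.comp Sum.inl_injective
  have hr : Function.Injective fun x : B => e.symm (Sum.inr x) :=
    e.symm.injective.comp Sum.inr_injective
  have hc : (Set.range fun x : A => e.symm (Sum.inl x))ᶜ =
      Set.range fun x : B => e.symm (Sum.inr x) := by
    ext v
    obtain ⟨x | x, rfl⟩ := e.symm.surjective v <;> simp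
  refine ⟨Set.range fun x : A => e.symm (Sum.inl x), ?_, ?_⟩
  · refine (typeOf_congr ⟨Equiv.ofInjective _ hl, fun {u v} => ?_⟩).symm
    exact (e.symm.map_adj_iff).trans (by simp)
  · refine (typeOf_congr ⟨(Equiv.ofInjective _ hr).trans (Equiv.setCongr hc.symm),
      fun {u v} => ?_⟩).symm
    exact (e.symm.map_adj_iff).trans (by simp)

/-! ### Edge counts -/

/-- The number of ordered pairs of adjacent vertices. -/
def adjCount {V : Type} (H : SimpleGraph V) : ℕ := {p : V × V | H.Adj p.1 p.2}.ncard

theorem adjCount_congr {V W : Type} {H : SimpleGraph V} {K : SimpleGraph W} (e : H ≃g K) :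
    adjCount H = adjCount K := by
  rw [adjCount, adjCount, ← Set.ncard_image_of_injective _
    (e.injective.prodMap e.injective)]
  congr 1
  ext ⟨u, v⟩
  constructor
  · rintro ⟨⟨x, y⟩, h, rfl, rfl⟩
    exact e.map_adj_iff.2 h
  · intro h
    exact ⟨(e.symm u, e.symm v), e.symm.map_adj_iff.2 h, by simp⟩

theorem adjCount_induce {V : Type} (H : SimpleGraph V) (S : Set V) :
    adjCount (H.induce S) = {p : V × V | H.Adj p.1 p.2 ∧ p.1 ∈ S ∧ p.2 ∈ S}.ncard := by
  rw [adjCount, ← Set.ncard_image_of_injective _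
    ((Subtype.val_injective (p := (· ∈ S))).prodMap Subtype.val_injective)]
  congr 1
  ext ⟨u, v⟩
  constructor
  · rintro ⟨⟨x, y⟩, h, rfl, rfl⟩
    exact ⟨h, x.2, y.2⟩
  · rintro ⟨h, hu, hv⟩
    exact ⟨(⟨u, hu⟩, ⟨v, hv⟩), h, rfl⟩

theorem adjCount_induce_add {V : Type} [Finite V] (H : SimpleGraph V) (S : Set V) :
    adjCount (H.induce S) + adjCount (H.induce Sᶜ) =
      {p : V × V | H.Adj p.1 p.2 ∧ (p.1 ∈ S ↔ p.2 ∈ S)}.ncard := by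
  rw [adjCount_induce, adjCount_induce, ← Set.ncard_union_eq]
  · congr 1
    ext ⟨u, v⟩
    simp only [Set.mem_union, Set.mem_ofPred_eq, Set.mem_compl_iff]
    tauto
  · rw [Set.disjoint_left]
    exact fun p h h' => h'.2.1 h.2.1

theorem adjCount_induce_add_le {V : Type} [Finite V] (H : SimpleGraph V) (S : Set V) :
    adjCount (H.induce S) + adjCount (H.induce Sᶜ) ≤ adjCount H := by
  rw [adjCount_induce_add]
  exact Set.ncard_le_ncard fun p h => h.1

theorem IsClosed.adjCount_eq {V : Type} [Finite V] {H : SimpleGraph V} {S : Set V}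
    (h : IsClosed H S) : adjCount (H.induce S) + adjCount (H.induce Sᶜ) = adjCount H := by
  rw [adjCount_induce_add, adjCount]
  congr 1
  ext p
  exact and_iff_left_of_imp fun hp => h.adj_iff hp

theorem isClosed_of_adjCount_le {V : Type} [Finite V] {H : SimpleGraph V} {S : Set V}
    (h : adjCount H ≤ adjCount (H.induce S) + adjCount (H.induce Sᶜ)) : IsClosed H S := by
  rw [adjCount_induce_add] at h
  have h' := Set.eq_of_subset_of_ncard_le (fun p hp => hp.1) h
  intro u v huv hu
  exact ((h'.symm ▸ huv : (u, v) ∈ {p : V × V | H.Adj p.1 p.2 ∧ (p.1 ∈ S ↔ p.2 ∈ S)})).2.1 hu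

/-- The number of ordered pairs of adjacent vertices of an isomorphism class of graphs. -/
def Types.adjCount : Types → ℕ :=
  Quotient.lift (fun X => GraphIncidence.adjCount X.graph) fun _ _ ⟨e⟩ => adjCount_congr e

theorem adjCount_typeOf {V : Type} [Finite V] (H : SimpleGraph V) :
    (typeOf H).adjCount = adjCount H :=
  adjCount_congr (fullIntervalIso H)

theorem Types.adjCount_add_le (a b : Types) : (a + b).adjCount ≤ a.adjCount + b.adjCount := by
  obtain ⟨V, _, H, rfl⟩ := exists_typeOf a
  obtain ⟨W, _, K, rfl⟩ := exists_typeOf b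
  have hl : typeOf ((H ⊕g K).induce (Set.range Sum.inl)) = typeOf H :=
    (typeOf_congr ⟨Equiv.ofInjective _ Sum.inl_injective, by simp⟩).symm
  have hr : typeOf ((H ⊕g K).induce (Set.range Sum.inl)ᶜ) = typeOf K :=
    (typeOf_congr ⟨(Equiv.ofInjective _ Sum.inr_injective).trans
      (Equiv.setCongr Set.compl_range_inl.symm), by simp⟩).symm
  have hcl : IsClosed (H ⊕g K) (Set.range Sum.inl) := by
    rintro (u | u) (v | v) huv hu <;> simp_all
  rw [← typeOf_sum, adjCount_typeOf, ← hcl.adjCount_eq, ← adjCount_typeOf, ← adjCount_typeOf,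
    hl, hr]

/-! ### Monomials in the indicator functions of connected classes -/

namespace IncAlg

variable (k : Type*) [Field k]

/-- The product of indicator functions of connected isomorphism classes. -/
def monomial (m : ConnectedTypes →₀ ℕ) : IncAlg k := m.prod fun c n => delta k c.1 ^ n

theorem monomial_zero : monomial k 0 = 1 := Finsupp.prod_zero_index

theorem monomial_add (m m' : ConnectedTypes →₀ ℕ) :
    monomial k (m + m') = monomial k m * monomial k m' :=
  Finsupp.prod_add_index' (fun c => pow_zero (delta k c.1)) fun c => pow_add (delta k c.1)

theorem monomial_single_add (c : ConnectedTypes) (m : ConnectedTypes →₀ ℕ) :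
    monomial k (Finsupp.single c 1 + m) = delta k c.1 * monomial k m := by
  rw [monomial_add]
  congr 1
  exact (Finsupp.prod_single_index (h := fun (c : ConnectedTypes) n => delta k c.1 ^ n)
    (pow_zero (delta k c.1))).trans (pow_one _)

variable {k}

theorem eq_zero_of_monomial_zero_ne_zero {t : Types} (h : monomial k 0 t ≠ 0) : t = 0 := by
  obtain ⟨V, _, H, rfl⟩ := exists_typeOf t
  rw [monomial_zero] at h
  have := one_typeOf_ne_zero h
  exact typeOf_of_isEmpty H

theorem exists_of_delta_mul_ne_zero {c : Types} {f : IncAlg k} {V : Type} [Finite V]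
    {H : SimpleGraph V} (h : (delta k c * f) (typeOf H) ≠ 0) :
    ∃ S : Set V, typeOf (H.induce S) = c ∧ f (typeOf (H.induce Sᶜ)) ≠ 0 := by
  have : Fintype (Set V) := Fintype.ofFinite _
  rw [mul_typeOf] at h
  obtain ⟨S, -, hS⟩ := Finset.exists_ne_zero_of_sum_ne_zero h
  refine ⟨S, by_contra fun hc => hS ?_, right_ne_zero_of_mul hS⟩
  rw [delta_apply, if_neg hc, zero_mul]

/-- A nonzero value splits the vertices into pieces inducing the factors of `m`. Edges inside the
pieces are those of the union; equality of counts means that no edge joins two pieces. -/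
theorem adjCount_union_le (m : ConnectedTypes →₀ ℕ) : ∀ t : Types, monomial k m t ≠ 0 →
    (union m).adjCount ≤ t.adjCount ∧ (t.adjCount ≤ (union m).adjCount → t = union m) := by
  induction m using Finsupp.induction_single_one with
  | zero =>
    intro t ht
    obtain rfl := eq_zero_of_monomial_zero_ne_zero ht
    rw [map_zero]
    exact ⟨le_rfl, fun _ => rfl⟩
  | add c m ih =>
    intro t ht
    obtain ⟨V, _, H, rfl⟩ := exists_typeOf t
    rw [monomial_single_add] at ht
    obtain ⟨S, hS, hS'⟩ := exists_of_delta_mul_ne_zero ht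
    obtain ⟨h1, h2⟩ := ih _ hS'
    have h3 := Types.adjCount_add_le c.1 (union m)
    have h4 := adjCount_induce_add_le H S
    rw [map_add, union_single]
    rw [← adjCount_typeOf, ← adjCount_typeOf, ← adjCount_typeOf, hS] at h4
    refine ⟨by omega, fun h5 => ?_⟩
    have hcl : IsClosed H S := isClosed_of_adjCount_le (by
      rw [← adjCount_typeOf, ← adjCount_typeOf, ← adjCount_typeOf, hS]
      omega)
    rw [hcl.typeOf_eq, hS, h2 (by omega)]

/-- The values count splittings of the vertex set; keeping track of them in `ℕ` rules out
cancellation between terms. -/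
theorem exists_nat_monomial_apply (m : ConnectedTypes →₀ ℕ) :
    ∀ t : Types, ∃ n : ℕ, monomial k m t = n ∧ (t = union m → 0 < n) := by
  classical
  induction m using Finsupp.induction_single_one with
  | zero =>
    intro t
    obtain ⟨V, _, H, rfl⟩ := exists_typeOf t
    rw [monomial_zero]
    by_cases hV : IsEmpty V
    · exact ⟨1, by rw [one_typeOf, Nat.cast_one], fun _ => one_pos⟩
    · refine ⟨0, ?_, fun h => absurd (isEmpty_of_typeOf_eq_zero (h.trans (map_zero _))) hV⟩
      rw [Nat.cast_zero]
      exact by_contra fun h => hV (one_typeOf_ne_zero h)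
  | add c m ih =>
    intro t
    obtain ⟨V, _, H, rfl⟩ := exists_typeOf t
    have : Fintype (Set V) := Fintype.ofFinite _
    choose n hn hpos using ih
    refine ⟨∑ S : Set V, (if typeOf (H.induce S) = c.1 then 1 else 0) * n (typeOf (H.induce Sᶜ)),
      ?_, fun h => ?_⟩
    · rw [monomial_single_add, mul_typeOf]
      push_cast
      simp only [delta_apply, hn]
    · rw [map_add, union_single] at h
      obtain ⟨S, hS, hS'⟩ := exists_induce_of_typeOf_eq_add h
      refine Finset.sum_pos' (fun _ _ => Nat.zero_le _) ⟨S, Finset.mem_univ _, ?_⟩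
      rw [if_pos hS, one_mul]
      exact hpos _ hS'

theorem monomial_union_ne_zero [CharZero k] (m : ConnectedTypes →₀ ℕ) :
    monomial k m (union m) ≠ 0 := by
  obtain ⟨n, hn, hpos⟩ := exists_nat_monomial_apply (k := k) m (union m)
  rw [hn, Nat.cast_ne_zero]
  exact (hpos rfl).ne'

-- Each factor removes a nonempty set of vertices whose induced type determines it, so the number of
-- vertices serves for induction.
variable (k) in
theorem finite_monomial_ne_zero (t : Types) : {m | monomial k m t ≠ 0}.Finite := by
  obtain ⟨V, _, H, rfl⟩ := exists_typeOf t
  induction hn : Nat.card V using Nat.strong_induction_on generalizing V with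
  | _ n ih =>
    have hsub : {m | monomial k m (typeOf H) ≠ 0} ⊆ {0} ∪
        ⋃ S ∈ {S : Set V | S.Nonempty}, ⋃ c ∈ {c : ConnectedTypes | c.1 = typeOf (H.induce S)},
          (Finsupp.single c 1 + ·) '' {m | monomial k m (typeOf (H.induce Sᶜ)) ≠ 0} := by
      intro m
      refine Finsupp.induction_single_one (P := fun m => monomial k m (typeOf H) ≠ 0 → m ∈ _) m
        (fun _ => Or.inl rfl) fun c m _ hm => Or.inr ?_
      rw [monomial_single_add] at hm
      obtain ⟨S, hS, hS'⟩ := exists_of_delta_mul_ne_zero hm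
      obtain ⟨⟨x, hx⟩⟩ := (c.connected hS).nonempty
      exact Set.mem_biUnion (show S.Nonempty from ⟨x, hx⟩)
        (Set.mem_biUnion (x := c) hS.symm ⟨m, hS', rfl⟩)
    refine Set.Finite.subset ((Set.finite_singleton _).union
      (Set.Finite.biUnion (Set.toFinite _) fun S hS => Set.Finite.biUnion
        (Set.Subsingleton.finite fun c hc d hd => Subtype.ext (hc.trans hd.symm))
        fun c _ => Set.Finite.image _ ?_)) hsub
    obtain ⟨x, hx⟩ := hS
    refine ih _ ?_ _ _ _ rfl
    rw [← hn]
    exact Finite.card_subtype_lt (x := x) fun h => h hx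

theorem augmentation_apply (f : IncAlg k) : augmentation k f = f 0 := by
  refine congrArg f ((ty_eq_typeOf point).trans ?_)
  have : IsEmpty (Σ i, ↥(point.top i \ point.bot i)) := ⟨fun ⟨i, _⟩ => i.elim⟩
  exact typeOf_of_isEmpty _

end IncAlg

end GraphIncidence

end

noncomputable section

namespace GraphIncidence

/-! ## Monomial coordinates on the graph incidence algebra -/

section Coordinates

variable (k : Type*) [Field k]

/-- Evaluation of elements of the incidence coalgebra on the monomials. -/
def monomialPairing : (Types →₀ k) →ₗ[k] ((ConnectedTypes →₀ ℕ) →₀ k) :=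
  Finsupp.linearCombination k fun t =>
    Finsupp.ofSupportFinite (fun m => IncAlg.monomial k m t) (IncAlg.finite_monomial_ne_zero k t)

theorem monomialPairing_single_apply (t : Types) (m : ConnectedTypes →₀ ℕ) :
    monomialPairing k (Finsupp.single t 1) m = IncAlg.monomial k m t := by
  rw [monomialPairing, Finsupp.linearCombination_single, one_smul]
  rfl

theorem monomialPairing_apply (c : Types →₀ k) (m : ConnectedTypes →₀ ℕ) :
    monomialPairing k c m = pairing c (IncAlg.monomial k m) := by
  induction c using Finsupp.induction_linear with
  | zero => simp
  | add c d hc hd => rw [map_add, map_add, Finsupp.add_apply, LinearMap.add_apply, hc, hd]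
  | single t x =>
    rw [← Finsupp.smul_single_one, map_smul, map_smul, Finsupp.smul_apply, LinearMap.smul_apply,
      monomialPairing_single_apply, pairing_single]

/-- Once types are indexed by multisets through `union`, the matrix is triangular for the number of
edges, with positive integers on the diagonal. -/
theorem monomialPairing_bijective [CharZero k] : Function.Bijective (monomialPairing k) := by
  let u := Equiv.ofBijective union union_bijective
  let D : ((ConnectedTypes →₀ ℕ) →₀ k) ≃ₗ[k] (Types →₀ k) := Finsupp.domLCongr u
  have hD (m) : D (Finsupp.single m 1) = Finsupp.single (union m) 1 :=
    Finsupp.domLCongr_single u m 1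
  have h : Function.Bijective (monomialPairing k ∘ₗ D.toLinearMap) := by
    refine LinearMap.bijective_of_triangular (fun m => (union m).adjCount) _
      (fun m => ?_) fun m m' h hne => ?_
    · rw [LinearMap.comp_apply, LinearEquiv.coe_coe, hD, monomialPairing_single_apply]
      exact IncAlg.monomial_union_ne_zero m
    · rw [LinearMap.comp_apply, LinearEquiv.coe_coe, hD, monomialPairing_single_apply] at h
      obtain ⟨h1, h2⟩ := IncAlg.adjCount_union_le _ _ h
      exact lt_of_not_ge fun h3 => hne (union_bijective.1 (h2 h3).symm)
  rw [LinearMap.coe_comp] at h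
  exact (Function.Bijective.of_comp_iff _ D.bijective).1 h

/-- The monomials in the indicator functions of connected graphs are coordinates of the graph
incidence algebra. -/
def coordinates [CharZero k] :
    Hochschild.MonomialCoordinates (augmentation k) ConnectedTypes :=
  monomialCoordinates (IncAlg.monomial k)
    (LinearEquiv.ofBijective _ (monomialPairing_bijective k)) (IncAlg.monomial_add k)
    (fun m => by
      refine Finsupp.induction_single_one (P := fun m => augmentation k (IncAlg.monomial k m) =
        BarComplex.eps k m) m ?_ fun c m _ => ?_
      · rw [IncAlg.monomial_zero, BarComplex.eps_zero]
        exact map_one (augmentation k).toAlgHom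
      · rw [IncAlg.monomial_single_add, BarComplex.eps_add, BarComplex.eps_single, zero_mul]
        refine (map_mul (augmentation k).toAlgHom _ _).trans ?_
        -- The augmentation evaluates at the empty graph, which is not connected.
        refine mul_eq_zero_of_left ((IncAlg.augmentation_apply _).trans ?_) _
        rw [IncAlg.delta_apply, if_neg]
        intro h
        obtain ⟨t, V, _, H, hH, rfl⟩ := c
        have := isEmpty_of_typeOf_eq_zero h.symm
        exact not_isEmpty_of_nonempty V (h := hH.nonempty) this)
    (monomialPairing_apply k)

end Coordinates

/-! ## The elements `λ([G])` for connected graphs -/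

/-- An isomorphism of graphs induces a bijection of the partitions of the vertex sets. -/
def partitionEquiv {V W : Type} (e : V ≃ W) :
    {π : Set (Set V) // Setoid.IsPartition π} ≃ {π : Set (Set W) // Setoid.IsPartition π} :=
  (Equiv.Set.congr (Equiv.Set.congr e)).subtypeEquiv fun π => by
    have himg : Equiv.Set.congr (Equiv.Set.congr e) π = Set.image e '' π := rfl
    have hmem (B : Set W) : B ∈ Set.image e '' π ↔ e ⁻¹' B ∈ π := by
      constructor
      · rintro ⟨B, hB, rfl⟩
        rwa [e.preimage_image]
      · exact fun h => ⟨_, h, e.image_preimage B⟩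
    rw [himg, Setoid.IsPartition, Setoid.IsPartition, hmem, Set.preimage_empty]
    refine and_congr_right fun _ => e.forall_congr fun a => ?_
    refine (Equiv.Set.congr e).existsUnique_congr fun {B} => ?_
    have hB : Equiv.Set.congr e B = e '' B := rfl
    rw [hB, hmem, e.preimage_image, e.injective.mem_set_image]

theorem ty_blocks_congr {G G' : FinGraph} (e : G.graph ≃g G'.graph) (π : Set (Set G.V)) :
    ty (blocks G π) = ty (blocks G' (Set.image e.toEquiv '' π)) := by
  refine ty_eq ⟨?_, ?_⟩
  · refine Equiv.sigmaCongr
      (Equiv.Set.image _ π e.toEquiv.injective.image_injective) fun B => ?_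
    exact e.toEquiv.subtypeEquiv fun v =>
      and_congr e.toEquiv.injective.mem_set_image.symm Iff.rfl
  · rintro ⟨B, u⟩ ⟨B', v⟩
    constructor
    · rintro ⟨h, huv⟩
      obtain rfl : B = B' := (Equiv.Set.image _ π e.toEquiv.injective.image_injective).injective h
      exact ⟨rfl, e.map_adj_iff.1 huv⟩
    · rintro ⟨h, huv⟩
      obtain rfl : B = B' := h
      exact ⟨rfl, e.map_adj_iff.2 huv⟩

theorem lam_congr (k : Type*) [Field k] {G G' : FinGraph} (e : G.graph ≃g G'.graph) :
    lam k G = lam k G' := by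
  refine Fintype.sum_equiv (partitionEquiv e.toEquiv) _ _ fun π => ?_
  have h : (partitionEquiv e.toEquiv π).1 = Set.image e.toEquiv '' π.1 := rfl
  rw [h, ty_blocks_congr e, Set.ncard_image_of_injective _ e.toEquiv.injective.image_injective]

theorem isPartition_univ {V : Type} [Nonempty V] : Setoid.IsPartition {(Set.univ : Set V)} :=
  ⟨fun h => Set.empty_ne_univ h, fun _ => ⟨Set.univ, ⟨rfl, trivial⟩, fun _ h => h.1⟩⟩

theorem ty_blocks_univ (G : FinGraph) : ty (blocks G {Set.univ}) = typeOf G.graph := by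
  refine (ty_eq_typeOf _).trans (typeOf_congr ⟨⟨fun x => x.2.1,
    fun v => ⟨⟨Set.univ, rfl⟩, v, trivial, id⟩, ?_, fun _ => rfl⟩, ?_⟩)
  · rintro ⟨⟨_, rfl⟩, v⟩
    rfl
  · rintro ⟨⟨_, rfl⟩, u⟩ ⟨⟨_, rfl⟩, v⟩
    exact ⟨fun h => ⟨rfl, h⟩, fun ⟨_, h⟩ => h⟩

/-- A block is closed in the disjoint union, so connectedness leaves room for only one. -/
theorem eq_univ_of_blocks_connected {G : FinGraph} {π : Set (Set G.V)}
    (hπ : Setoid.IsPartition π) (h : (blocks G π).graph.Connected) : π = {Set.univ} := by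
  obtain ⟨⟨B, v⟩⟩ := h.nonempty
  have hcl : IsClosed (blocks G π).graph {x | x.1 = B} := by
    rintro ⟨B', u⟩ ⟨B'', w⟩ ⟨h', -⟩ hu
    exact h'.symm.trans hu
  have huniv := hcl.eq_univ h ⟨⟨B, v⟩, rfl⟩
  have key : ∀ B' ∈ π, B' = B.1 := by
    intro B' hB'
    obtain ⟨w, hw⟩ := Set.nonempty_iff_ne_empty.2 fun h0 => hπ.1 (h0 ▸ hB')
    have hm : (⟨⟨B', hB'⟩, w, hw, id⟩ : Σ i, ↥((blocks G π).top i \ (blocks G π).bot i)) ∈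
        {x | x.1 = B} := huniv ▸ Set.mem_univ _
    exact congrArg Subtype.val hm
  have hB : B.1 = Set.univ := by
    refine Set.eq_univ_of_forall fun w => ?_
    obtain ⟨B', ⟨hB', hw⟩, -⟩ := hπ.2 w
    exact key B' hB' ▸ hw
  rw [Set.eq_singleton_iff_unique_mem, ← hB]
  exact ⟨B.2, key⟩

-- Only the one-block partition can produce a connected type, and its coefficient is `(-1) ^ 0 * 0!
-- = 1`.
open Classical in
theorem lam_apply_typeOf (k : Type*) [Field k] (G : FinGraph) [Nonempty G.V] {V : Type} [Finite V]
    {H : SimpleGraph V} (hH : H.Connected) :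
    lam k G (typeOf H) = if typeOf G.graph = typeOf H then 1 else 0 := by
  rw [lam, Finsupp.finsetSum_apply, Fintype.sum_eq_single ⟨{Set.univ}, isPartition_univ⟩]
  · rw [ty_blocks_univ, Finsupp.single_apply]
    simp
  · intro π hπ
    rw [Finsupp.single_apply, if_neg]
    intro h
    rw [ty_eq_typeOf] at h
    obtain ⟨e⟩ := typeOf_eq_iff.1 h
    exact hπ (Subtype.ext (eq_univ_of_blocks_connected π.2 (e.connected_iff.2 hH)))

/-- A connected graph `G` is determined up to isomorphism by `λ([G])`. -/
def lamType (k : Type*) [Field k] (x : lamConnected k) : ConnectedTypes :=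
  ConnectedTypes.mk x.2.choose.graph x.2.choose_spec.1

/-- Injectivity is the isomorphism invariance of `lam`. For surjectivity, the graph chosen to
represent `lam` of `H` need not be `H`, but the coefficient at the type of `H` makes it isomorphic
to `H`. -/
theorem lamType_bijective (k : Type*) [Field k] : Function.Bijective (lamType k) := by
  refine ⟨fun x y h => ?_, ?_⟩
  · obtain ⟨e⟩ := typeOf_eq_iff.1 (congrArg Subtype.val h)
    exact Subtype.ext
      (x.2.choose_spec.2.symm.trans ((lam_congr k e).trans y.2.choose_spec.2))
  · rintro ⟨t, V, _, H, hH, rfl⟩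
    let x : lamConnected k := ⟨lam k ⟨V, H⟩, ⟨V, H⟩, hH, rfl⟩
    refine ⟨x, Subtype.ext ?_⟩
    have hx := congrArg (· (typeOf H)) x.2.choose_spec.2
    have : Nonempty x.2.choose.V := x.2.choose_spec.1.nonempty
    have : Nonempty (FinGraph.mk V H).V := hH.nonempty
    by_contra hne
    have h0 := (lam_apply_typeOf k x.2.choose hH).trans (if_neg hne)
    have h1 := (lam_apply_typeOf k ⟨V, H⟩ hH).trans (if_pos rfl)
    exact zero_ne_one (h0.symm.trans (hx.trans h1))

/-- The bijection `λ([G]) ↦ [G]` for connected graphs `G`. -/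
def lamEquiv (k : Type*) [Field k] : lamConnected k ≃ ConnectedTypes :=
  Equiv.ofBijective _ (lamType_bijective k)

end GraphIncidence

/-! ### The theorem -/

/-- A linear equivalence induces an isomorphism of exterior algebras. -/
def ExteriorAlgebra.mapEquiv {k M N : Type*} [CommRing k] [AddCommGroup M] [Module k M]
    [AddCommGroup N] [Module k N] (e : M ≃ₗ[k] N) :
    ExteriorAlgebra k M ≃ₐ[k] ExteriorAlgebra k N :=
  AlgEquiv.ofAlgHom (ExteriorAlgebra.map e.toLinearMap) (ExteriorAlgebra.map e.symm.toLinearMap)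
    (by rw [ExteriorAlgebra.map_comp_map, LinearEquiv.comp_symm, ExteriorAlgebra.map_id])
    (by rw [ExteriorAlgebra.map_comp_map, LinearEquiv.symm_comp, ExteriorAlgebra.map_id])

theorem mainTheorem4 (k : Type*) [Field k] [CharZero k] :
    (∀ (p q : ℕ) (x : Hochschild.HH (GraphIncidence.augmentation k) p) (y : Hochschild.HH (GraphIncidence.augmentation k) q),
      (DirectSum.of (Hochschild.HH (GraphIncidence.augmentation k)) p x * DirectSum.of (Hochschild.HH (GraphIncidence.augmentation k)) q y :
          Hochschild.Cohomology (GraphIncidence.augmentation k)) =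
        (-1) ^ (p * q) *
          (DirectSum.of (Hochschild.HH (GraphIncidence.augmentation k)) q y * DirectSum.of (Hochschild.HH (GraphIncidence.augmentation k)) p x)) ∧
    ∃ ξ : GraphIncidence.lamConnected k → Hochschild.HH (GraphIncidence.augmentation k) 1,
      Function.Injective ξ ∧
      Algebra.adjoin k (Set.range fun c => DirectSum.of (Hochschild.HH (GraphIncidence.augmentation k)) 1 (ξ c)) =
        (⊤ : Subalgebra k (Hochschild.Cohomology (GraphIncidence.augmentation k))) ∧
      ∃ Φ : ExteriorAlgebra k (GraphIncidence.lamConnected k →₀ k) ≃ₐ[k] Hochschild.Cohomology (GraphIncidence.augmentation k),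
        ∀ c, Φ (ExteriorAlgebra.ι k (Finsupp.single c 1)) =
          DirectSum.of (Hochschild.HH (GraphIncidence.augmentation k)) 1 (ξ c) := by
  let C := GraphIncidence.coordinates k
  let E := GraphIncidence.lamEquiv k
  -- The generator labelled by `λ([G])` is the class of the 1-cocycle dual to the indicator function
  -- of `[G]`.
  refine ⟨C.graded_comm, fun c => C.gen (E c), C.gen_injective.comp E.injective, ?_,
    (ExteriorAlgebra.mapEquiv (Finsupp.domLCongr E)).trans C.exteriorEquiv, fun c => ?_⟩
  · exact (congrArg _ (EquivLike.range_comp (fun i => DirectSum.of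
      (Hochschild.HH (GraphIncidence.augmentation k)) 1 (C.gen i)) E)).trans C.adjoin_gen
  · refine Eq.trans (congrArg C.exteriorEquiv ?_) (C.exteriorEquiv_ι_single (E c))
    refine (ExteriorAlgebra.map_apply_ι _ _).trans (congrArg _ ?_)
    exact Finsupp.domLCongr_single E c 1

end
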